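/- **Conventions on words.** Let $F_n$ be the free group on $a_1,\dots,a_n$, regarded as the fundamental group of a bouquet $R_n$ of $n$ oriented circles labelled $a_1,\dots,a_n$. A word is *cyclically reduced* if it is reduced and its last and first letters are not inverse to each other. A finite list $U$ of words in $F_n$ is - *minimal* if no automorphism of $F_n$ reduces the sum of the lengths of the words in $U$, where words are taken up to conjugacy, i.e. the length of a word means the length of its cyclic reduction; - *diskbusting* if one cannot write $F_n=A*B$ with $A,B\neq\{1\}$ such that each word in $U$ is conjugate into $A$ or into $B$; - *polygonal* (for $U$ consisting of cyclically reduced words) if there are finitely many polygonal disks $P_1,\dots,P_m$ (disks whose boundary circle is subdivided into at least one side), a pairing of their sides together with a homeomorphism between the two sides of each pair, with quotient closed surface $S=\coprod_i P_i/\!\sim$, and a locally injective graph map $S^{(1)}\to R_n$ (each edge being mapped around exactly one circle) such that for each $i$ the closed curve $\partial P_i\to S^{(1)}\to R_n$ reads, from some starting point, $u^k$ for some word $u$ in $U$ and some integer $k\ne0$, and such that $\chi(S)<m$. **Tiling Conjecture in rank $n$.** Every minimal and diskbusting list of cyclically reduced words in $F_n$ is polygonal. **Conventions on graphs.** Graphs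 are finite and may have parallel edges and loops. The degree $\deg(v)$ counts loops twice, $\delta(v)$ is the set of non-loop edges incident with $v$, and for $x\ne y$, $\lambda(x,y)$ is the maximum number of pairwise edge-disjoint paths from $x$ to $y$. A cycle is a connected $2$-regular graph (so two parallel edges form a cycle of length $2$); a cycle of $G$ is a subgraph of $G$ that is a cycle. **Graph conjecture on $N$ vertices.** Let $G=(V,E)$ be a graph with $|V|=N$ that contains at least one cycle, let $\mu:V\to V$ be a fixed point free involution, and for each vertex $v$ let $\sigma_v:\delta(v)\to\delta(\mu(v))$ be a bijection, such that $\lambda(v,\mu(v))=\deg(v)$ and $\sigma_{\mu(v)}=\sigma_v^{-1}$ for every $v$. Then there is a nonempty finite list of cycles of $G$ such that for every vertex $v$ and every pair of distinct edges $e,f\in\delta(v)$, the number of cycles in the list containing both $e$ and $f$ equals the number of cycles in the list containing both $\sigma_v(e)$ and $\sigma_v(f)$; moreover, if $G$ has a connected component with at least four vertices, the list can be chosen to contain also at least one cycle of length greater than two. **Proposition.** Let $n'>1$. The Tiling Conjecture holds in all ranks $n=2,\dots,n'$ if and only if the graph conjecture holds on $N=2n'$ vertices. -/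

import Mathlib

namespace TilingConj

/-! ## Lists of words in the free group `F_n = FreeGroup (Fin n)` -/

section Words

variable {n : ℕ}

/-- The length of the cyclically reduced words conjugate to `g`. -/
def cyclicLength (g : FreeGroup (Fin n)) : ℕ :=
  (FreeGroup.reduceCyclically g.toWord).length

/-- No automorphism of `F_n` reduces the total length of the list; words are taken up to
conjugacy, so the length of a word is the length of its cyclic reduction. -/
def IsMinimal (U : List (FreeGroup (Fin n))) : Prop :=
  ∀ φ : FreeGroup (Fin n) ≃* FreeGroup (Fin n),
    (U.map cyclicLength).sum ≤ (U.map fun u => cyclicLength (φ u)).sum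

/-- The group `G` is the (internal) free product of its subgroups `A` and `B`. -/
def IsInternalFreeProduct {G : Type*} [Group G] (A B : Subgroup G) : Prop :=
  Function.Bijective (Monoid.Coprod.lift A.subtype B.subtype)

/-- `u` is conjugate to an element of `A`. -/
def ConjInto {G : Type*} [Group G] (u : G) (A : Subgroup G) : Prop :=
  ∃ g : G, g * u * g⁻¹ ∈ A

/-- There is no splitting `F_n = A * B` with `A, B ≠ 1` such that every word in the list is
conjugate into `A` or into `B`. -/
def IsDiskbusting (U : List (FreeGroup (Fin n))) : Prop :=
  ¬ ∃ A B : Subgroup (FreeGroup (Fin n)), IsInternalFreeProduct A B ∧ A ≠ ⊥ ∧ B ≠ ⊥ ∧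
    ∀ u ∈ U, ConjInto u A ∨ ConjInto u B

end Words

/-! ## Closed surfaces obtained from polygonal disks by a side-pairing -/

/-- A side-pairing on polygonal disks `P_0, …, P_{m-1}`. The boundary of each disk is given an
orientation, and its sides are listed in cyclic order along this orientation. -/
structure SidePairing where
  /-- the number of disks -/
  m : ℕ
  /-- the number of sides of each disk -/
  sides : Fin m → ℕ
  sides_pos : ∀ i, 0 < sides i
  /-- the side which a given side is glued to -/
  pair : (Σ i : Fin m, Fin (sides i)) → Σ i : Fin m, Fin (sides i)
  pair_ne : ∀ s, pair s ≠ s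
  pair_pair : ∀ s, pair (pair s) = s
  /-- whether the gluing homeomorphism reverses the chosen boundary orientations
  (a homeomorphism between two sides is determined by this up to isotopy) -/
  flip : (Σ i : Fin m, Fin (sides i)) → Bool
  flip_pair : ∀ s, flip (pair s) = flip s

namespace SidePairing

variable (S : SidePairing)

/-- The sides of the disks. -/
abbrev Side : Type := Σ i : Fin S.m, Fin (S.sides i)

/-- The side following `s` on the boundary of its disk. -/
def next (s : S.Side) : S.Side := ⟨s.1, finRotate _ s.2⟩

/-- An end of a side: `(s, false)` is the end at its initial corner, `(s, true)` the end at its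
terminal corner. -/
abbrev SideEnd : Type := S.Side × Bool

/-- The corner of the disk at an end of a side. The corner at the initial point of a side `s`
is denoted by `s` as well. -/
def corner (h : S.SideEnd) : S.Side := if h.2 then S.next h.1 else h.1

/-- The end of a side that is glued to a given end of a side. -/
def opp (h : S.SideEnd) : S.SideEnd := (S.pair h.1, xor h.2 (S.flip h.1))

/-- The vertices of the quotient surface: corners of the disks, modulo the gluing. -/
def Vertex : Type :=
  Quot fun c d : S.Side => ∃ h : S.SideEnd, c = S.corner h ∧ d = S.corner (S.opp h)

/-- The edges of the quotient surface: sides of the disks, modulo the pairing. -/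
def Edge : Type := Quot fun s t : S.Side => t = S.pair s

/-- The vertex of the quotient surface at an end of a side. -/
def vertexAt (h : S.SideEnd) : S.Vertex := Quot.mk _ (S.corner h)

/-- The Euler characteristic of the quotient surface, from its cell structure with one 2-cell
for each disk. -/
noncomputable def eulerChar : ℤ := (Nat.card S.Vertex : ℤ) - Nat.card S.Edge + S.m

end SidePairing

section Polygonal

variable {n : ℕ}

/-- A letter `a_i` is `(i, true)`, and its inverse is `(i, false)`. -/
def letterInv (x : Fin n × Bool) : Fin n × Bool := (x.1, !x.2)

/-- A graph map from the 1-skeleton of the surface to the bouquet `Cay(F_n)/F_n`, given by the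
letter that each side reads in the direction of the boundary orientation of its disk. -/
def IsGraphMap (S : SidePairing) (ℓ : S.Side → Fin n × Bool) : Prop :=
  ∀ s, ℓ (S.pair s) = if S.flip s then letterInv (ℓ s) else ℓ s

/-- The letter read along the edge when leaving the vertex at the given end of a side. -/
def outLetter (S : SidePairing) (ℓ : S.Side → Fin n × Bool) (h : S.SideEnd) : Fin n × Bool :=
  if h.2 then letterInv (ℓ h.1) else ℓ h.1

/-- The graph map is locally injective: two edge-ends at the same vertex of the surface with the
same image are equal. (An edge-end of the surface consists of the side-ends `h` and `opp h`.) -/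
def IsLocallyInjective (S : SidePairing) (ℓ : S.Side → Fin n × Bool) : Prop :=
  ∀ h h' : S.SideEnd, S.vertexAt h = S.vertexAt h' → outLetter S ℓ h = outLetter S ℓ h' →
    h' = h ∨ h' = S.opp h

/-- The word read along the boundary of the disk `P_i`. -/
def boundaryWord (S : SidePairing) (ℓ : S.Side → Fin n × Bool) (i : Fin S.m) :
    List (Fin n × Bool) :=
  List.ofFn fun j : Fin (S.sides i) => ℓ ⟨i, j⟩

/-- Polygonality of a list of cyclically reduced words. Since `u` is cyclically reduced, the
reduced word `(u ^ k).toWord` is the concatenation of `|k|` copies of the word `u` or of its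
inverse; a closed curve reads it if it does so from some starting point. -/
def IsPolygonal (U : List (FreeGroup (Fin n))) : Prop :=
  ∃ (S : SidePairing) (ℓ : S.Side → Fin n × Bool),
    IsGraphMap S ℓ ∧ IsLocallyInjective S ℓ ∧
    (∀ i : Fin S.m, ∃ u ∈ U, ∃ k : ℤ, k ≠ 0 ∧
      List.IsRotated (boundaryWord S ℓ i) (u ^ k).toWord) ∧
    S.eulerChar < S.m

end Polygonal

/-- The Tiling Conjecture for the free group of rank `n`. -/
def TilingConjecture (n : ℕ) : Prop :=
  ∀ U : List (FreeGroup (Fin n)), (∀ u ∈ U, FreeGroup.IsCyclicallyReduced u.toWord) →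
    IsMinimal U → IsDiskbusting U → IsPolygonal U

/-! ## Graphs, with parallel edges and loops allowed -/

section Graphs

open scoped Graph

variable {α β : Type*}

/-- The degree of a vertex, loops being counted twice. -/
noncomputable def degree (G : Graph α β) (v : α) : ℕ :=
  (G.incidenceSet v).ncard + (G.loopSet v).ncard

/-- The set `δ(v)` of non-loop edges incident with `v`. -/
def delta (G : Graph α β) (v : α) : Set β := {e | G.IsNonloopAt e v}

/-- The vertex set of the connected component containing `v`. -/
def component (G : Graph α β) (v : α) : Set α :=
  {w | w ∈ V(G) ∧ Relation.ReflTransGen G.Adj v w}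

/-- A cycle: a finite, connected, 2-regular graph. -/
structure IsCycle (C : Graph α β) : Prop where
  finite_vertices : V(C).Finite
  finite_edges : E(C).Finite
  nonempty : V(C).Nonempty
  connected : ∀ v ∈ V(C), component C v = V(C)
  two_regular : ∀ v ∈ V(C), degree C v = 2

/-- `C` is a cycle of the graph `G`. -/
def IsCycleOf (C G : Graph α β) : Prop := C ≤ G ∧ IsCycle C

/-- `IsWalk G x w y`: starting at `x` and following the successive (edge, next vertex) pairs
in `w` is a walk of `G` that ends at `y`. -/
inductive IsWalk (G : Graph α β) : α → List (β × α) → α → Prop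
  | nil {x : α} (hx : x ∈ V(G)) : IsWalk G x [] x
  | cons {x z y : α} {e : β} {w : List (β × α)} (h : G.IsLink e x z) (hw : IsWalk G z w y) :
      IsWalk G x ((e, z) :: w) y

/-- A path is a walk that visits no vertex twice. -/
def IsPath (G : Graph α β) (x : α) (w : List (β × α)) (y : α) : Prop :=
  IsWalk G x w y ∧ (x :: w.map Prod.snd).Nodup

/-- The local edge-connectivity `λ(x, y)` of distinct vertices: the maximum number of pairwise
edge-disjoint paths from `x` to `y`. -/
noncomputable def localEdgeConn (G : Graph α β) (x y : α) : ℕ :=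
  sSup {k : ℕ | ∃ P : Fin k → List (β × α), (∀ i, IsPath G x (P i) y) ∧
    Pairwise fun i j => List.Disjoint ((P i).map Prod.fst) ((P j).map Prod.fst)}

open Classical in
/-- The number of members of the list `L` containing both of the edges `e` and `f`. -/
noncomputable def countBoth (L : List (Graph α β)) (e f : β) : ℕ :=
  L.countP fun C => e ∈ E(C) ∧ f ∈ E(C)

/-- The graph-theoretic conjecture for (finite) graphs on `N` vertices. -/
def GraphConjecture (N : ℕ) : Prop :=
  ∀ (α β : Type) (G : Graph α β), V(G).Finite → E(G).Finite → V(G).ncard = N →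
    (∃ C, IsCycleOf C G) →
    ∀ (μ : α → α) (σ : α → β → β),
      (∀ v ∈ V(G), μ v ∈ V(G) ∧ μ v ≠ v ∧ μ (μ v) = v) →
      (∀ v ∈ V(G), Set.BijOn (σ v) (delta G v) (delta G (μ v))) →
      (∀ v ∈ V(G), localEdgeConn G v (μ v) = degree G v) →
      (∀ v ∈ V(G), ∀ e ∈ delta G v, σ (μ v) (σ v e) = e) →
      ∃ L : List (Graph α β), L ≠ [] ∧ (∀ C ∈ L, IsCycleOf C G) ∧
        (∀ v ∈ V(G), ∀ e ∈ delta G v, ∀ f ∈ delta G v, e ≠ f →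
          countBoth L e f = countBoth L (σ v e) (σ v f)) ∧
        ((∃ v ∈ V(G), 4 ≤ (component G v).ncard) → ∃ C ∈ L, 2 < E(C).ncard)

end Graphs

end TilingConj

/-! Both directions go through the Whitehead graph. Cyclically reduced words give a graph on the 2n
letters, with one edge for each position in a word, joining the letter read forwards to the letter
read backwards. Inversion of letters is the involution μ, and moving one step along a word
identifies the edges at a letter with those at its inverse, which is σ. Conversely, in a matched
graph one can follow σ from edge to edge; the closed lines obtained spell cyclically reduced words.
`LineSystem` encodes both situations. The condition λ(v, μ(v)) = deg(v) becomes `CutCondition`: a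
set of letters separating a letter from its inverse is crossed by at least as many edges as there
are at that letter.

Minimality corresponds to the cut condition. A Whitehead automorphism changes the total length by at
most the size of a cut minus a degree, so minimal lists satisfy the cut condition
(`cutCondition_of_isMinimal`), and Menger's theorem (`localEdgeConn_eq_of_cut`) turns this into a
statement about λ. The converse, `isMinimal_of_cutCondition`, is proved in the Cayley tree, using
functions that change across only finitely many tree edges. By `exists_lines`, at least as many
lifted lines have ends separated by such a function as there are Whitehead edges separated by it at
the root. The function is the pullback under the automorphism of one that changes across a single
tree edge labelled `a_j`; then the separated lines are bounded by the occurrences of `a_j` in the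
image words, and one sums over j.

Diskbusting corresponds to connectedness, given the cut condition. If the graph is disconnected, a
partition of the basis gives a splitting (`eq_empty_or_univ_of_isDiskbusting`). If it is connected,
`exists_lines` for a function coming from the Bass-Serre tree of a splitting excludes the splitting
(`isDiskbusting_of_cutCondition`).

Tilings correspond to balanced lists of cycles. By local injectivity the link of a vertex of the
surface is a cycle of the graph, up to degenerate links that can be dropped, and an edge of the
surface matches the pair of corners at one of its ends with the pair at the other, which is the
balance condition (`Dart.exists_list_of_tiling`). Conversely, balance allows cycles to be matched
letter by letter and glued to a surface (`CycleFamily.exists_surface`). As χ(S) < m means that there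
are fewer vertices than edges, it corresponds to a link with more than two corners.

For the ranks, a component with at least four vertices is lettered by some F_n with 2 ≤ n ≤ n', and
Whitehead graphs of smaller rank are padded with isolated vertices. If all components are smaller,
the cycles are written down directly (`IsMatched.exists_list_of_small`). -/

namespace TilingConj

/-! ### Letters and the Cayley tree -/

section FreeGroupLetters

variable {n : ℕ}

/-- The element of the free group given by a letter. -/
def letterElt (x : Fin n × Bool) : FreeGroup (Fin n) := FreeGroup.mk [x]

@[simp] theorem letterInv_letterInv (x : Fin n × Bool) : letterInv (letterInv x) = x := by
  simp [letterInv]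

theorem letterInv_ne (x : Fin n × Bool) : letterInv x ≠ x := by
  rcases x with ⟨i, b⟩; cases b <;> simp [letterInv]

theorem letterInv_injective : Function.Injective (letterInv : Fin n × Bool → _) :=
  Function.LeftInverse.injective letterInv_letterInv

theorem letterElt_letterInv (x : Fin n × Bool) : letterElt (letterInv x) = (letterElt x)⁻¹ := by
  simp [letterElt, letterInv, FreeGroup.inv_mk, FreeGroup.invRev]

@[simp] theorem letterElt_mul_letterInv (x : Fin n × Bool) :
    letterElt x * letterElt (letterInv x) = 1 := by simp [letterElt_letterInv]

theorem norm_letterElt_pow (x : Fin n × Bool) (k : ℕ) : (letterElt x ^ k).norm = k := by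
  rcases x with ⟨i, b⟩
  cases b
  · have : letterElt (i, false) = (FreeGroup.of i)⁻¹ := by
      simp [letterElt, FreeGroup.of, FreeGroup.inv_mk, FreeGroup.invRev]
    rw [this, inv_pow, FreeGroup.norm_inv_eq, FreeGroup.norm_of_pow]
  · exact FreeGroup.norm_of_pow i k

theorem norm_letterElt (x : Fin n × Bool) : (letterElt x).norm = 1 := by
  simpa using norm_letterElt_pow x 1

/-- The letter leading from the vertex `g` of the Cayley tree towards the root `1`. -/
def back (g : FreeGroup (Fin n)) : Option (Fin n × Bool) := g.toWord.getLast?.map letterInv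

theorem back_one : back (1 : FreeGroup (Fin n)) = none := by simp [back]

theorem eq_one_of_back (g : FreeGroup (Fin n)) (h : back g = none) : g = 1 := by
  simpa [back] using h

theorem toWord_mul_letterElt_of_ne {g : FreeGroup (Fin n)} {x : Fin n × Bool}
    (h : back g ≠ some x) : (g * letterElt x).toWord = g.toWord ++ [x] := by
  have h1 : FreeGroup.IsReduced (g.toWord ++ [x]) := by
    have h2 : FreeGroup.IsReduced g.toWord := FreeGroup.isReduced_toWord
    rw [FreeGroup.IsReduced, List.isChain_append]
    refine ⟨h2, by simp, ?_⟩
    intro a ha b hb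
    simp only [List.head?_cons, Option.mem_some_iff] at hb
    subst hb
    intro hab
    by_contra hne
    apply h
    rw [Option.mem_def] at ha
    simp only [back, ha, Option.map_some, letterInv, Option.some.injEq]
    ext
    · simp [hab]
    · revert hne; cases a.2 <;> cases x.2 <;> simp
  rw [FreeGroup.toWord_mul, letterElt, FreeGroup.toWord_mk, FreeGroup.reduce_singleton,
    h1.reduce_eq]

theorem norm_mul_letterElt_of_ne {g : FreeGroup (Fin n)} {x : Fin n × Bool}
    (h : back g ≠ some x) : (g * letterElt x).norm = g.norm + 1 := by
  simp [FreeGroup.norm, toWord_mul_letterElt_of_ne h]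

theorem back_mul_letterElt_of_ne {g : FreeGroup (Fin n)} {x : Fin n × Bool}
    (h : back g ≠ some x) : back (g * letterElt x) = some (letterInv x) := by
  simp [back, toWord_mul_letterElt_of_ne h]

theorem finite_norm_le (R : ℕ) : {g : FreeGroup (Fin n) | g.norm ≤ R}.Finite :=
  Set.Finite.of_finite_image ((List.finite_length_le (Fin n × Bool) R).subset (by
    rintro _ ⟨g, hg, rfl⟩; exact hg)) FreeGroup.toWord_injective.injOn

end FreeGroupLetters

/-! ### Values of almost constant functions along rays of the tree -/

section Rays

variable {n : ℕ} {τ : Type*} {p : FreeGroup (Fin n) → τ} {R : ℕ}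

/-- Only finitely many vertices see a change of `p` across an adjacent edge, and `R` lies beyond
their norms. -/
theorem exists_radius (hp : ∀ x, {g | p (g * letterElt x) ≠ p g}.Finite) :
    ∃ R, ∀ g x, R ≤ g.norm → p (g * letterElt x) = p g := by
  obtain ⟨R, hR⟩ := ((Set.finite_iUnion hp).image FreeGroup.norm).bddAbove
  refine ⟨R + 1, fun g x hg => ?_⟩
  by_contra hne
  have := hR ⟨g, Set.mem_iUnion.2 ⟨x, hne⟩, rfl⟩
  omega

/-- The eventual value of `p` along the ray `g, g x, g x², …`, if `p` is locally constant outside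
the ball of radius `R`. -/
def rayValue (p : FreeGroup (Fin n) → τ) (R : ℕ) (g : FreeGroup (Fin n)) (x : Fin n × Bool) : τ :=
  p (g * letterElt x ^ (g.norm + R))

/-- By the triangle inequality `g * x ^ K` has norm at least `K - g.norm`, so it is outside the ball
once `K ≥ g.norm + R`, and the value no longer changes. This explains the exponent in `rayValue`. -/
theorem apply_mul_pow (hR : ∀ g x, R ≤ g.norm → p (g * letterElt x) = p g)
    (g : FreeGroup (Fin n)) (x : Fin n × Bool) {K : ℕ} (hK : g.norm + R ≤ K) :
    p (g * letterElt x ^ K) = rayValue p R g x := by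
  induction K, hK using Nat.le_induction with
  | base => rfl
  | succ K hK ih =>
    rw [pow_succ, ← mul_assoc, hR _ _ _, ih]
    have h1 := FreeGroup.norm_mul_le g⁻¹ (g * letterElt x ^ K)
    rw [inv_mul_cancel_left, norm_letterElt_pow, FreeGroup.norm_inv_eq] at h1
    omega

/-- The two rays share a tail. -/
theorem rayValue_mul (hR : ∀ g x, R ≤ g.norm → p (g * letterElt x) = p g)
    (g : FreeGroup (Fin n)) (x : Fin n × Bool) :
    rayValue p R (g * letterElt x) x = rayValue p R g x := by
  rw [← apply_mul_pow hR g x (K := (g * letterElt x).norm + R + g.norm + 1) (by omega),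
    ← apply_mul_pow hR (g * letterElt x) x (K := (g * letterElt x).norm + R + g.norm) (by omega),
    mul_assoc, ← pow_succ']

/-- A step that does not lead back increases the norm and leaves the way back behind it, so the ray
never re-enters the ball. -/
theorem rayValue_of_le (hR : ∀ g x, R ≤ g.norm → p (g * letterElt x) = p g)
    {g : FreeGroup (Fin n)} {x : Fin n × Bool} (hg : R ≤ g.norm) (hx : back g ≠ some x) :
    rayValue p R g x = p g := by
  have h : ∀ K : ℕ, p (g * letterElt x ^ K) = p g ∧ R ≤ (g * letterElt x ^ K).norm ∧
      back (g * letterElt x ^ K) ≠ some x := by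
    intro K
    induction K with
    | zero => simpa using ⟨hg, hx⟩
    | succ K ih =>
      obtain ⟨h1, h2, h3⟩ := ih
      rw [pow_succ, ← mul_assoc, hR _ _ h2, h1, norm_mul_letterElt_of_ne h3,
        back_mul_letterElt_of_ne h3]
      exact ⟨rfl, by omega, by simpa using letterInv_ne x⟩
  exact (h _).1

end Rays

/-! ### Line systems and their lifts to the Cayley tree -/

/-- Cyclically reduced cyclic words: `E` is the set of positions, `nxt` sends a position to the next
one, and `hd e` is the letter read from the position `e` to the position `nxt e`. -/
structure LineSystem (n : ℕ) (E : Type*) where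
  nxt : Equiv.Perm E
  hd : E → Fin n × Bool
  hd_nxt_ne : ∀ e, hd (nxt e) ≠ letterInv (hd e)

namespace LineSystem

open Filter

variable {n : ℕ} {E : Type*} (D : LineSystem n E)

/-- The letter read backwards from the position `e`. The position `e` gives an edge from `tl e` to
`hd e` of the Whitehead graph. -/
def tl (e : E) : Fin n × Bool := letterInv (D.hd (D.nxt.symm e))

theorem tl_nxt (e : E) : D.tl (D.nxt e) = letterInv (D.hd e) := by simp [tl]

theorem hd_nxt_symm (e : E) : D.hd (D.nxt.symm e) = letterInv (D.tl e) := by simp [tl]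

theorem hd_ne_tl (e : E) : D.hd e ≠ D.tl e := by
  simpa [tl] using D.hd_nxt_ne (D.nxt.symm e)

/-- The words read backwards. -/
def reverse : LineSystem n E where
  nxt := D.nxt.symm
  hd := D.tl
  hd_nxt_ne e h := by
    have := D.hd_ne_tl (D.nxt.symm e)
    rw [h, hd_nxt_symm] at this
    exact this rfl

@[simp] theorem reverse_hd (e : E) : D.reverse.hd e = D.tl e := rfl

@[simp] theorem reverse_tl (e : E) : D.reverse.tl e = D.hd e := by
  change letterInv (D.tl (D.nxt e)) = _
  simp [tl_nxt]

/-- Moving one step along the lifts of the words to the Cayley tree. -/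
def step : Equiv.Perm (FreeGroup (Fin n) × E) where
  toFun x := (x.1 * letterElt (D.hd x.2), D.nxt x.2)
  invFun x := (x.1 * letterElt (D.tl x.2), D.nxt.symm x.2)
  left_inv x := by simp [tl_nxt, mul_assoc]
  right_inv x := by simp [hd_nxt_symm, mul_assoc]

theorem step_apply (x : FreeGroup (Fin n) × E) :
    D.step x = (x.1 * letterElt (D.hd x.2), D.nxt x.2) := rfl

theorem reverse_step : D.reverse.step = D.step⁻¹ := by
  ext x <;> rfl

/-- The two ends of the line through `x` have different `p`-values. -/
def EndsDiffer {τ : Type*} (p : FreeGroup (Fin n) → τ) (x : FreeGroup (Fin n) × E) : Prop :=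
  ∃ K : ℕ, ∀ k l : ℕ, K ≤ k → K ≤ l → p ((D.step ^ k) x).1 ≠ p ((D.step⁻¹ ^ l) x).1

/-- Every set of letters separating `letterInv x` from `x` is crossed by at least as many edges of
the Whitehead graph as there are at `x`. -/
def CutCondition : Prop :=
  ∀ (x : Fin n × Bool) (X : Set (Fin n × Bool)), x ∉ X → letterInv x ∈ X →
    {e | D.tl e = x ∨ D.hd e = x}.ncard ≤ {e | ¬ (D.tl e ∈ X ↔ D.hd e ∈ X)}.ncard

section Forward

variable {D}

/-- Lines are geodesics: since `hd` and `tl` differ at every position, a line that moves away from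
the root has the way back behind it and must move away again. -/
theorem step_forward {x : FreeGroup (Fin n) × E} (hx : back x.1 ≠ some (D.hd x.2)) (k : ℕ) :
    ((D.step ^ k) x).1.norm = x.1.norm + k ∧
    back ((D.step ^ k) x).1 ≠ some (D.hd ((D.step ^ k) x).2) ∧
    back ((D.step ^ (k + 1)) x).1 = some (D.tl ((D.step ^ (k + 1)) x).2) := by
  induction k with
  | zero =>
    refine ⟨by simp, by simpa using hx, ?_⟩
    simp [step, back_mul_letterElt_of_ne hx, tl_nxt]
  | succ k ih =>
    obtain ⟨h1, h2, h3⟩ := ih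
    have h4 : back ((D.step ^ (k + 1)) x).1 ≠ some (D.hd ((D.step ^ (k + 1)) x).2) := by
      rw [h3]
      simpa using (D.hd_ne_tl _).symm
    refine ⟨?_, h4, ?_⟩
    · rw [pow_succ', Equiv.Perm.mul_apply]
      simp [step_apply, norm_mul_letterElt_of_ne h2, h1, add_assoc]
    · rw [pow_succ', Equiv.Perm.mul_apply]
      simp [step_apply, back_mul_letterElt_of_ne h4, tl_nxt]

variable {τ : Type*} {p : FreeGroup (Fin n) → τ} {R : ℕ}

/-- The ray in the direction of travel becomes, one step later, the ray straight on
(`rayValue_mul`), and `hm` says that turning from there into the new direction keeps the value. So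
the value is carried along the line, and beyond radius `R` it is the value of `p` itself. -/
theorem eventually_forward (hR : ∀ g x, R ≤ g.norm → p (g * letterElt x) = p g)
    {x : FreeGroup (Fin n) × E} (hx : back x.1 ≠ some (D.hd x.2))
    (hm : ∀ y, Equiv.Perm.SameCycle D.step x y → back y.1 = some (D.tl y.2) →
      rayValue p R y.1 (D.hd y.2) = rayValue p R y.1 (letterInv (D.tl y.2))) :
    ∀ᶠ k : ℕ in atTop, p ((D.step ^ k) x).1 = rayValue p R x.1 (D.hd x.2) := by
  have h : ∀ k : ℕ, rayValue p R ((D.step ^ k) x).1 (D.hd ((D.step ^ k) x).2) =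
      rayValue p R x.1 (D.hd x.2) := by
    intro k
    induction k with
    | zero => simp
    | succ k ih =>
      rw [hm _ ⟨(k + 1 : ℕ), by simp only [zpow_natCast]⟩ (step_forward hx k).2.2, ← ih, pow_succ',
        Equiv.Perm.mul_apply]
      simp only [step, Equiv.coe_fn_mk, tl_nxt, letterInv_letterInv]
      exact rayValue_mul hR _ _
  filter_upwards [eventually_ge_atTop R] with k hk
  rw [← h k, rayValue_of_le hR _ (step_forward hx k).2.1]
  rw [(step_forward hx k).1]
  omega

end Forward

variable {D}

theorem sameCycle_reverse_iff {x y : FreeGroup (Fin n) × E} :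
    Equiv.Perm.SameCycle D.reverse.step x y ↔ Equiv.Perm.SameCycle D.step x y := by
  rw [reverse_step, Equiv.Perm.sameCycle_inv]

/-- A geodesic of a tree has only one point nearest to the root: away from such a point, the way
back always runs along the line. -/
theorem eq_of_sameCycle_of_nearest {x y : FreeGroup (Fin n) × E}
    (h : Equiv.Perm.SameCycle D.step x y)
    (hx : back x.1 ≠ some (D.tl x.2) ∧ back x.1 ≠ some (D.hd x.2))
    (hy : back y.1 ≠ some (D.tl y.2) ∧ back y.1 ≠ some (D.hd y.2)) : x = y := by
  obtain ⟨i, hi⟩ := h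
  rcases i with (_ | k) | k
  · simpa using hi
  · exfalso
    apply hy.1
    rw [← hi]
    exact (step_forward hx.2 k).2.2
  · exfalso
    apply hy.2
    have := (step_forward (D := D.reverse) (x := x) hx.1 k).2.2
    rw [reverse_step, reverse_tl, inv_pow] at this
    rw [← hi, zpow_negSucc]
    exact this

/-! ### Counting lines with separated ends -/

section Count

variable {τ : Type*} {p : FreeGroup (Fin n) → τ} {R : ℕ}

/-- The letters at `g` whose rays have the same value as the ray straight away from the root. -/
def sideSet (p : FreeGroup (Fin n) → τ) (R : ℕ) (t : τ) (g : FreeGroup (Fin n)) :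
    Set (Fin n × Bool) :=
  {x | back g ≠ some x ∧
    rayValue p R g x = ((back g).map fun z => rayValue p R g (letterInv z)).getD t}

theorem mem_sideSet {t : τ} {g : FreeGroup (Fin n)} {x : Fin n × Bool} :
    x ∈ sideSet p R t g ↔ back g ≠ some x ∧
      rayValue p R g x = ((back g).map fun z => rayValue p R g (letterInv z)).getD t := Iff.rfl

open Classical in
/-- The contribution of a point of a line to the difference of the values at the two ends. -/
noncomputable def defect (D : LineSystem n E) (p : FreeGroup (Fin n) → τ) (R : ℕ) (t : τ)
    (x : FreeGroup (Fin n) × E) : ℤ :=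
  (if D.tl x.2 ∈ sideSet p R t x.1 ↔ D.hd x.2 ∈ sideSet p R t x.1 then 0 else 1) -
    if back x.1 = some (D.tl x.2) ∨ back x.1 = some (D.hd x.2) then 1 else 0

theorem defect_reverse (t : τ) (x : FreeGroup (Fin n) × E) :
    D.reverse.defect p R t x = D.defect p R t x := by
  classical
  unfold defect
  congr 1
  · exact if_congr (by rw [reverse_tl, reverse_hd]; exact iff_comm) rfl rfl
  · exact if_congr (by rw [reverse_tl, reverse_hd]; exact or_comm) rfl rfl

/-- The side set omits the letter leading back, so the edge crosses it exactly when `D.hd` belongs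
to it. A crossing cancels the 1 subtracted for the letter leading back; if there is none, the line
turns to a ray with another value and -1 remains. -/
theorem defect_of_back_eq_tl {t : τ} {x : FreeGroup (Fin n) × E} (h : back x.1 = some (D.tl x.2)) :
    D.defect p R t x ≤ 0 ∧ (D.defect p R t x = -1 ∨
      rayValue p R x.1 (D.hd x.2) = rayValue p R x.1 (letterInv (D.tl x.2))) := by
  have h1 : D.tl x.2 ∉ sideSet p R t x.1 := by simp [sideSet, h]
  have h2 : D.hd x.2 ∈ sideSet p R t x.1 ↔
      rayValue p R x.1 (D.hd x.2) = rayValue p R x.1 (letterInv (D.tl x.2)) := by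
    simp [sideSet, h, (D.hd_ne_tl x.2).symm]
  simp only [defect, h1, h, h2, true_or, if_true, false_iff]
  split_ifs with h3 <;> simp_all

theorem defect_of_back_eq_hd {t : τ} {x : FreeGroup (Fin n) × E} (h : back x.1 = some (D.hd x.2)) :
    D.defect p R t x ≤ 0 ∧ (D.defect p R t x = -1 ∨
      rayValue p R x.1 (D.tl x.2) = rayValue p R x.1 (letterInv (D.hd x.2))) := by
  have := defect_of_back_eq_tl (D := D.reverse) (p := p) (R := R) (t := t) (x := x)
    (by rwa [reverse_tl])
  simpa only [defect_reverse, reverse_tl, reverse_hd] using this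

/-- Nothing is subtracted at the nearest point, so the defect only records whether its two
directions lie on different sides. -/
theorem defect_of_nearest {t : τ} {x : FreeGroup (Fin n) × E}
    (h : back x.1 ≠ some (D.tl x.2) ∧ back x.1 ≠ some (D.hd x.2)) :
    D.defect p R t x = 0 ∨ (D.defect p R t x = 1 ∧
      rayValue p R x.1 (D.tl x.2) ≠ rayValue p R x.1 (D.hd x.2)) := by
  simp only [defect, mem_sideSet, h.1, h.2, ne_eq, not_false_eq_true, true_and,
    or_self, if_false, sub_zero]
  split_ifs with h3
  · exact Or.inl rfl
  · exact Or.inr ⟨rfl, fun h4 => h3 (by simp only [mem_sideSet, h.1, h.2, h4, ne_eq, not_false_eq_true])⟩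

/-- Beyond radius `R` all outward rays have the value `p x.1`, so the side set consists of all
letters but the one leading back. An edge crosses it exactly when it is at that letter, and the two
terms cancel. -/
theorem defect_eq_zero (hR : ∀ g x, R ≤ g.norm → p (g * letterElt x) = p g) {t : τ}
    {x : FreeGroup (Fin n) × E} (hx : R < x.1.norm) : D.defect p R t x = 0 := by
  have hb : ∃ z, back x.1 = some z := by
    rw [← Option.isSome_iff_exists, Option.isSome_iff_ne_none]
    intro h
    rw [eq_one_of_back _ h] at hx
    simp at hx
  obtain ⟨z, hz⟩ := hb
  have h1 : ∀ y, y ∈ sideSet p R t x.1 ↔ back x.1 ≠ some y := by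
    intro y
    simp only [mem_sideSet, and_iff_left_iff_imp]
    intro hy
    rw [rayValue_of_le hR hx.le hy, hz, Option.map_some, Option.getD_some,
      rayValue_of_le hR hx.le]
    rw [hz]
    simpa using (letterInv_ne z).symm
  simp only [defect, h1]
  have := D.hd_ne_tl x.2
  by_cases h2 : back x.1 = some (D.tl x.2) <;> by_cases h3 : back x.1 = some (D.hd x.2) <;>
    simp_all

theorem sum_defect [Fintype E] (g : FreeGroup (Fin n)) (t : τ) :
    ∑ e, D.defect p R t (g, e) =
      ({e | ¬ (D.tl e ∈ sideSet p R t g ↔ D.hd e ∈ sideSet p R t g)}.ncard : ℤ) -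
      {e | back g = some (D.tl e) ∨ back g = some (D.hd e)}.ncard := by
  classical
  simp only [defect, Finset.sum_sub_distrib]
  congr 1
  · rw [Set.ncard_eq_toFinset_card', Finset.card_eq_sum_ones, Nat.cast_sum, Set.toFinset_ofPred,
      Finset.sum_filter]
    exact Finset.sum_congr rfl fun e _ => by split_ifs <;> simp
  · rw [Set.ncard_eq_toFinset_card', Finset.card_eq_sum_ones, Nat.cast_sum, Set.toFinset_ofPred,
      Finset.sum_filter]
    simp

/-- This is the cut condition for the side set, which omits the letter leading back and contains its
inverse. -/
theorem sum_defect_nonneg [Fintype E] (hD : D.CutCondition) {g : FreeGroup (Fin n)} (hg : g ≠ 1) (t : τ) :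
    0 ≤ ∑ e, D.defect p R t (g, e) := by
  have hb : ∃ z, back g = some z := by
    rw [← Option.isSome_iff_exists, Option.isSome_iff_ne_none]
    exact fun h => hg (eq_one_of_back _ h)
  obtain ⟨z, hz⟩ := hb
  have := hD z (sideSet p R t g) (by simp [sideSet, hz])
    (by simp [sideSet, hz, (letterInv_ne z).symm])
  rw [sum_defect, hz]
  simp only [Option.some.injEq, eq_comm (a := z)]
  omega

/-- Without a defect -1 the two different ray values at the nearest point would be carried unchanged
to the two ends of the line. -/
theorem exists_defect_neg (hR : ∀ g x, R ≤ g.norm → p (g * letterElt x) = p g) {t : τ}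
    {x : FreeGroup (Fin n) × E} (hx : D.defect p R t x = 1) (hnd : ¬ D.EndsDiffer p x) :
    ∃ y, Equiv.Perm.SameCycle D.step x y ∧ D.defect p R t y = -1 := by
  by_contra! hno
  have h1 : back x.1 ≠ some (D.tl x.2) := fun h => by
    have := (defect_of_back_eq_tl (p := p) (R := R) (t := t) h).1; omega
  have h2 : back x.1 ≠ some (D.hd x.2) := fun h => by
    have := (defect_of_back_eq_hd (p := p) (R := R) (t := t) h).1; omega
  have h3 := (defect_of_nearest (p := p) (R := R) (t := t) ⟨h1, h2⟩).resolve_left (by omega)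
  apply hnd
  have hf := eventually_forward hR h2 fun y hy hb =>
    (defect_of_back_eq_tl (p := p) (R := R) (t := t) hb).2.resolve_left (hno y hy)
  have hb := eventually_forward (D := D.reverse) hR (x := x) h1 fun y hy hb => by
    rw [reverse_tl] at hb ⊢
    exact (defect_of_back_eq_hd (p := p) (R := R) (t := t) hb).2.resolve_left
      (hno y (sameCycle_reverse_iff.1 hy))
  rw [reverse_step] at hb
  obtain ⟨K, hK⟩ := eventually_atTop.1 hf
  obtain ⟨K', hK'⟩ := eventually_atTop.1 hb
  refine ⟨max K K', fun k l hk hl => ?_⟩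
  rw [hK k (by omega), hK' l (by omega)]
  exact h3.2.symm

/-- Sum the defects over all points of all lines. Vertex by vertex, the root contributes the number
of Whitehead edges told apart by `t`, and every other vertex a nonnegative amount. Line by line,
only the nearest point can contribute +1, and a -1 compensates for it unless the ends differ. `T`
collects the uncompensated nearest points. -/
theorem exists_lines [Fintype E] (hD : D.CutCondition)
    (hR : ∀ g x, R ≤ g.norm → p (g * letterElt x) = p g) (t : τ) :
    ∃ T : Finset (FreeGroup (Fin n) × E), (∀ x ∈ T, D.EndsDiffer p x) ∧
      (∀ x ∈ T, ∀ y ∈ T, Equiv.Perm.SameCycle D.step x y → x = y) ∧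
      {e | ¬ (rayValue p R 1 (D.tl e) = t ↔ rayValue p R 1 (D.hd e) = t)}.ncard ≤ T.card := by
  classical
  set B : Finset (FreeGroup (Fin n)) := (finite_norm_le R).toFinset with hB
  set Ω : Finset (FreeGroup (Fin n) × E) := B ×ˢ Finset.univ with hΩ
  have hmem : ∀ x, D.defect p R t x ≠ 0 → x ∈ Ω := by
    intro x hx
    have : x.1.norm ≤ R := by
      by_contra h
      exact hx (defect_eq_zero hR (by omega))
    simp [hΩ, hB, this]
  have htot : ({e | ¬ (rayValue p R 1 (D.tl e) = t ↔ rayValue p R 1 (D.hd e) = t)}.ncard : ℤ) ≤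
      ∑ x ∈ Ω, D.defect p R t x := by
    rw [hΩ, Finset.sum_product, ← Finset.add_sum_erase B _ (a := 1) (by simp [hB])]
    have h1 : ∑ e, D.defect p R t (1, e) =
        ({e | ¬ (rayValue p R 1 (D.tl e) = t ↔ rayValue p R 1 (D.hd e) = t)}.ncard : ℤ) := by
      rw [sum_defect]
      simp [sideSet, back_one]
    rw [h1]
    have h2 : 0 ≤ ∑ g ∈ B.erase 1, ∑ e, D.defect p R t (g, e) :=
      Finset.sum_nonneg fun g hg => sum_defect_nonneg hD (Finset.ne_of_mem_erase hg) t
    linarith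
  have hcase : ∀ x, D.defect p R t x = -1 ∨ D.defect p R t x = 0 ∨ (D.defect p R t x = 1 ∧
      back x.1 ≠ some (D.tl x.2) ∧ back x.1 ≠ some (D.hd x.2)) := by
    intro x
    by_cases h1 : back x.1 = some (D.tl x.2)
    · have h := (defect_of_back_eq_tl (p := p) (R := R) (t := t) h1).1
      have : -1 ≤ D.defect p R t x := by
        simp only [defect]; split_ifs <;> simp
      omega
    by_cases h2 : back x.1 = some (D.hd x.2)
    · have h := (defect_of_back_eq_hd (p := p) (R := R) (t := t) h2).1
      have : -1 ≤ D.defect p R t x := by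
        simp only [defect]; split_ifs <;> simp
      omega
    rcases defect_of_nearest (p := p) (R := R) (t := t) ⟨h1, h2⟩ with h | h
    · exact Or.inr (Or.inl h)
    · exact Or.inr (Or.inr ⟨h.1, h1, h2⟩)
  have hnear : ∀ x, D.defect p R t x = 1 →
      back x.1 ≠ some (D.tl x.2) ∧ back x.1 ≠ some (D.hd x.2) := by
    intro x hx
    rcases hcase x with h | h | h
    · omega
    · omega
    · exact h.2
  refine ⟨Ω.filter fun x => D.defect p R t x = 1 ∧ D.EndsDiffer p x, ?_, ?_, ?_⟩
  · intro x hx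
    exact (Finset.mem_filter.1 hx).2.2
  · intro x hx y hy hxy
    exact eq_of_sameCycle_of_nearest hxy (hnear x (Finset.mem_filter.1 hx).2.1)
      (hnear y (Finset.mem_filter.1 hy).2.1)
  -- Different lines are compensated at different points, because a line has only one nearest point.
  · choose f hf1 hf2 using fun (x : FreeGroup (Fin n) × E)
      (h : D.defect p R t x = 1 ∧ ¬ D.EndsDiffer p x) => exists_defect_neg hR h.1 h.2
    have hcard : (Ω.filter fun x => D.defect p R t x = 1 ∧ ¬ D.EndsDiffer p x).card ≤
        (Ω.filter fun x => D.defect p R t x = -1).card := by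
      refine Finset.card_le_card_of_injOn
        (fun x => if h : D.defect p R t x = 1 ∧ ¬ D.EndsDiffer p x then f x h else x) ?_ ?_
      · intro x hx
        have hx' := (Finset.mem_filter.1 (Finset.mem_coe.1 hx)).2
        simp only [hx', not_false_eq_true, and_self, dif_pos]
        exact Finset.mem_coe.2 (Finset.mem_filter.2 ⟨hmem _ (by rw [hf2]; decide), hf2 _ _⟩)
      · intro x hx y hy hxy
        have hx' := (Finset.mem_filter.1 (Finset.mem_coe.1 hx)).2
        have hy' := (Finset.mem_filter.1 (Finset.mem_coe.1 hy)).2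
        simp only [hx', hy', not_false_eq_true, and_self, dif_pos] at hxy
        have h1 := hf1 x hx'
        rw [hxy] at h1
        exact eq_of_sameCycle_of_nearest (h1.trans (hf1 y hy').symm) (hnear x hx'.1)
          (hnear y hy'.1)
    have hsum : ∑ x ∈ Ω, D.defect p R t x ≤
        ((Ω.filter fun x => D.defect p R t x = 1 ∧ D.EndsDiffer p x).card : ℤ) +
        (Ω.filter fun x => D.defect p R t x = 1 ∧ ¬ D.EndsDiffer p x).card -
        (Ω.filter fun x => D.defect p R t x = -1).card := by
      simp only [Finset.card_filter, Nat.cast_sum]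
      rw [← Finset.sum_add_distrib, ← Finset.sum_sub_distrib]
      refine Finset.sum_le_sum fun x _ => ?_
      rcases hcase x with h | h | h <;> by_cases hd : D.EndsDiffer p x <;> simp [h, hd]
    have : ({e | ¬ (rayValue p R 1 (D.tl e) = t ↔
        rayValue p R 1 (D.hd e) = t)}.ncard : ℤ) ≤
        ((Ω.filter fun x => D.defect p R t x = 1 ∧ D.EndsDiffer p x).card : ℤ) := by
      have : ((Ω.filter fun x => D.defect p R t x = 1 ∧ ¬ D.EndsDiffer p x).card : ℤ) ≤
        (Ω.filter fun x => D.defect p R t x = -1).card := by exact_mod_cast hcard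
      linarith
    exact_mod_cast this

end Count

end LineSystem

/-! ### Functions crossing a single tree edge -/

section Cosets

/-- A finitely supported function on a torsion-free group with nonzero sum has nonzero sum on some
left coset of the cyclic group generated by `w`. -/
theorem exists_coset_sum_ne_zero {F : Type*} [Group F] [IsMulTorsionFree F] {w : F} (hw : w ≠ 1)
    {f : F → ℤ} (hf : f.support.Finite) (hs : ∑ᶠ h, f h ≠ 0) :
    ∃ (g : F) (K₀ : ℕ), ∀ K : ℕ, K₀ ≤ K →
      ∑ i ∈ Finset.range (2 * K), f (g * w ^ ((i : ℤ) - K)) ≠ 0 := by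
  classical
  have hinj : ∀ g : F, Function.Injective fun k : ℤ => g * w ^ k := fun g k l h =>
    injective_zpow_iff_not_isOfFinOrder.2 (not_isOfFinOrder_of_isMulTorsionFree hw)
      (mul_left_cancel h)
  -- Group the sum by left cosets of the cyclic group; some coset has nonzero sum. As the support is
  -- finite and `w` has infinite order, a long symmetric range of exponents sees all of the support
  -- on that coset.
  rw [finsum_eq_sum f hf, ← Finset.sum_fiberwise_of_maps_to
    (t := hf.toFinset.image fun h : F => (QuotientGroup.mk h : F ⧸ Subgroup.zpowers w))
    (fun h hh => Finset.mem_image_of_mem _ hh)] at hs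
  obtain ⟨q, -, hq⟩ := Finset.exists_ne_zero_of_sum_ne_zero hs
  obtain ⟨g, rfl⟩ := QuotientGroup.mk_surjective q
  have hfin : {k : ℤ | g * w ^ k ∈ f.support}.Finite := hf.preimage (hinj g).injOn
  obtain ⟨b, hb⟩ := hfin.bddAbove
  obtain ⟨a, ha⟩ := hfin.bddBelow
  refine ⟨g, a.natAbs + b.natAbs + 1, fun K hK => ?_⟩
  convert hq using 1
  have hinj' : Set.InjOn (fun i : ℕ => g * w ^ ((i : ℤ) - K)) (Finset.range (2 * K)) := by
    intro i _ j _ hij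
    have : (i : ℤ) - K = j - K := hinj g hij
    omega
  rw [← Finset.sum_image (g := fun i : ℕ => g * w ^ ((i : ℤ) - K)) (f := f) hinj']
  symm
  apply Finset.sum_subset_zero_on_sdiff
  · intro h hh
    obtain ⟨hh1, hh2⟩ := Finset.mem_filter.1 hh
    obtain ⟨k, hk⟩ := Subgroup.mem_zpowers_iff.1 (QuotientGroup.eq.1 hh2.symm)
    have hk' : h = g * w ^ k := by rw [hk]; group
    have hk2 : k ∈ {k : ℤ | g * w ^ k ∈ f.support} := by
      rw [Set.mem_ofPred_eq, ← hk']
      simpa using hh1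
    have h1 := hb hk2
    have h2 := ha hk2
    refine Finset.mem_image.2 ⟨(k + K).toNat, ?_, ?_⟩
    · rw [Finset.mem_range]; omega
    · rw [hk']
      congr 2
      omega
  · intro h hh
    obtain ⟨hh1, hh2⟩ := Finset.mem_sdiff.1 hh
    obtain ⟨i, -, rfl⟩ := Finset.mem_image.1 hh1
    by_contra hne
    apply hh2
    rw [Finset.mem_filter]
    refine ⟨by simpa using hne, ?_⟩
    rw [eq_comm, QuotientGroup.eq, inv_mul_cancel_left]
    exact Subgroup.zpow_mem_zpowers _ _
  · intros; rfl

end Cosets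

section Coboundary

variable {n : ℕ} {τ : Type*} {p : FreeGroup (Fin n) → τ}

theorem mk_cons (x : Fin n × Bool) (L : List (Fin n × Bool)) :
    FreeGroup.mk (x :: L) = letterElt x * FreeGroup.mk L := by
  rw [letterElt, FreeGroup.mul_mk]; rfl

theorem finite_coboundary (hp : ∀ x, {g | p (g * letterElt x) ≠ p g}.Finite)
    (w : FreeGroup (Fin n)) : {g | p (g * w) ≠ p g}.Finite := by
  obtain ⟨L, rfl⟩ : ∃ L, FreeGroup.mk L = w := ⟨w.toWord, FreeGroup.mk_toWord⟩
  induction L with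
  | nil => simp [← FreeGroup.one_eq_mk]
  | cons x L ih =>
    refine ((ih.preimage (mul_left_injective (letterElt x)).injOn).union (hp x)).subset ?_
    intro g hg
    rw [Set.mem_ofPred_eq, mk_cons, ← mul_assoc] at hg
    by_cases h : p (g * letterElt x) = p g
    · left
      rw [Set.mem_preimage, Set.mem_ofPred_eq, h]
      exact hg
    · exact Or.inr h

theorem finite_coboundary_comp (hp : ∀ x, {g | p (g * letterElt x) ≠ p g}.Finite)
    (g₀ : FreeGroup (Fin n)) (φ : FreeGroup (Fin n) ≃* FreeGroup (Fin n)) (x : Fin n × Bool) :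
    {g | p (g₀ * φ (g * letterElt x)) ≠ p (g₀ * φ g)}.Finite := by
  refine ((finite_coboundary hp (φ (letterElt x))).preimage
    (f := fun g => g₀ * φ g) ?_).subset ?_
  · exact ((mul_right_injective g₀).comp φ.injective).injOn
  · intro g hg
    simpa [mul_assoc] using hg

/-- Outside a bounded range of exponents, moving by `w` does not change the value of `p`. -/
theorem exists_forall_apply_mul_zpow_mul (hp : ∀ x, {g | p (g * letterElt x) ≠ p g}.Finite)
    {c : FreeGroup (Fin n)} (hc : c ≠ 1) (h w : FreeGroup (Fin n)) :
    ∃ K : ℕ, ∀ k : ℤ, K ≤ k.natAbs → p (h * c ^ k * w) = p (h * c ^ k) := by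
  have hinj : Function.Injective fun k : ℤ => h * c ^ k := fun k l hkl =>
    injective_zpow_iff_not_isOfFinOrder.2 (not_isOfFinOrder_of_isMulTorsionFree hc)
      (mul_left_cancel hkl)
  have hfin := ((finite_coboundary hp w).preimage hinj.injOn).image Int.natAbs
  obtain ⟨K, hK⟩ := hfin.bddAbove
  refine ⟨K + 1, fun k hk => ?_⟩
  by_contra hne
  have := hK ⟨k, hne, rfl⟩
  omega

end Coboundary

section CrossingCount

variable {n : ℕ}

/-- `P` changes exactly along the edge of the Cayley tree from `1` to the `j`-th generator. -/
def IsCrossingFunction (j : Fin n) (P : FreeGroup (Fin n) → ℤ) : Prop :=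
  ∀ g i, P (g * FreeGroup.of i) = P g + if i = j ∧ g = 1 then 1 else 0

/-- By freeness the group acts on pairs of a vertex and a height, each generator translating the
vertex and changing the height exactly across the chosen edge. `P g` is the height reached from `(1,
0)`. -/
theorem exists_crossing_function (j : Fin n) :
    ∃ P : FreeGroup (Fin n) → ℤ, IsCrossingFunction j P := by
  let σ : Fin n → Equiv.Perm (FreeGroup (Fin n) × ℤ) := fun i =>
    { toFun := fun x => (x.1 * FreeGroup.of i, x.2 + if i = j ∧ x.1 = 1 then 1 else 0)
      invFun := fun x => (x.1 * (FreeGroup.of i)⁻¹,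
        x.2 - if i = j ∧ x.1 * (FreeGroup.of i)⁻¹ = 1 then 1 else 0)
      left_inv := fun x => by simp
      right_inv := fun x => by simp }
  let ρ := FreeGroup.lift fun i => (σ i)⁻¹
  have h1 : ∀ a x, (ρ a x).1 = x.1 * a⁻¹ := by
    intro a
    induction a using FreeGroup.induction_on with
    | C1 => simp
    | of i => intro x; simp only [ρ, FreeGroup.lift_apply_of]; rfl
    | inv_of i _ => intro x; simp only [ρ, map_inv, FreeGroup.lift_apply_of, inv_inv]; rfl
    | mul a b ha hb => intro x; simp [ha, hb, mul_assoc]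
  refine ⟨fun g => (ρ g⁻¹ (1, 0)).2, fun g i => ?_⟩
  have h2 : ρ (g * FreeGroup.of i)⁻¹ (1, 0) = σ i (ρ g⁻¹ (1, 0)) := by
    rw [mul_inv_rev, map_mul, Equiv.Perm.mul_apply, map_inv ρ (FreeGroup.of i)]
    simp [ρ]
  simp only [h2]
  change (ρ g⁻¹ (1, 0)).2 + (if i = j ∧ (ρ g⁻¹ (1, 0)).1 = 1 then 1 else 0) = _
  simp only [h1, one_mul, inv_inv]

/-- The exponent sum of the `j`-th generator. -/
def exponentSum (j : Fin n) : FreeGroup (Fin n) →* Multiplicative ℤ :=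
  FreeGroup.lift fun i => Multiplicative.ofAdd (if i = j then 1 else 0)

/-- The matrix of `φ` on the abelianization is invertible, so some term of the Leibniz expansion of
its determinant is nonzero; `π` is the permutation of that term. -/
theorem exists_perm_exponentSum_ne (φ : FreeGroup (Fin n) ≃* FreeGroup (Fin n)) :
    ∃ π : Equiv.Perm (Fin n), ∀ j, exponentSum j (φ (FreeGroup.of (π j))) ≠ 1 := by
  let M : (FreeGroup (Fin n) ≃* FreeGroup (Fin n)) → Matrix (Fin n) (Fin n) ℤ := fun φ =>
    Matrix.of fun i j => (exponentSum j (φ (FreeGroup.of i))).toAdd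
  have hcomp : ∀ (φ : FreeGroup (Fin n) ≃* FreeGroup (Fin n)) (g : FreeGroup (Fin n)) (j : Fin n),
      (exponentSum j (φ g)).toAdd = ∑ i, (exponentSum i g).toAdd * M φ i j := by
    intro φ g j
    induction g using FreeGroup.induction_on with
    | C1 => simp
    | of i => simp [exponentSum, M]
    | inv_of i _ => simp [exponentSum, M]
    | mul a b ha hb => simp [ha, hb, add_mul, Finset.sum_add_distrib]
  have hM : M φ.symm * M φ = 1 := by
    ext i j
    rw [Matrix.mul_apply, Matrix.one_apply]
    refine (hcomp φ (φ.symm (FreeGroup.of i)) j).symm.trans ?_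
    rw [MulEquiv.apply_symm_apply]
    simp only [exponentSum, FreeGroup.lift_apply_of, toAdd_ofAdd]
  have hdet : (M φ).det ≠ 0 := by
    intro h
    have := congrArg Matrix.det hM
    rw [Matrix.det_mul, h, mul_zero, Matrix.det_one] at this
    exact one_ne_zero this.symm
  rw [Matrix.det_apply] at hdet
  obtain ⟨π, -, hπ⟩ := Finset.exists_ne_zero_of_sum_ne_zero hdet
  refine ⟨π, fun j h => hπ ?_⟩
  rw [Finset.prod_eq_zero (Finset.mem_univ j), smul_zero]
  simp [M, h]

variable {j : Fin n} {P : FreeGroup (Fin n) → ℤ}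

theorem eq_of_crossing (hP : IsCrossingFunction j P) {g : FreeGroup (Fin n)} {x : Fin n × Bool}
    (h : P (g * letterElt x) ≠ P g) :
    x.1 = j ∧ g = if x.2 then 1 else letterElt (letterInv x) := by
  obtain ⟨i, b⟩ := x
  cases b
  · have h1 : letterElt (letterInv (i, false)) = FreeGroup.of i := rfl
    have h2 := hP (g * letterElt (i, false)) i
    rw [← h1, mul_assoc, letterElt_mul_letterInv, mul_one] at h2
    by_cases h3 : i = j ∧ g * letterElt (i, false) = 1
    · refine ⟨h3.1, ?_⟩
      simp only [Bool.false_eq_true, if_false]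
      rw [letterElt_letterInv]
      exact eq_inv_of_mul_eq_one_left h3.2
    · rw [if_neg h3, add_zero] at h2
      exact absurd h2.symm h
  · have h1 : letterElt (i, true) = FreeGroup.of i := rfl
    rw [h1, hP] at h
    by_cases h3 : i = j ∧ g = 1
    · simpa using h3
    · rw [if_neg h3, add_zero] at h
      exact absurd rfl h

theorem finite_crossing (hP : IsCrossingFunction j P) (x : Fin n × Bool) : {g | P (g * letterElt x) ≠ P g}.Finite := by
  refine (Set.finite_singleton (if x.2 then 1 else letterElt (letterInv x))).subset ?_
  intro g hg
  exact (eq_of_crossing hP hg).2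

/-- The left side is additive in `w`, by reindexing with a right translation, and for a generator at
most one summand is nonzero. -/
theorem finsum_crossing (hP : IsCrossingFunction j P) (w : FreeGroup (Fin n)) :
    ∑ᶠ h, (P (h * w) - P h) = (exponentSum j w).toAdd := by
  have hfin : ∀ w, (Function.support fun h => P (h * w) - P h).Finite := fun w => by
    refine (finite_coboundary (finite_crossing hP) w).subset ?_
    intro g hg
    simpa [sub_eq_zero] using hg
  have hmul : ∀ a b, ∑ᶠ h, (P (h * (a * b)) - P h) =
      ∑ᶠ h, (P (h * a) - P h) + ∑ᶠ h, (P (h * b) - P h) := by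
    intro a b
    have h1 := finsum_comp_equiv (Equiv.mulRight a) (f := fun h => P (h * b) - P h)
    rw [← h1, ← finsum_add_distrib (hfin a)]
    · refine finsum_congr fun h => ?_
      simp only [Equiv.coe_mulRight, mul_assoc]
      ring
    · refine ((hfin b).preimage (mul_left_injective a).injOn).subset ?_
      intro g hg
      exact hg
  have hone : ∑ᶠ h, (P (h * 1) - P h) = 0 := by simp
  have hof : ∀ i, ∑ᶠ h, (P (h * FreeGroup.of i) - P h) =
      (exponentSum j (FreeGroup.of i)).toAdd := by
    intro i
    rw [finsum_eq_single _ 1]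
    · rw [hP]; simp [exponentSum]
    · intro x hx
      rw [hP]; simp [hx]
  induction w using FreeGroup.induction_on with
  | C1 => simp
  | of i => exact hof i
  | inv_of i _ =>
    have h1 := hmul (FreeGroup.of i)⁻¹ (FreeGroup.of i)
    rw [inv_mul_cancel, hone, hof] at h1
    rw [map_inv, toAdd_inv]
    linarith
  | mul a b ha hb => rw [hmul, ha, hb, map_mul, toAdd_mul]

/-- The increments `P (h * w) - P h` have nonzero sum over the group, hence on some coset of the
powers of `w`, where the sum telescopes to the difference between the far ends. -/
theorem exists_separating_translate (hP : IsCrossingFunction j P) {w : FreeGroup (Fin n)}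
    (hw : exponentSum j w ≠ 1) :
    ∃ (g : FreeGroup (Fin n)) (K₀ : ℕ), ∀ K : ℕ, K₀ ≤ K → P (g * w ^ K) ≠ P (g * w⁻¹ ^ K) := by
  have hw1 : w ≠ 1 := by rintro rfl; simp at hw
  have hfin : (Function.support fun h => P (h * w) - P h).Finite := by
    refine (finite_coboundary (finite_crossing hP) w).subset ?_
    intro g hg
    simpa [sub_eq_zero] using hg
  obtain ⟨g, K₀, h⟩ := exists_coset_sum_ne_zero hw1 hfin (by
    rw [finsum_crossing hP]; simpa using hw)
  refine ⟨g, K₀, fun K hK heq => h K hK ?_⟩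
  have h1 : ∀ i : ℕ, P (g * w ^ ((i : ℤ) - K) * w) - P (g * w ^ ((i : ℤ) - K)) =
      P (g * w ^ (((i + 1 : ℕ) : ℤ) - K)) - P (g * w ^ ((i : ℤ) - K)) := by
    intro i
    rw [mul_assoc, ← zpow_add_one]
    congr 4
    push_cast; ring
  simp only [h1]
  rw [Finset.sum_range_sub (fun i : ℕ => P (g * w ^ ((i : ℤ) - K)))]
  have h2 : ((2 * K : ℕ) : ℤ) - K = K := by push_cast; ring
  rw [h2, zpow_natCast, heq]
  simp

/-- If the two ends of the line `h c^k` are separated, then the line crosses the base edge. -/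
theorem exists_crossing (hP : IsCrossingFunction j P) {h : FreeGroup (Fin n)} {L : List (Fin n × Bool)} {k l : ℤ}
    (hkl : P (h * FreeGroup.mk L ^ k) ≠ P (h * FreeGroup.mk L ^ l)) :
    ∃ (m : ℤ) (i : Fin L.length), (L.get i).1 = j ∧ h * FreeGroup.mk L ^ m =
      (if (L.get i).2 then 1 else letterElt (letterInv (L.get i))) *
        (FreeGroup.mk (L.take i))⁻¹ := by
  -- Locate the change first up to a period `m`, then at a letter within the word `L`.
  have h1 : ∃ m : ℤ, P (h * FreeGroup.mk L ^ m * FreeGroup.mk L) ≠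
      P (h * FreeGroup.mk L ^ m) := by
    by_contra! hno
    have : ∀ m : ℤ, P (h * FreeGroup.mk L ^ m) = P h := by
      intro m
      induction m using Int.induction_on with
      | zero => simp
      | succ i ih => rw [zpow_add_one, ← mul_assoc, hno, ih]
      | pred i ih =>
        rw [← hno, mul_assoc, ← zpow_add_one, sub_add_cancel, ih]
    rw [this, this] at hkl
    exact hkl rfl
  obtain ⟨m, hm⟩ := h1
  have h2 : ∃ i : Fin L.length, P (h * FreeGroup.mk L ^ m * FreeGroup.mk (L.take (i + 1))) ≠
      P (h * FreeGroup.mk L ^ m * FreeGroup.mk (L.take i)) := by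
    by_contra! hno
    have : ∀ i : ℕ, i ≤ L.length → P (h * FreeGroup.mk L ^ m * FreeGroup.mk (L.take i)) =
        P (h * FreeGroup.mk L ^ m) := by
      intro i
      induction i with
      | zero => simp [← FreeGroup.one_eq_mk]
      | succ i ih => intro hi; rw [hno ⟨i, hi⟩, ih (by omega)]
    have := this L.length le_rfl
    rw [List.take_length] at this
    exact hm this
  obtain ⟨i, hi⟩ := h2
  rw [List.take_add_one, List.getElem?_eq_getElem i.2, Option.toList_some, ← FreeGroup.mul_mk,
    ← mul_assoc] at hi
  obtain ⟨h3, h4⟩ := eq_of_crossing hP hi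
  exact ⟨m, i, h3, eq_mul_inv_of_mul_eq h4⟩

end CrossingCount

/-! ### The cut condition implies minimality -/

namespace LineSystem

variable {n : ℕ} {E : Type*} (D : LineSystem n E)

/-- The word of length `k` read from the position `e` on. -/
def read (k : ℕ) (e : E) : List (Fin n × Bool) :=
  (List.range k).map fun t => D.hd ((D.nxt ^ t) e)

theorem length_read (k : ℕ) (e : E) : (D.read k e).length = k := by simp [read]

theorem read_succ (k : ℕ) (e : E) : D.read (k + 1) e = D.read k e ++ [D.hd ((D.nxt ^ k) e)] := by
  simp [read, List.range_succ]

theorem isReduced_read (k : ℕ) (e : E) : FreeGroup.IsReduced (D.read k e) := by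
  rw [FreeGroup.IsReduced, read, List.isChain_map, List.isChain_iff_getElem]
  intro i hi h
  simp only [List.getElem_range] at h ⊢
  by_contra hne
  apply D.hd_nxt_ne ((D.nxt ^ i) e)
  rw [← Equiv.Perm.mul_apply, ← pow_succ']
  ext
  · simp [letterInv, h]
  · revert hne
    simp only [letterInv]
    cases (D.hd ((D.nxt ^ i) e)).2 <;> cases (D.hd ((D.nxt ^ (i + 1)) e)).2 <;> simp

theorem isCyclicallyReduced_read {k : ℕ} {e : E} (hk : (D.nxt ^ k) e = e) :
    FreeGroup.IsCyclicallyReduced (D.read k e) := by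
  refine ⟨D.isReduced_read k e, ?_⟩
  rcases k with _ | k
  · simp [read]
  -- Reading one letter beyond the period puts the last letter next to the first.
  have h := D.isReduced_read (k + 2) e
  rw [read_succ, hk, read_succ, List.append_assoc] at h
  have h2 := h.infix (L₁ := [D.hd ((D.nxt ^ k) e), D.hd e]) ⟨D.read k e, [], by simp⟩
  intro a ha b hb
  rw [read_succ, List.getLast?_concat, Option.mem_some_iff] at ha
  have hb' : D.hd e = b := by simpa [read, List.range_succ_eq_map] using hb
  subst ha hb'
  simpa [FreeGroup.IsReduced] using h2

theorem toWord_read (k : ℕ) (e : E) : (FreeGroup.mk (D.read k e)).toWord = D.read k e := by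
  rw [FreeGroup.toWord_mk, (D.isReduced_read k e).reduce_eq]

theorem reduceCyclically_of_isCyclicallyReduced {L : List (Fin n × Bool)}
    (h : FreeGroup.IsCyclicallyReduced L) : FreeGroup.reduceCyclically L = L := by
  induction L using List.bidirectionalRec with
  | nil => simp
  | singleton => simp
  | cons_append a l b ih =>
    rw [FreeGroup.reduceCyclically.cons_append, if_neg]
    · rfl
    · rintro ⟨h1, h2⟩
      have := (FreeGroup.isCyclicallyReduced_cons_append_iff.1 h).2 h1
      rw [this] at h2
      simp at h2

theorem cyclicLength_of_isCyclicallyReduced {u : FreeGroup (Fin n)}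
    (h : FreeGroup.IsCyclicallyReduced u.toWord) : cyclicLength u = u.norm := by
  rw [cyclicLength, reduceCyclically_of_isCyclicallyReduced h, FreeGroup.norm]

theorem cyclicLength_read {k : ℕ} {e : E} (hk : (D.nxt ^ k) e = e) :
    cyclicLength (FreeGroup.mk (D.read k e)) = k := by
  rw [cyclicLength_of_isCyclicallyReduced, FreeGroup.norm, toWord_read, length_read]
  rw [toWord_read]
  exact D.isCyclicallyReduced_read hk

theorem step_pow_apply (g : FreeGroup (Fin n)) (e : E) (k : ℕ) :
    (D.step ^ k) (g, e) = (g * FreeGroup.mk (D.read k e), (D.nxt ^ k) e) := by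
  induction k with
  | zero => simp [read, ← FreeGroup.one_eq_mk]
  | succ k ih =>
    rw [pow_succ', Equiv.Perm.mul_apply, ih, step_apply, read_succ, ← FreeGroup.mul_mk,
      pow_succ', Equiv.Perm.mul_apply, mul_assoc]
    rfl

theorem step_pow_zpow_apply {N : ℕ} {e : E} (hN : (D.nxt ^ N) e = e) (g : FreeGroup (Fin n))
    (k : ℤ) : ((D.step ^ N) ^ k) (g, e) = (g * FreeGroup.mk (D.read N e) ^ k, e) := by
  have h1 : ∀ g : FreeGroup (Fin n),
      (D.step ^ N) (g, e) = (g * FreeGroup.mk (D.read N e), e) := fun g => by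
    rw [step_pow_apply, hN]
  induction k using Int.induction_on with
  | zero => simp
  | succ i ih =>
    rw [add_comm, zpow_one_add, Equiv.Perm.mul_apply, ih, h1, mul_assoc, ← zpow_add_one, add_comm]
  | pred i ih =>
    rw [← EmbeddingLike.apply_eq_iff_eq (D.step ^ N), ← Equiv.Perm.mul_apply, ← zpow_one_add, h1,
      add_sub_cancel, ih, mul_assoc, ← zpow_add_one, sub_add_cancel]

theorem EndsDiffer.step_pow {D : LineSystem n E} {τ : Type*} {p : FreeGroup (Fin n) → τ}
    {x : FreeGroup (Fin n) × E} (h : D.EndsDiffer p x) (s : ℕ) :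
    D.EndsDiffer p ((D.step ^ s) x) := by
  obtain ⟨K, hK⟩ := h
  refine ⟨K + s, fun k l hk hl => ?_⟩
  have := hK (k + s) (l - s) (by omega) (by omega)
  convert this using 3
  · rw [pow_add, Equiv.Perm.mul_apply]
  · rw [← Equiv.Perm.mul_apply]
    congr 1
    obtain ⟨m, rfl⟩ : ∃ m, l = m + s := ⟨l - s, by omega⟩
    rw [pow_add, mul_assoc, inv_pow D.step s, inv_mul_cancel, mul_one, Nat.add_sub_cancel]

/-- `N` disjoint copies of a line system, shifted cyclically along the lines. -/
def cover (N : ℕ) [NeZero N] : LineSystem n (E × ZMod N) where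
  nxt := D.nxt.prodCongr (Equiv.addRight 1)
  hd x := D.hd x.1
  hd_nxt_ne x := D.hd_nxt_ne x.1

theorem ncard_prod_zmod {E : Type*} (N : ℕ) (Q : E → Prop) : {x : E × ZMod N | Q x.1}.ncard = {e | Q e}.ncard * N := by
  have : {x : E × ZMod N | Q x.1} = {e | Q e} ×ˢ Set.univ := by ext; simp
  rw [this, Set.ncard_prod, Set.ncard_univ, Nat.card_zmod]

section Cover

variable {D} {N : ℕ} [NeZero N]

theorem cover_nxt_pow (k : ℕ) (x : E × ZMod N) :
    ((D.cover N).nxt ^ k) x = ((D.nxt ^ k) x.1, x.2 + k) := by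
  induction k with
  | zero => simp
  | succ k ih =>
    rw [pow_succ', Equiv.Perm.mul_apply, ih, pow_succ', Equiv.Perm.mul_apply]
    simp [cover, add_assoc]

theorem cover_read (k : ℕ) (x : E × ZMod N) : (D.cover N).read k x = D.read k x.1 := by
  simp only [read, cover_nxt_pow]
  rfl

theorem cover_tl (x : E × ZMod N) : (D.cover N).tl x = D.tl x.1 := rfl

theorem cover_hd (x : E × ZMod N) : (D.cover N).hd x = D.hd x.1 := rfl

/-- The list to be studied has a word of length `N` for every position `e`, so each Whitehead edge
is repeated `N` times; `cover` has these repeated edges, and both sides of the inequality scale by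
`N`. -/
theorem CutCondition.cover (h : D.CutCondition) : (D.cover N).CutCondition := by
  intro x X hx hx'
  have h1 := ncard_prod_zmod N fun e => D.tl e = x ∨ D.hd e = x
  have h2 := ncard_prod_zmod N fun e => ¬ (D.tl e ∈ X ↔ D.hd e ∈ X)
  simp only [cover_tl, cover_hd]
  rw [h1, h2]
  exact Nat.mul_le_mul_right _ (h x X hx hx')

/-- Every separated line passes through the base position of one of the words, and sufficiently
large powers of this word lead to different values. -/
theorem EndsDiffer.exists_base (hN : D.nxt ^ N = 1) {τ : Type*} {p : FreeGroup (Fin n) → τ}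
    {x : FreeGroup (Fin n) × (E × ZMod N)} (h : (D.cover N).EndsDiffer p x) :
    ∃ (g : FreeGroup (Fin n)) (e : E), Equiv.Perm.SameCycle (D.cover N).step x (g, (e, 0)) ∧
      ∃ K : ℕ, ∀ k : ℕ, K ≤ k → p (g * FreeGroup.mk (D.read N e) ^ (k : ℤ)) ≠
        p (g * FreeGroup.mk (D.read N e) ^ (-(k : ℤ))) := by
  have h0 := h.step_pow (-x.2.2).val
  obtain ⟨g, e⟩ := x
  rw [step_pow_apply, cover_nxt_pow] at h0
  simp only [ZMod.natCast_val, ZMod.cast_id', id_eq, add_neg_cancel] at h0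
  refine ⟨g * FreeGroup.mk ((D.cover N).read (-e.2).val e), (D.nxt ^ (-e.2).val) e.1,
    ⟨((-e.2).val : ℕ), ?_⟩, ?_⟩
  rotate_left
  · obtain ⟨K, hK⟩ := h0
    refine ⟨K, fun k hk => ?_⟩
    have hfix : ((D.cover N).nxt ^ N) ((D.nxt ^ (-e.2).val) e.1, (0 : ZMod N)) =
        ((D.nxt ^ (-e.2).val) e.1, 0) := by
      rw [cover_nxt_pow, hN]
      simp
    have hkN : K ≤ N * k := hk.trans (Nat.le_mul_of_pos_left k (NeZero.pos N))
    have := hK (N * k) (N * k) hkN hkN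
    rw [inv_pow, pow_mul, ← zpow_natCast, ← zpow_neg, step_pow_zpow_apply _ hfix,
      step_pow_zpow_apply _ hfix, cover_read] at this
    rw [cover_read] at this ⊢
    exact this
  · rw [zpow_natCast, step_pow_apply, cover_nxt_pow]
    simp

/-- Up to bounded distance and translation, `φ` takes a separated line to the line of the cyclic
word `L e`. Its ends are separated by `P`, so it traverses the only tree edge where `P` changes, at
an occurrence of the `j`-th generator or its inverse. That occurrence determines the line. -/
theorem card_lines_le [Fintype E] {j : Fin n} {P : FreeGroup (Fin n) → ℤ}
    (hP : IsCrossingFunction j P) (hN : D.nxt ^ N = 1)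
    (φ : FreeGroup (Fin n) ≃* FreeGroup (Fin n)) (g₀ : FreeGroup (Fin n))
    {T : Finset (FreeGroup (Fin n) × (E × ZMod N))}
    (hT : ∀ x ∈ T, (D.cover N).EndsDiffer (fun g => P (g₀ * φ g)) x)
    (hdisj : ∀ x ∈ T, ∀ y ∈ T, Equiv.Perm.SameCycle (D.cover N).step x y → x = y)
    (L : E → List (Fin n × Bool)) (w : E → FreeGroup (Fin n))
    (hL : ∀ e, φ (FreeGroup.mk (D.read N e)) = w e * FreeGroup.mk (L e) * (w e)⁻¹) :
    T.card ≤ ∑ e, (Finset.univ.filter fun i : Fin (L e).length => ((L e).get i).1 = j).card := by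
  classical
  -- `ξ` recovers a point of the line from an occurrence, undoing the conjugation by `w`, the
  -- translation by `g₀` and `φ`.
  let ξ : (Σ e, Fin (L e).length) → FreeGroup (Fin n) × (E × ZMod N) := fun q =>
    (φ.symm (g₀⁻¹ * ((if ((L q.1).get q.2).2 then 1 else letterElt (letterInv ((L q.1).get q.2))) *
      (FreeGroup.mk ((L q.1).take q.2))⁻¹) * (w q.1)⁻¹), (q.1, 0))
  have key : ∀ x ∈ T, ∃ q : Σ e, Fin (L e).length, ((L q.1).get q.2).1 = j ∧
      Equiv.Perm.SameCycle (D.cover N).step x (ξ q) := by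
    intro x hx
    obtain ⟨g, e, hxg, K, hK⟩ := (hT x hx).exists_base hN
    have hpow : ∀ k : ℤ, g₀ * φ (g * FreeGroup.mk (D.read N e) ^ k) =
        g₀ * φ g * w e * FreeGroup.mk (L e) ^ k * (w e)⁻¹ := by
      intro k
      rw [map_mul, map_zpow, hL, conj_zpow]
      group
    have hne : FreeGroup.mk (L e) ≠ 1 := by
      intro h1
      have := hK K le_rfl
      simp only [hpow, h1, one_zpow] at this
      exact this rfl
    -- Far out, the trailing factor `(w e)⁻¹` does not affect `P`.
    obtain ⟨K', hK'⟩ := exists_forall_apply_mul_zpow_mul (finite_crossing hP) hne (g₀ * φ g * w e)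
      (w e)⁻¹
    have h2 := hK (max K K') (le_max_left _ _)
    simp only [hpow] at h2
    rw [hK' _ (by omega), hK' _ (by omega)] at h2
    obtain ⟨m, i, hi, hm⟩ := exists_crossing hP h2
    refine ⟨⟨e, i⟩, hi, hxg.trans ⟨N * m, ?_⟩⟩
    have hfix : ((D.cover N).nxt ^ N) (e, (0 : ZMod N)) = (e, 0) := by
      rw [cover_nxt_pow, hN]
      simp
    rw [zpow_mul, zpow_natCast, step_pow_zpow_apply _ hfix, cover_read]
    simp only [ξ]
    rw [← hm]
    congr 1
    rw [MulEquiv.eq_symm_apply, map_mul, map_zpow, hL, conj_zpow]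
    group
  choose f hf1 hf2 using key
  rw [← Finset.card_attach]
  calc T.attach.card ≤ (Finset.univ.sigma fun e =>
        Finset.univ.filter fun i : Fin (L e).length => ((L e).get i).1 = j).card := by
        refine Finset.card_le_card_of_injOn (fun x => f x.1 x.2) ?_ ?_
        · intro x _
          simpa using hf1 x.1 x.2
        · intro x _ y _ hxy
          have h1 := hf2 x.1 x.2
          simp only at hxy
          rw [hxy] at h1
          exact Subtype.ext (hdisj x.1 x.2 y.1 y.2 (h1.trans (hf2 y.1 y.2).symm))
    _ = _ := Finset.card_sigma _ _

/-- **Whitehead's minimality criterion**: if the Whitehead graph satisfies the cut condition, then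
no automorphism reduces the total length. -/
theorem isMinimal_of_cutCondition [Fintype E] (hD : D.CutCondition) (hN : D.nxt ^ N = 1) :
    IsMinimal ((Finset.univ : Finset E).toList.map fun e => FreeGroup.mk (D.read N e)) := by
  classical
  intro φ
  simp only [List.map_map, Finset.sum_map_toList]
  have h0 : ∀ e : E, (D.nxt ^ N) e = e := fun e => by rw [hN]; rfl
  simp only [Function.comp_apply, cyclicLength_read D (h0 _)]
  set L : E → List (Fin n × Bool) := fun e =>
    FreeGroup.reduceCyclically (φ (FreeGroup.mk (D.read N e))).toWord with hLdef
  set w : E → FreeGroup (Fin n) := fun e => FreeGroup.mk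
    (FreeGroup.reduceCyclically.conjugator (φ (FreeGroup.mk (D.read N e))).toWord) with hwdef
  have hL : ∀ e, φ (FreeGroup.mk (D.read N e)) = w e * FreeGroup.mk (L e) * (w e)⁻¹ := by
    intro e
    rw [hwdef, hLdef]
    simp only [FreeGroup.mul_mk, FreeGroup.inv_mk]
    rw [FreeGroup.reduceCyclically.conj_conjugator_reduceCyclically, FreeGroup.mk_toWord]
  obtain ⟨π, hπ⟩ := exists_perm_exponentSum_ne φ
  -- The image of the generator `π j` has nonzero exponent sum in `j`, so a translate of the
  -- crossing function tells its two rays at the root apart. The cut condition then bounds the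
  -- degree of that letter by the number of separated lines, hence by the occurrences of `j` in the
  -- images.
  have key : ∀ j, {x : E × ZMod N | (D.cover N).tl x = (π j, false) ∨
      (D.cover N).hd x = (π j, false)}.ncard ≤
      ∑ e, (Finset.univ.filter fun i : Fin (L e).length => ((L e).get i).1 = j).card := by
    intro j
    obtain ⟨P, hP⟩ := exists_crossing_function j
    obtain ⟨g₀, K₀, hsep⟩ := exists_separating_translate hP (hπ j)
    obtain ⟨R, hR⟩ := exists_radius (p := fun g => P (g₀ * φ g))
      (finite_coboundary_comp (finite_crossing hP) g₀ φ)
    set p : FreeGroup (Fin n) → ℤ := fun g => P (g₀ * φ g) with hp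
    have hne : rayValue p R 1 (π j, false) ≠ rayValue p R 1 (π j, true) := by
      rw [← apply_mul_pow hR 1 _ (K := R + K₀) (by simp),
        ← apply_mul_pow hR 1 _ (K := R + K₀) (by simp)]
      have := hsep (R + K₀) (by omega)
      rw [← map_inv, ← map_pow, ← map_pow] at this
      have h3 : letterElt (π j, false) = (FreeGroup.of (π j))⁻¹ := rfl
      have h4 : letterElt (π j, true) = FreeGroup.of (π j) := rfl
      simpa only [hp, one_mul, h3, h4] using this.symm
    obtain ⟨T, hT1, hT2, hT3⟩ := exists_lines (p := p) (hD.cover (N := N)) hR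
      (rayValue p R 1 (π j, true))
    refine le_trans ?_ (card_lines_le hP hN φ g₀ hT1 hT2 L w hL)
    refine le_trans ?_ hT3
    exact hD.cover (N := N) (π j, false)
      {y | rayValue p R 1 y = rayValue p R 1 (π j, true)} hne rfl
  have hsum := Finset.sum_le_sum fun j (_ : j ∈ Finset.univ) => key j
  rw [Finset.sum_comm] at hsum
  have hr : ∀ e, ∑ j, (Finset.univ.filter fun i : Fin (L e).length =>
      ((L e).get i).1 = j).card = (L e).length := by
    intro e
    rw [← Finset.card_eq_sum_card_fiberwise (fun _ _ => Finset.mem_coe.2 (Finset.mem_univ _))]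
    simp
  simp only [hr] at hsum
  refine le_trans (le_of_eq ?_) hsum
  -- The degree of a letter counts the occurrences of the letter and of its inverse.
  have hl : ∀ i, {x : E × ZMod N | (D.cover N).tl x = (i, false) ∨
      (D.cover N).hd x = (i, false)}.ncard =
      (Finset.univ.filter fun x : E × ZMod N => ((D.cover N).hd x).1 = i).card := by
    intro i
    have hu : {x : E × ZMod N | (D.cover N).tl x = (i, false) ∨ (D.cover N).hd x = (i, false)} =
        {x | (D.cover N).tl x = (i, false)} ∪ {x | (D.cover N).hd x = (i, false)} := rfl
    have hu' : ((Finset.univ.filter fun x : E × ZMod N => ((D.cover N).hd x).1 = i) :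
        Set (E × ZMod N)) =
        {x | (D.cover N).hd x = (i, true)} ∪ {x | (D.cover N).hd x = (i, false)} := by
      ext x
      simp only [Finset.coe_filter, Finset.mem_univ, true_and, Set.mem_ofPred_eq, Set.mem_union,
        Prod.ext_iff]
      cases ((D.cover N).hd x).2 <;> simp
    rw [← Set.ncard_coe_finset, hu, hu', Set.ncard_union_eq, Set.ncard_union_eq]
    · congr 1
      rw [← Set.ncard_image_of_injective {x | (D.cover N).hd x = (i, true)}
        (D.cover N).nxt.injective]
      congr 1
      ext x
      rw [Equiv.image_eq_preimage_symm]
      simp only [Set.mem_preimage, Set.mem_ofPred_eq]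
      rw [← letterInv_injective.eq_iff (b := (i, false)), ← hd_nxt_symm]
      rfl
    · refine Set.disjoint_left.2 fun x h1 h2 => ?_
      rw [Set.mem_ofPred_eq] at h1 h2
      rw [h1] at h2
      simp at h2
    · exact Set.disjoint_left.2 fun x h1 h2 => (D.cover N).hd_ne_tl x (h2.trans h1.symm)
  simp only [hl]
  rw [Equiv.sum_comp π fun i =>
    (Finset.univ.filter fun x : E × ZMod N => ((D.cover N).hd x).1 = i).card,
    ← Finset.card_eq_sum_card_fiberwise (fun _ _ => Finset.mem_coe.2 (Finset.mem_univ _))]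
  simp [ZMod.card]

end Cover

end LineSystem

/-! ### Free splittings and the diskbusting criterion -/

section FreeProduct

variable {G : Type*} [Group G] {A B : Subgroup G}

open Classical in
/-- `P` changes exactly at the base point of the Bass-Serre tree of the splitting `A * B`. -/
structure IsSplittingFunction (A B : Subgroup G) (P : G → ℤ) : Prop where
  left : ∀ g, ∀ a ∈ A, P (g * a) = P g + (if g * a = 1 then 1 else 0) - (if g = 1 then 1 else 0)
  right : ∀ g, ∀ b ∈ B, P (g * b) = P g

/-- The elements of `G` are the edges of the Bass-Serre tree and the left cosets of `A` and `B` its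
vertices. The free product acts on pairs of an element and a height: `B` by translation, `A` by
translation conjugated with a height shift over `1`. `P g` is the height reached from `(1, 0)`. -/
theorem exists_splittingFunction (h : IsInternalFreeProduct A B) :
    ∃ P : G → ℤ, IsSplittingFunction A B P := by
  classical
  let tr : G →* Equiv.Perm (G × ℤ) :=
    { toFun := fun a => (Equiv.mulRight a⁻¹).prodCongr (Equiv.refl ℤ)
      map_one' := by ext x <;> simp
      map_mul' := fun a b => by ext x <;> simp [mul_assoc] }
  let sh : Equiv.Perm (G × ℤ) :=
    { toFun := fun x => (x.1, x.2 + if x.1 = 1 then 1 else 0)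
      invFun := fun x => (x.1, x.2 - if x.1 = 1 then 1 else 0)
      left_inv := fun x => by simp
      right_inv := fun x => by simp }
  let e := MulEquiv.ofBijective (Monoid.Coprod.lift A.subtype B.subtype) h
  let ρ' : Monoid.Coprod A B →* Equiv.Perm (G × ℤ) :=
    Monoid.Coprod.lift (((MulAut.conj sh).toMonoidHom.comp tr).comp A.subtype) (tr.comp B.subtype)
  let ρ : G →* Equiv.Perm (G × ℤ) := ρ'.comp e.symm.toMonoidHom
  have hA : ∀ a ∈ A, ρ a = sh * tr a * sh⁻¹ := by
    intro a ha
    have : e.symm a = Monoid.Coprod.inl ⟨a, ha⟩ := by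
      rw [MulEquiv.symm_apply_eq]
      exact (Monoid.Coprod.lift_apply_inl A.subtype B.subtype ⟨a, ha⟩).symm
    change ρ' (e.symm a) = _
    rw [this]
    simp [ρ']
  have hB : ∀ b ∈ B, ρ b = tr b := by
    intro b hb
    have : e.symm b = Monoid.Coprod.inr ⟨b, hb⟩ := by
      rw [MulEquiv.symm_apply_eq]
      exact (Monoid.Coprod.lift_apply_inr A.subtype B.subtype ⟨b, hb⟩).symm
    change ρ' (e.symm b) = _
    rw [this]
    simp [ρ']
  have h1 : ∀ g x, (ρ g x).1 = x.1 * g⁻¹ := by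
    intro g
    obtain ⟨y, rfl⟩ := e.surjective g
    induction y using Monoid.Coprod.induction_on with
    | inl a =>
      have : e (Monoid.Coprod.inl a) = a :=
        Monoid.Coprod.lift_apply_inl A.subtype B.subtype a
      rw [this, hA a a.2]
      intro x
      rfl
    | inr b =>
      have : e (Monoid.Coprod.inr b) = b :=
        Monoid.Coprod.lift_apply_inr A.subtype B.subtype b
      rw [this, hB b b.2]
      intro x
      rfl
    | mul a b ha hb =>
      intro x
      rw [map_mul, map_mul, Equiv.Perm.mul_apply, ha, hb, mul_inv_rev, mul_assoc]
  have h2 : ∀ g, ρ g⁻¹ (1, 0) = (g, (ρ g⁻¹ (1, 0)).2) := fun g =>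
    Prod.ext (by rw [h1]; simp) rfl
  refine ⟨fun g => (ρ g⁻¹ (1, 0)).2, fun g a ha => ?_, fun g b hb => ?_⟩
  · simp only [mul_inv_rev, map_mul, Equiv.Perm.mul_apply]
    rw [hA _ (A.inv_mem ha), h2]
    change (ρ g⁻¹ (1, 0)).2 - (if g = 1 then 1 else 0) + (if g * a⁻¹⁻¹ = 1 then 1 else 0) = _
    rw [inv_inv]
    ring
  · simp only [mul_inv_rev, map_mul, Equiv.Perm.mul_apply]
    rw [hB _ (B.inv_mem hb), h2]
    rfl

variable {P : G → ℤ}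

theorem IsSplittingFunction.finite_coboundary (hP : IsSplittingFunction A B P)
    (h : IsInternalFreeProduct A B) (w : G) : {g | P (g * w) ≠ P g}.Finite := by
  obtain ⟨y, rfl⟩ := h.2 w
  induction y using Monoid.Coprod.induction_on with
  | inl a =>
    refine (Set.toFinite {(a : G)⁻¹, 1}).subset fun g hg => ?_
    rw [Set.mem_ofPred_eq, Monoid.Coprod.lift_apply_inl, Subgroup.coe_subtype, hP.left g a a.2] at hg
    by_contra hne
    simp only [Set.mem_insert_iff, Set.mem_singleton_iff, not_or] at hne
    rw [if_neg hne.2, if_neg (fun h => hne.1 (eq_inv_of_mul_eq_one_left h))] at hg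
    simp at hg
  | inr b =>
    refine Set.finite_empty.subset fun g hg => ?_
    rw [Set.mem_ofPred_eq, Monoid.Coprod.lift_apply_inr, Subgroup.coe_subtype,
      hP.right g b b.2] at hg
    exact hg rfl
  | mul x y hx hy =>
    refine ((hy.preimage (mul_left_injective
      (Monoid.Coprod.lift A.subtype B.subtype x)).injOn).union hx).subset fun g hg => ?_
    rw [Set.mem_ofPred_eq, map_mul, ← mul_assoc] at hg
    by_cases h : P (g * Monoid.Coprod.lift A.subtype B.subtype x) = P g
    · left
      rw [Set.mem_preimage, Set.mem_ofPred_eq, h]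
      exact hg
    · exact Or.inr h

/-- The points `h * c ^ k` stay in one left coset of `A` or of `B`, where `P` is constant except
possibly at `1`, which at most one exponent reaches. -/
theorem IsSplittingFunction.exists_apply_zpow_eq [IsMulTorsionFree G]
    (hP : IsSplittingFunction A B P) {c : G} (hc : c ∈ A ∨ c ∈ B) (h : G) :
    ∃ K : ℕ, ∀ k : ℕ, K ≤ k → P (h * c ^ (k : ℤ)) = P (h * c ^ (-(k : ℤ))) := by
  rcases hc with hc | hc
  · by_cases h1 : c = 1
    · exact ⟨0, fun k _ => by simp [h1]⟩
    have hinj := injective_zpow_iff_not_isOfFinOrder.2 (not_isOfFinOrder_of_isMulTorsionFree h1)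
    by_cases h2 : ∃ m : ℤ, h * c ^ m = 1
    · obtain ⟨m, hm⟩ := h2
      have key : ∀ k : ℤ, k ≠ m → h * c ^ k ≠ 1 := fun k hk h3 =>
        hk (hinj (mul_left_cancel (h3.trans hm.symm)))
      refine ⟨m.natAbs + 1, fun k hk => ?_⟩
      rw [hP.left _ _ (A.zpow_mem hc _), hP.left _ _ (A.zpow_mem hc _),
        if_neg (key _ (by omega)), if_neg (key _ (by omega))]
    · push Not at h2
      refine ⟨0, fun k _ => ?_⟩
      rw [hP.left _ _ (A.zpow_mem hc _), hP.left _ _ (A.zpow_mem hc _), if_neg (h2 _),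
        if_neg (h2 _)]
  · refine ⟨0, fun k _ => ?_⟩
    rw [hP.right _ _ (B.zpow_mem hc _), hP.right _ _ (B.zpow_mem hc _)]

/-- The values of a splitting function are not almost constant. -/
theorem IsSplittingFunction.not_finite [IsMulTorsionFree G] (hP : IsSplittingFunction A B P)
    (hA : A ≠ ⊥) (hB : B ≠ ⊥) (v : ℤ) : ¬ {g | P g ≠ v}.Finite := by
  intro hfin
  obtain ⟨⟨a, ha⟩, ha0⟩ := Subgroup.ne_bot_iff_exists_ne_one.1 hA
  obtain ⟨⟨b, hb⟩, hb0⟩ := Subgroup.ne_bot_iff_exists_ne_one.1 hB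
  have ha1 : a ≠ 1 := fun h => ha0 (Subtype.ext h)
  have hb1 : b ≠ 1 := fun h => hb0 (Subtype.ext h)
  have hinj : ∀ c : G, c ≠ 1 → ∀ h : G, Function.Injective fun k : ℤ => h * c ^ k :=
    fun c hc h k l hkl => injective_zpow_iff_not_isOfFinOrder.2
      (not_isOfFinOrder_of_isMulTorsionFree hc) (mul_left_cancel hkl)
  -- Multiplying `a` by powers of `b` gives the value `P 1 - 1` infinitely often, and multiplying
  -- `b` by powers of `a` gives `P 1` infinitely often.
  have h1 : v = P 1 - 1 := by
    obtain ⟨k, hk⟩ := (hfin.preimage (hinj b hb1 a).injOn).exists_notMem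
    simp only [Set.mem_preimage, Set.mem_ofPred_eq, not_not] at hk
    rw [← hk, hP.right _ _ (B.zpow_mem hb _)]
    have := hP.left 1 a ha
    simpa [ha1] using this
  have h2 : v = P 1 := by
    obtain ⟨k, hk⟩ := ((hfin.preimage (hinj a ha1 b).injOn).union
      ((Set.finite_singleton (1 : G)).preimage (hinj a ha1 b).injOn)).exists_notMem
    simp only [Set.mem_union, Set.mem_preimage, Set.mem_ofPred_eq, not_or, not_not,
      Set.mem_singleton_iff] at hk
    rw [← hk.1, hP.left _ _ (A.zpow_mem ha _), if_neg hk.2, if_neg hb1, ← one_mul b,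
      hP.right _ _ hb]
    simp
  omega

end FreeProduct

namespace LineSystem

variable {n : ℕ} {E : Type*} {D : LineSystem n E} {N : ℕ} [NeZero N]

/-- **Whitehead's diskbusting criterion**: if the Whitehead graph is connected and satisfies the
cut condition, then the words are diskbusting. -/
theorem isDiskbusting_of_cutCondition [Fintype E] (hD : D.CutCondition) (hN : D.nxt ^ N = 1)
    (hconn : ∀ X : Set (Fin n × Bool), (∀ e, D.tl e ∈ X ↔ D.hd e ∈ X) → X = ∅ ∨ X = Set.univ) :
    IsDiskbusting ((Finset.univ : Finset E).toList.map fun e => FreeGroup.mk (D.read N e)) := by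
  rintro ⟨A, B, hAB, hA, hB, hU⟩
  obtain ⟨P, hP⟩ := exists_splittingFunction hAB
  have hfin : ∀ x, {g | P (g * letterElt x) ≠ P g}.Finite := fun x => hP.finite_coboundary hAB _
  -- No line is separated: far out along both ends, conjugacy of the word into `A` or `B` gives
  -- equal values of `P`.
  have hnd : ∀ g₀ x, ¬ (D.cover N).EndsDiffer (fun g => P (g₀ * g)) x := by
    intro g₀ x hx
    obtain ⟨g, e, -, K, hK⟩ := hx.exists_base hN
    obtain ⟨w, hw⟩ : ∃ w, w * FreeGroup.mk (D.read N e) * w⁻¹ ∈ A ∨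
        w * FreeGroup.mk (D.read N e) * w⁻¹ ∈ B := by
      rcases hU _ (List.mem_map.2 ⟨e, by simp, rfl⟩) with ⟨w, hw⟩ | ⟨w, hw⟩
      exacts [⟨w, Or.inl hw⟩, ⟨w, Or.inr hw⟩]
    set c := w * FreeGroup.mk (D.read N e) * w⁻¹ with hc
    have hpow : ∀ k : ℤ, g₀ * (g * FreeGroup.mk (D.read N e) ^ k) = g₀ * g * w⁻¹ * c ^ k * w := by
      intro k
      rw [hc, conj_zpow]
      group
    simp only [hpow] at hK
    have hne : c ≠ 1 := by
      intro h1
      have := hK K le_rfl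
      simp only [h1, one_zpow] at this
      exact this rfl
    obtain ⟨K₁, hK₁⟩ := exists_forall_apply_mul_zpow_mul hfin hne (g₀ * g * w⁻¹) w
    obtain ⟨K₂, hK₂⟩ := hP.exists_apply_zpow_eq hw (g₀ * g * w⁻¹)
    have := hK (K + K₁ + K₂) (by omega)
    rw [hK₁ _ (by omega), hK₁ _ (by omega)] at this
    exact this (hK₂ _ (by omega))
  -- With no separated lines, `exists_lines` leaves no Whitehead edge between rays of different
  -- value, and by connectedness all rays from `g` have the same value.
  have hray : ∀ g x y, ∃ K₀ : ℕ, ∀ K : ℕ, K₀ ≤ K →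
      P (g * letterElt x ^ K) = P (g * letterElt y ^ K) := by
    intro g x y
    obtain ⟨R, hR⟩ := exists_radius (p := fun h => P (g * h))
      (finite_coboundary_comp hfin g (MulEquiv.refl _))
    obtain ⟨T, hT1, -, hT3⟩ := exists_lines (p := fun h => P (g * h)) (hD.cover (N := N)) hR
      (rayValue (fun h => P (g * h)) R 1 x)
    have hT : T = ∅ := Finset.eq_empty_of_forall_notMem fun z hz => hnd g z (hT1 z hz)
    rw [hT, Finset.card_empty, Nat.le_zero, Set.ncard_eq_zero] at hT3
    rcases hconn {z | rayValue (fun h => P (g * h)) R 1 z = rayValue (fun h => P (g * h)) R 1 x}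
      (fun e => by
        by_contra hne
        exact Set.notMem_empty (e, (0 : ZMod N)) (hT3 ▸ hne)) with h | h
    · exact absurd (show x ∈ _ from rfl) (h ▸ Set.notMem_empty x)
    · have hy : y ∈ {z | rayValue (fun h => P (g * h)) R 1 z =
        rayValue (fun h => P (g * h)) R 1 x} := h ▸ Set.mem_univ y
      refine ⟨R, fun K hK => ?_⟩
      have h1 := apply_mul_pow (p := fun h => P (g * h)) hR 1 x (K := K) (by simpa using hK)
      have h2 := apply_mul_pow (p := fun h => P (g * h)) hR 1 y (K := K) (by simpa using hK)
      simp only [one_mul] at h1 h2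
      rw [h1, h2]
      exact hy.symm
  obtain ⟨i⟩ : Nonempty (Fin n) := by
    by_contra hemp
    rw [not_nonempty_iff] at hemp
    exact hA (Subsingleton.elim _ _)
  obtain ⟨R, hR⟩ := exists_radius hfin
  -- Adjacent vertices share the tail of a ray, so the common ray value is the same at all vertices.
  -- Then `P` is constant outside a ball, which `not_finite` forbids.
  have hstep : ∀ g x, rayValue P R (g * letterElt x) (i, true) = rayValue P R g (i, true) := by
    have hxy : ∀ g x y, rayValue P R g x = rayValue P R g y := by
      intro g x y
      obtain ⟨K₀, h⟩ := hray g x y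
      rw [← apply_mul_pow hR g x (K := g.norm + R + K₀) (by omega),
        ← apply_mul_pow hR g y (K := g.norm + R + K₀) (by omega)]
      exact h _ (by omega)
    intro g x
    rw [hxy _ _ x, rayValue_mul hR, hxy]
  have hconst : ∀ L g, rayValue P R (g * FreeGroup.mk L) (i, true) = rayValue P R g (i, true) := by
    intro L
    induction L with
    | nil => simp [← FreeGroup.one_eq_mk]
    | cons x L ih => intro g; rw [mk_cons, ← mul_assoc, ih, hstep]
  have hxy : ∀ g x, rayValue P R g x = rayValue P R 1 (i, true) := by
    intro g x
    obtain ⟨K₀, h⟩ := hray g x (i, true)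
    have h1 := hconst g.toWord 1
    rw [FreeGroup.mk_toWord, one_mul] at h1
    rw [← h1, ← apply_mul_pow hR g x (K := g.norm + R + K₀) (by omega),
      ← apply_mul_pow hR g (i, true) (K := g.norm + R + K₀) (by omega)]
    exact h _ (by omega)
  apply hP.not_finite hA hB (rayValue P R 1 (i, true))
  refine (finite_norm_le R).subset fun g hg => ?_
  by_contra hgR
  rw [Set.mem_ofPred_eq, not_le] at hgR
  apply hg
  obtain ⟨x, hx⟩ : ∃ x, back g ≠ some x := by
    by_contra! h
    have := (h (i, true)).symm.trans (h (i, false))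
    simp at this
  rw [← rayValue_of_le hR hgR.le hx, hxy]

end LineSystem

/-! ### Combinatorics of side-pairings -/

namespace SidePairing

variable (S : SidePairing)

/-- The side preceding `s` on the boundary of its disk. -/
def prev (s : S.Side) : S.Side := ⟨s.1, (finRotate _).symm s.2⟩

@[simp] theorem next_prev (s : S.Side) : S.next (S.prev s) = s := by
  exact congrArg (Sigma.mk s.1) ((finRotate _).apply_symm_apply s.2)

@[simp] theorem prev_next (s : S.Side) : S.prev (S.next s) = s := by
  exact congrArg (Sigma.mk s.1) ((finRotate _).symm_apply_apply s.2)

@[simp] theorem corner_false (s : S.Side) : S.corner (s, false) = s := rfl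

@[simp] theorem corner_true (s : S.Side) : S.corner (s, true) = S.next s := rfl

theorem opp_opp (h : S.SideEnd) : S.opp (S.opp h) = h := by
  simp [opp, S.pair_pair, S.flip_pair]

theorem opp_ne (h : S.SideEnd) : S.opp h ≠ h := fun h' => S.pair_ne h.1 (congrArg Prod.fst h')

theorem opp_not (h : S.SideEnd) : S.opp (h.1, !h.2) = ((S.opp h).1, !(S.opp h).2) := by
  simp [opp]

theorem vertexAt_opp (h : S.SideEnd) : S.vertexAt (S.opp h) = S.vertexAt h :=
  (Quot.sound ⟨h, rfl, rfl⟩).symm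

theorem corner_eq_iff {h : S.SideEnd} {s : S.Side} :
    S.corner h = s ↔ h = (s, false) ∨ h = (S.prev s, true) := by
  obtain ⟨t, b⟩ := h
  cases b
  · simp
  · rw [corner_true]
    constructor
    · rintro rfl
      simp
    · rintro (h | h)
      · simp at h
      · rw [show t = S.prev s from congrArg Prod.fst h, next_prev]

instance : Finite S.Vertex := Quot.finite _

instance : Finite S.Edge := Quot.finite _

/-- A property of corners that is preserved by the gluing holds on entire vertices. -/
theorem of_vertex_eq {Q : S.Side → Prop} (hQ : ∀ h, Q (S.corner h) → Q (S.corner (S.opp h)))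
    {s t : S.Side} (hst : (Quot.mk _ s : S.Vertex) = Quot.mk _ t) (hs : Q s) : Q t := by
  have hr : ∀ c d : S.Side, (∃ h : S.SideEnd, c = S.corner h ∧ d = S.corner (S.opp h)) →
      Q c = Q d := by
    rintro _ _ ⟨h, rfl, rfl⟩
    exact propext ⟨hQ h, fun h' => by simpa [opp_opp] using hQ (S.opp h) h'⟩
  have h : Q s = Q t := congrArg (Quot.lift Q hr) hst
  exact h ▸ hs

/-- The edge of the quotient surface carried by a side. -/
def edgeOf (s : S.Side) : S.Edge := Quot.mk _ s

theorem edge_eq_iff {s t : S.Side} :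
    S.edgeOf s = S.edgeOf t ↔ t = s ∨ t = S.pair s := by
  constructor
  · intro h
    have hr : ∀ c d : S.Side, d = S.pair c → (c = s ∨ c = S.pair s) = (d = s ∨ d = S.pair s) := by
      rintro c _ rfl
      refine propext ⟨?_, ?_⟩
      · rintro (rfl | rfl)
        · exact Or.inr rfl
        · exact Or.inl (S.pair_pair s)
      · rintro (h | h)
        · exact Or.inr (by rw [← h, S.pair_pair])
        · exact Or.inl (by rw [← S.pair_pair c, h, S.pair_pair])
    have h' : (s = s ∨ s = S.pair s) = (t = s ∨ t = S.pair s) :=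
      congrArg (Quot.lift (fun c : S.Side => c = s ∨ c = S.pair s) hr) h
    exact h' ▸ Or.inl rfl
  · rintro (rfl | rfl)
    · rfl
    · exact Quot.sound rfl

theorem card_side : Nat.card S.Side = Nat.card S.Edge * 2 := by
  classical
  have := Fintype.ofFinite S.Edge
  rw [Nat.card_eq_fintype_card, Nat.card_eq_fintype_card, ← Finset.card_univ, ← Finset.card_univ,
    Finset.card_eq_sum_card_fiberwise (f := S.edgeOf)
      (t := Finset.univ)
      (fun _ _ => Finset.mem_coe.2 (Finset.mem_univ _)), Finset.sum_const_nat]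
  intro q _
  obtain ⟨s, rfl⟩ : ∃ s, S.edgeOf s = q := Quot.exists_rep q
  rw [← Finset.card_pair (S.pair_ne s).symm]
  congr 1
  ext t
  rw [Finset.mem_filter, eq_comm, S.edge_eq_iff]
  simp

end SidePairing

open scoped Graph

theorem countP_toList_map {ι γ : Type*} (s : Finset ι) (f : ι → γ) (q : γ → Prop)
    [DecidablePred q] : (s.toList.map f).countP (fun c => q c) = (s.filter fun i => q (f i)).card := by
  rw [List.countP_map]
  change List.countP (fun i => decide (q (f i))) _ = _
  rw [← Multiset.coe_countP, Finset.coe_toList, Multiset.countP_eq_card_filter]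
  rfl

/-! ### Vertex links of a surface as cycles of a graph -/

section Links

variable {α β : Type*}

/-- A labelling of the corners of a surface by the edges of a graph, and of its edge-ends by the
vertices, as obtained from a locally injective map to the presentation complex. -/
structure LinkLabelling (S : SidePairing) (G : Graph α β) where
  edge : S.Side → β
  vtx : S.SideEnd → α
  isLink : ∀ s, G.IsLink (edge s) (vtx (s, false)) (vtx (S.prev s, true))
  vtx_opp : ∀ h, vtx (S.opp h) = vtx h
  inj : ∀ h h', S.vertexAt h = S.vertexAt h' → vtx h = vtx h' → h' = h ∨ h' = S.opp h

namespace LinkLabelling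

variable {S : SidePairing} {G : Graph α β} (Λ : LinkLabelling S G)

theorem isLink_of_corner_eq {h h' : S.SideEnd} (hne : h ≠ h') (hc : S.corner h = S.corner h') :
    G.IsLink (Λ.edge (S.corner h)) (Λ.vtx h) (Λ.vtx h') := by
  have h1 := S.corner_eq_iff.1 (rfl : S.corner h = S.corner h)
  have h2 := S.corner_eq_iff.1 hc.symm
  have h3 := Λ.isLink (S.corner h)
  generalize S.corner h = s at *
  rcases h1 with rfl | rfl <;> rcases h2 with rfl | rfl
  · exact absurd rfl hne
  · exact h3
  · exact h3.symm
  · exact absurd rfl hne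

theorem inc_corner (h : S.SideEnd) : G.Inc (Λ.edge (S.corner h)) (Λ.vtx h) := by
  have h3 := Λ.isLink (S.corner h)
  rcases S.corner_eq_iff.1 (rfl : S.corner h = S.corner h) with h1 | h1
  · rw [h1]; rw [← h1]; rw [← h1] at h3; exact h3.inc_left
  · rw [← h1] at h3; exact h3.inc_right

theorem exists_end_of_inc {s : S.Side} {v : α} (h : G.Inc (Λ.edge s) v) :
    ∃ h : S.SideEnd, S.corner h = s ∧ Λ.vtx h = v := by
  rcases h.eq_or_eq_of_isLink (Λ.isLink s) with rfl | rfl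
  · exact ⟨(s, false), rfl, rfl⟩
  · exact ⟨(S.prev s, true), by simp, rfl⟩

/-- The link of a vertex of the surface, as a subgraph. -/
def link (p : S.Vertex) : Graph α β where
  vertexSet := Λ.vtx '' {h | S.vertexAt h = p}
  edgeSet := Λ.edge '' {s | Quot.mk _ s = p}
  IsLink e x y := e ∈ Λ.edge '' {s | Quot.mk _ s = p} ∧ G.IsLink e x y
  isLink_symm e _ := ⟨fun _ _ h => ⟨h.1, h.2.symm⟩⟩
  eq_or_eq_of_isLink_of_isLink _ _ _ _ _ h h' := h.2.left_eq_or_eq h'.2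
  edge_mem_iff_exists_isLink e := by
    constructor
    · rintro ⟨s, hs, rfl⟩
      exact ⟨_, _, ⟨s, hs, rfl⟩, Λ.isLink s⟩
    · rintro ⟨x, y, h, -⟩
      exact h
  left_mem_of_isLink := by
    rintro _ x y ⟨⟨s, hs, rfl⟩, h⟩
    obtain ⟨k, hk, rfl⟩ := Λ.exists_end_of_inc h.inc_left
    refine ⟨k, ?_, rfl⟩
    rw [Set.mem_ofPred_eq, SidePairing.vertexAt, hk]
    exact hs

/-- The corners at `p` carry distinct edges. -/
def Good (p : S.Vertex) : Prop := Set.InjOn Λ.edge {s | Quot.mk _ s = p}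

/-- By local injectivity only `h` and its glued copy carry the label `Λ.vtx h` at `p`, so only the
corners beside these two matter. -/
theorem incidenceSet_link (p : S.Vertex) (h : S.SideEnd) (hp : S.vertexAt h = p) :
    (Λ.link p).incidenceSet (Λ.vtx h) =
      {Λ.edge (S.corner h), Λ.edge (S.corner (S.opp h))} := by
  ext e
  constructor
  · rintro ⟨y, ⟨s, hs, rfl⟩, hl⟩
    obtain ⟨k, hk, hkv⟩ := Λ.exists_end_of_inc hl.inc_left
    have hkp : S.vertexAt k = p := by
      rw [SidePairing.vertexAt, hk]; exact hs
    rcases Λ.inj h k (hp.trans hkp.symm) hkv.symm with rfl | rfl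
    · rw [hk]; exact Or.inl rfl
    · rw [hk]; exact Or.inr rfl
  · rintro (rfl | rfl)
    · obtain ⟨y, hy⟩ := Λ.inc_corner h
      exact ⟨y, ⟨_, hp, rfl⟩, hy⟩
    · obtain ⟨y, hy⟩ := Λ.inc_corner (S.opp h)
      rw [Λ.vtx_opp] at hy
      exact ⟨y, ⟨_, (S.vertexAt_opp h).trans hp, rfl⟩, hy⟩

theorem corner_opp_ne (Λ : LinkLabelling S G) (hG : ∀ e x, ¬ G.IsLoopAt e x) (h : S.SideEnd) :
    S.corner (S.opp h) ≠ S.corner h := by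
  intro hc
  have := Λ.isLink_of_corner_eq (S.opp_ne h).symm hc.symm
  rw [Λ.vtx_opp] at this
  exact hG _ _ this

/-- Each edge-end at `p` lies between two corners, which differ as `G` has no loops and carry
different edges as `p` is good. Gluing connects all corners at `p`. -/
theorem link_isCycleOf (hG : ∀ e x, ¬ G.IsLoopAt e x) {p : S.Vertex} (hp : Λ.Good p) :
    IsCycleOf (Λ.link p) G := by
  refine ⟨⟨?_, fun e x y h => h.2⟩, ?_, ?_, ?_, ?_, ?_⟩
  · rintro _ ⟨h, -, rfl⟩
    exact (Λ.inc_corner h).vertex_mem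
  · exact (Set.toFinite {h | S.vertexAt h = p}).image Λ.vtx
  · exact (Set.toFinite {s : S.Side | (Quot.mk _ s : S.Vertex) = p}).image Λ.edge
  · obtain ⟨s, rfl⟩ := Quot.exists_rep p
    exact ⟨_, (s, false), rfl, rfl⟩
  · intro v hv
    refine Set.Subset.antisymm (fun w hw => hw.1) fun w hw => ⟨hw, ?_⟩
    have hsymm : ∀ {x y}, Relation.ReflTransGen (Λ.link p).Adj x y →
        Relation.ReflTransGen (Λ.link p).Adj y x := fun h =>
      haveI : Std.Symm (Λ.link p).Adj := ⟨fun _ _ h => h.symm⟩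
      Relation.ReflTransGen.stdSymm.symm _ _ h
    have hcorner : ∀ h : S.SideEnd, S.vertexAt h = p →
        Relation.ReflTransGen (Λ.link p).Adj (Λ.vtx (S.corner h, false)) (Λ.vtx h) := by
      intro h hh
      by_cases hne : (S.corner h, false) = h
      · rw [hne]
      · refine Relation.ReflTransGen.single ⟨Λ.edge (S.corner h), ⟨_, hh, rfl⟩, ?_⟩
        exact Λ.isLink_of_corner_eq hne rfl
    have key : ∀ h h' : S.SideEnd, S.vertexAt h = p → S.vertexAt h' = p →
        Relation.ReflTransGen (Λ.link p).Adj (Λ.vtx (S.corner h, false))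
          (Λ.vtx (S.corner h', false)) := by
      intro h h' hh hh'
      refine (S.of_vertex_eq (Q := fun t => (Quot.mk _ t : S.Vertex) = p ∧
        Relation.ReflTransGen (Λ.link p).Adj (Λ.vtx (S.corner h, false)) (Λ.vtx (t, false)))
        ?_ (hh.trans hh'.symm) ⟨hh, Relation.ReflTransGen.refl⟩).2
      rintro k ⟨hk1, hk2⟩
      refine ⟨(S.vertexAt_opp k).trans hk1, hk2.trans ((hcorner k hk1).trans ?_)⟩
      rw [← Λ.vtx_opp]
      exact hsymm (hcorner _ ((S.vertexAt_opp k).trans hk1))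
    obtain ⟨h, hh, rfl⟩ := hv
    obtain ⟨h', hh', rfl⟩ := hw
    exact (hsymm (hcorner h hh)).trans ((key h h' hh hh').trans (hcorner h' hh'))
  · rintro _ ⟨h, hh, rfl⟩
    have h1 : (Λ.link p).loopSet (Λ.vtx h) = ∅ := by
      ext e
      simpa using fun hl : (Λ.link p).IsLoopAt e (Λ.vtx h) => hG _ _ hl.2
    rw [degree, h1, Set.ncard_empty, add_zero, Λ.incidenceSet_link p h hh, Set.ncard_pair]
    intro heq
    exact Λ.corner_opp_ne hG h (hp hh ((S.vertexAt_opp h).trans hh) heq).symm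

open Classical in
/-- The ends of sides at the vertex `v` between the edges `e` and `f`. -/
noncomputable def ends (v : α) (e f : β) : Finset S.SideEnd :=
  Finset.univ.filter fun h =>
    Λ.vtx h = v ∧ Λ.edge (S.corner h) = e ∧ Λ.edge (S.corner (S.opp h)) = f

open Classical in
/-- The list of the links that are cycles. -/
noncomputable def goodLinks [Fintype S.Vertex] : List (Graph α β) :=
  ((Finset.univ : Finset S.Vertex).filter Λ.Good).toList.map Λ.link

theorem mem_goodLinks [Fintype S.Vertex] {C : Graph α β} :
    C ∈ Λ.goodLinks ↔ ∃ p, Λ.Good p ∧ Λ.link p = C := by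
  simp [goodLinks]

/-- If two corners at `p` carry the same edge, local injectivity makes them adjacent across both
ends of it, so the link closes up after these two corners and has a single edge. Such links do not
affect counts for `e ≠ f` and can be dropped. -/
theorem good_of_mem (p : S.Vertex) {e f : β} (hef : e ≠ f) (he : e ∈ E(Λ.link p))
    (hf : f ∈ E(Λ.link p)) : Λ.Good p := by
  intro s hs t ht hst
  by_contra hne
  have hs0 := Λ.isLink s
  have ht0 := Λ.isLink t
  rw [hst] at hs0
  have hE : ∀ k : S.SideEnd, S.corner k = s ∨ S.corner k = t → S.vertexAt k = p := by
    rintro k (hk | hk)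
    · rw [SidePairing.vertexAt, hk]; exact hs
    · rw [SidePairing.vertexAt, hk]; exact ht
  have hswap : ∀ k : S.SideEnd, (S.corner k = s → S.corner (S.opp k) = t) ∧
      (S.corner k = t → S.corner (S.opp k) = s) := by
    intro k
    constructor
    · intro hk
      have hi := Λ.inc_corner k
      rw [hk, hst] at hi
      obtain ⟨k', hk', hv⟩ := Λ.exists_end_of_inc hi
      rcases Λ.inj k k' ((hE k (Or.inl hk)).trans (hE k' (Or.inr hk')).symm) hv.symm with rfl | rfl
      · exact absurd (hk.symm.trans hk') hne
      · exact hk'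
    · intro hk
      have hi := Λ.inc_corner k
      rw [hk, ← hst] at hi
      obtain ⟨k', hk', hv⟩ := Λ.exists_end_of_inc hi
      rcases Λ.inj k k' ((hE k (Or.inr hk)).trans (hE k' (Or.inl hk')).symm) hv.symm with rfl | rfl
      · exact absurd (hk'.symm.trans hk) hne
      · exact hk'
  have hall : ∀ r : S.Side, (Quot.mk _ r : S.Vertex) = p → r = s ∨ r = t := by
    intro r hr
    refine S.of_vertex_eq (Q := fun r => r = s ∨ r = t) ?_ (hs.trans hr.symm) (Or.inl rfl)
    rintro k (hk | hk)
    · exact Or.inr ((hswap k).1 hk)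
    · exact Or.inl ((hswap k).2 hk)
  obtain ⟨s', hs', rfl⟩ := he
  obtain ⟨t', ht', rfl⟩ := hf
  apply hef
  rcases hall s' hs' with rfl | rfl <;> rcases hall t' ht' with rfl | rfl <;> simp [hst]

/-- A link containing both edges passes between them at `v` across one edge-end of the surface. Of
its two side-ends, the order of `e` and `f` selects one. -/
theorem countBoth_goodLinks [Fintype S.Vertex] {v : α} {e f : β} (hef : e ≠ f)
    (he : G.Inc e v) (hf : G.Inc f v) :
    countBoth Λ.goodLinks e f = (Λ.ends v e f).card := by
  classical
  rw [countBoth, goodLinks]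
  have := countP_toList_map ((Finset.univ : Finset S.Vertex).filter Λ.Good) Λ.link
    (fun C => e ∈ E(C) ∧ f ∈ E(C))
  refine Eq.trans (by convert this) (Eq.symm ?_)
  refine Finset.card_bij (fun h _ => S.vertexAt h) ?_ ?_ ?_
  · intro h hh
    simp only [ends, Finset.mem_filter, Finset.mem_univ, true_and] at hh
    have h1 : e ∈ E(Λ.link (S.vertexAt h)) := ⟨_, rfl, hh.2.1⟩
    have h2 : f ∈ E(Λ.link (S.vertexAt h)) := ⟨_, S.vertexAt_opp h, hh.2.2⟩
    simp only [Finset.mem_filter, Finset.mem_univ, true_and]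
    exact ⟨Λ.good_of_mem _ hef h1 h2, h1, h2⟩
  · intro h hh h' hh' heq
    simp only [ends, Finset.mem_filter, Finset.mem_univ, true_and] at hh hh'
    rcases Λ.inj h h' heq (hh.1.trans hh'.1.symm) with rfl | rfl
    · rfl
    · exact absurd (hh'.2.1.symm.trans hh.2.2) hef
  · intro p hp
    simp only [Finset.mem_filter, Finset.mem_univ, true_and] at hp
    obtain ⟨-, ⟨s, hs, rfl⟩, ⟨t, ht, rfl⟩⟩ := hp
    obtain ⟨h, hh, hv⟩ := Λ.exists_end_of_inc he
    obtain ⟨h', hh', hv'⟩ := Λ.exists_end_of_inc hf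
    have hhp : S.vertexAt h = p := by rw [SidePairing.vertexAt, hh]; exact hs
    have hhp' : S.vertexAt h' = p := by rw [SidePairing.vertexAt, hh']; exact ht
    rcases Λ.inj h h' (hhp.trans hhp'.symm) (hv.trans hv'.symm) with rfl | rfl
    · rw [← hh, ← hh'] at hef
      exact absurd rfl hef
    · exact ⟨h, by simp [ends, hv, hh, hh'], hhp⟩

/-- Passing to the other end of a side injects the ends at `v` into those at `μ v`, with the corners
changed by `σ v`. Used at `v` and at `μ v`, this gives the balance condition. -/
theorem card_ends_le {μ : α → α} {σ : α → β → β}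
    (hμ : ∀ h : S.SideEnd, Λ.vtx (h.1, !h.2) = μ (Λ.vtx h))
    (hσ : ∀ h : S.SideEnd, Λ.edge (S.corner (h.1, !h.2)) = σ (Λ.vtx h) (Λ.edge (S.corner h)))
    (v : α) (e f : β) :
    (Λ.ends v e f).card ≤ (Λ.ends (μ v) (σ v e) (σ v f)).card := by
  classical
  refine Finset.card_le_card_of_injOn (fun h => (h.1, !h.2)) ?_ ?_
  · intro h hh
    simp only [ends, Finset.coe_filter, Finset.mem_univ, true_and, Set.mem_ofPred_eq] at hh ⊢
    obtain ⟨rfl, rfl, rfl⟩ := hh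
    refine ⟨hμ h, hσ h, ?_⟩
    rw [S.opp_not, hσ (S.opp h), Λ.vtx_opp]
  · intro h _ h' _ heq
    simpa [Prod.ext_iff] using heq

/-- There are fewer vertices than edges, hence more than twice as many corners as vertices, and some
vertex has more than two corners. Its link is good, since a degenerate link has at most two corners.
-/
theorem exists_large_link [Fintype S.Vertex] (hχ : S.eulerChar < S.m) :
    ∃ C ∈ Λ.goodLinks, 2 < E(C).ncard := by
  classical
  have h1 : Nat.card S.Vertex * 2 < Nat.card S.Side := by
    rw [S.card_side]
    rw [SidePairing.eulerChar] at hχ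
    omega
  rw [Nat.card_eq_fintype_card, Nat.card_eq_fintype_card] at h1
  obtain ⟨p, hp⟩ := Fintype.exists_lt_card_fiber_of_mul_lt_card
    (f := fun s => S.vertexAt (s, false)) h1
  have hp' : 2 < {s : S.Side | (Quot.mk _ s : S.Vertex) = p}.ncard := by
    rw [Set.ncard_eq_toFinset_card', Set.toFinset_ofPred]
    exact hp
  have hgood : Λ.Good p := by
    by_contra hbad
    obtain ⟨s, hs⟩ : ∃ s : S.Side, (Quot.mk _ s : S.Vertex) = p := Quot.exists_rep p
    have hsub : ∀ e ∈ E(Λ.link p), ∀ f ∈ E(Λ.link p), e = f := fun e he f hf => by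
      by_contra hef
      exact hbad (Λ.good_of_mem p hef he hf)
    have hle : {s : S.Side | (Quot.mk _ s : S.Vertex) = p} ⊆
        S.corner '' {h | S.vertexAt h = p ∧ Λ.vtx h = Λ.vtx (s, false)} := by
      intro t ht
      have hi : G.Inc (Λ.edge t) (Λ.vtx (s, false)) := by
        rw [hsub _ ⟨t, ht, rfl⟩ _ ⟨s, hs, rfl⟩]
        exact Λ.inc_corner (s, false)
      obtain ⟨k, hk, hv⟩ := Λ.exists_end_of_inc hi
      refine ⟨k, ⟨?_, hv⟩, hk⟩
      rw [SidePairing.vertexAt, hk]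
      exact ht
    have hle2 : {h | S.vertexAt h = p ∧ Λ.vtx h = Λ.vtx (s, false)} ⊆
        {(s, false), S.opp (s, false)} := fun k hk =>
      Λ.inj (s, false) k (Eq.trans hs hk.1.symm) hk.2.symm
    have h3 := Set.ncard_le_ncard hle
    have h4 := Set.ncard_image_le (f := S.corner)
      (s := {h | S.vertexAt h = p ∧ Λ.vtx h = Λ.vtx (s, false)})
    have h5 := Set.ncard_le_ncard hle2
    have h6 := Set.ncard_insert_le (s, false) {S.opp (s, false)}
    rw [Set.ncard_singleton] at h6
    omega
  refine ⟨Λ.link p, Λ.mem_goodLinks.2 ⟨p, hgood, rfl⟩, ?_⟩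
  change 2 < (Λ.edge '' {s | Quot.mk _ s = p}).ncard
  rw [hgood.ncard_image]
  exact hp'

end LinkLabelling

end Links

open scoped Graph

/-! ### Cuts and matched graphs -/

section Connectivity

variable {α β : Type*} {G : Graph α β}

theorem localEdgeConn_le {x y : α} {Y : Set β} (hY : Y.Finite)
    (h : ∀ w, IsPath G x w y → ∃ e ∈ w.map Prod.fst, e ∈ Y) : localEdgeConn G x y ≤ Y.ncard := by
  refine csSup_le ⟨0, fun i => i.elim0, fun i => i.elim0, fun i => i.elim0⟩ ?_
  rintro k ⟨P, hP, hdisj⟩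
  choose e he heY using fun i => h (P i) (hP i)
  have hinj : Function.Injective e := by
    intro i j hij
    by_contra hne
    exact hdisj hne (he i) (hij ▸ he j)
  have h1 : (Set.range e).ncard = k := by
    rw [← Set.image_univ, hinj.injOn.ncard_image, Set.ncard_univ, Nat.card_fin]
  rw [← h1]
  exact Set.ncard_le_ncard (Set.range_subset_iff.2 heY) hY

/-- The edges with exactly one end in `X`. -/
def cutEdges (G : Graph α β) (X : Set α) : Set β := {e | ∃ a b, G.IsLink e a b ∧ a ∈ X ∧ b ∉ X}

theorem cutEdges_subset (X : Set α) : cutEdges G X ⊆ E(G) := by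
  rintro e ⟨a, b, h, -, -⟩
  exact h.edge_mem

theorem IsWalk.exists_mem_cutEdges {x y : α} {w : List (β × α)} (h : IsWalk G x w y) {X : Set α}
    (hx : x ∈ X) (hy : y ∉ X) : ∃ e ∈ w.map Prod.fst, e ∈ cutEdges G X := by
  induction h with
  | nil => exact absurd hx hy
  | @cons x z y e w h hw ih =>
    by_cases hz : z ∈ X
    · obtain ⟨f, hf, hf'⟩ := ih hz hy
      exact ⟨f, List.mem_cons_of_mem _ hf, hf'⟩
    · exact ⟨e, List.mem_cons_self, x, z, h, hx, hz⟩

theorem localEdgeConn_le_ncard_cutEdges (hE : E(G).Finite) {x y : α} {X : Set α} (hx : x ∈ X)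
    (hy : y ∉ X) : localEdgeConn G x y ≤ (cutEdges G X).ncard :=
  localEdgeConn_le (hE.subset (cutEdges_subset X)) fun _ hw => hw.1.exists_mem_cutEdges hx hy

theorem mem_delta {e : β} {v : α} : e ∈ delta G v ↔ ∃ y, y ≠ v ∧ G.IsLink e v y := Iff.rfl

theorem cutEdges_singleton (v : α) : cutEdges G {v} = delta G v := by
  ext e
  rw [mem_delta]
  constructor
  · rintro ⟨a, b, h, rfl, hb⟩
    exact ⟨b, hb, h⟩
  · rintro ⟨y, hy, h⟩
    exact ⟨v, y, h, rfl, hy⟩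

theorem degree_eq (hE : E(G).Finite) (v : α) :
    degree G v = (delta G v).ncard + 2 * (G.loopSet v).ncard := by
  have h1 : G.incidenceSet v = delta G v ∪ G.loopSet v := by
    ext e
    constructor
    · rintro ⟨y, h⟩
      by_cases hy : y = v
      · subst hy; exact Or.inr h
      · exact Or.inl ⟨y, hy, h⟩
    · rintro (⟨y, -, h⟩ | h)
      · exact ⟨y, h⟩
      · exact ⟨v, h⟩
  have h2 : Disjoint (delta G v) (G.loopSet v) := by
    rw [Set.disjoint_left]
    rintro e ⟨y, hy, h⟩ h'
    exact hy (h.right_unique h')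
  have h3 : (delta G v).Finite := hE.subset fun e ⟨_, _, h⟩ => h.edge_mem
  have h4 : (G.loopSet v).Finite := hE.subset fun e h => Graph.IsLink.edge_mem h
  rw [degree, h1, Set.ncard_union_eq h2 h3 h4]
  omega

theorem component_closed {v x y : α} {e : β} (hx : x ∈ component G v) (h : G.IsLink e x y) :
    y ∈ component G v :=
  ⟨h.right_mem, hx.2.tail ⟨e, h⟩⟩

theorem reflTransGen_adj_symm {x y : α} (h : Relation.ReflTransGen G.Adj x y) :
    Relation.ReflTransGen G.Adj y x :=
  haveI : Std.Symm G.Adj := ⟨fun _ _ h => h.symm⟩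
  Relation.ReflTransGen.stdSymm.symm _ _ h

/-- Every vertex is matched with another one, to which it is as well connected as possible; the
edges at matched vertices are identified. -/
structure IsMatched (G : Graph α β) (μ : α → α) (σ : α → β → β) : Prop where
  inv : ∀ v ∈ V(G), μ v ∈ V(G) ∧ μ v ≠ v ∧ μ (μ v) = v
  bij : ∀ v ∈ V(G), Set.BijOn (σ v) (delta G v) (delta G (μ v))
  conn : ∀ v ∈ V(G), localEdgeConn G v (μ v) = degree G v
  symm : ∀ v ∈ V(G), ∀ e ∈ delta G v, σ (μ v) (σ v e) = e

namespace IsMatched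

variable {μ : α → α} {σ : α → β → β}

/-- A loop would count in the degree but not in the cut around `v`, which bounds the local
edge-connectivity. -/
theorem loopSet_eq (h : IsMatched G μ σ) (hE : E(G).Finite) {v : α} (hv : v ∈ V(G)) :
    G.loopSet v = ∅ := by
  have h1 := h.conn v hv
  have h2 : localEdgeConn G v (μ v) ≤ (cutEdges G {v}).ncard :=
    localEdgeConn_le_ncard_cutEdges hE rfl (h.inv v hv).2.1
  rw [cutEdges_singleton] at h2
  rw [degree_eq hE] at h1
  have h3 : (G.loopSet v).Finite := hE.subset fun e h => Graph.IsLink.edge_mem h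
  rw [← Set.ncard_eq_zero h3]
  omega

theorem not_isLoopAt (h : IsMatched G μ σ) (hE : E(G).Finite) (e : β) (x : α) :
    ¬ G.IsLoopAt e x := fun hl => by
  have h1 : e ∈ G.loopSet x := hl
  rw [h.loopSet_eq hE (Graph.IsLink.left_mem hl)] at h1
  exact h1

theorem mem_delta_iff (h : IsMatched G μ σ) (hE : E(G).Finite) {e : β} {v : α} :
    e ∈ delta G v ↔ G.Inc e v := by
  constructor
  · rintro ⟨y, -, hy⟩
    exact ⟨y, hy⟩
  · rintro ⟨y, hy⟩
    refine ⟨y, ?_, hy⟩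
    rintro rfl
    exact h.not_isLoopAt hE e y hy

theorem conn_eq (h : IsMatched G μ σ) (hE : E(G).Finite) {v : α} (hv : v ∈ V(G)) :
    localEdgeConn G v (μ v) = (delta G v).ncard := by
  rw [h.conn v hv, degree_eq hE, h.loopSet_eq hE hv, Set.ncard_empty]
  omega

theorem ncard_delta_le (h : IsMatched G μ σ) (hE : E(G).Finite) {v : α} (hv : v ∈ V(G))
    {X : Set α} (hx : v ∈ X) (hy : μ v ∉ X) : (delta G v).ncard ≤ (cutEdges G X).ncard := by
  rw [← h.conn_eq hE hv]
  exact localEdgeConn_le_ncard_cutEdges hE hx hy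

/-- Otherwise the component would be a cut without edges between `v` and `μ v`, although `v` has
positive degree. -/
theorem map_mem_component (h : IsMatched G μ σ) (hE : E(G).Finite) {u v : α}
    (hv : v ∈ component G u) {e : β} (he : G.Inc e v) : μ v ∈ component G u := by
  by_contra hn
  have h1 := h.ncard_delta_le hE hv.1 (X := component G u) hv hn
  have h2 : cutEdges G (component G u) = ∅ := by
    rw [Set.eq_empty_iff_forall_notMem]
    rintro f ⟨a, b, hab, ha, hb⟩
    exact hb (component_closed ha hab)
  have h3 : 0 < (delta G v).ncard :=
    (Set.ncard_pos (hE.subset fun e he => ((h.mem_delta_iff hE).1 he).edge_mem)).2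
      ⟨e, (h.mem_delta_iff hE).2 he⟩
  rw [h2, Set.ncard_empty] at h1
  omega

/-- In a component with two different vertices each vertex has an edge. -/
theorem exists_inc_of_component {u v w : α} (hv : v ∈ component G u) (hw : w ∈ component G u)
    (hne : v ≠ w) : ∃ e, G.Inc e v := by
  rcases Relation.ReflTransGen.cases_head ((reflTransGen_adj_symm hv.2).trans hw.2) with
    h | ⟨c, ⟨e, he⟩, -⟩
  · exact absurd h hne
  · exact ⟨e, c, he⟩

end IsMatched

end Connectivity

/-! ### Graphs with small components only -/

section Banana

variable {α β : Type*}

/-- The subgraph on the vertices `v` and `w` with the edges between them that lie in `F`. -/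
def banana (G : Graph α β) (v w : α) (F : Finset β) : Graph α β where
  vertexSet := {x | x = v ∨ x = w}
  edgeSet := {e | e ∈ F ∧ G.IsLink e v w}
  IsLink e x y := (e ∈ F ∧ G.IsLink e v w) ∧ G.IsLink e x y
  isLink_symm _ _ := ⟨fun _ _ h => ⟨h.1, h.2.symm⟩⟩
  eq_or_eq_of_isLink_of_isLink _ _ _ _ _ h h' := h.2.left_eq_or_eq h'.2
  edge_mem_iff_exists_isLink _ := ⟨fun h => ⟨v, w, h, h.2⟩, fun ⟨_, _, h⟩ => h.1⟩
  left_mem_of_isLink := fun _ _ _ h => h.2.left_eq_or_eq h.1.2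

theorem isCycleOf_banana {G : Graph α β} {v w : α} (hv : v ∈ V(G)) (hw : w ∈ V(G)) (hne : v ≠ w)
    {F : Finset β} (hF : F.card = 2) (hlink : ∀ e ∈ F, G.IsLink e v w) :
    IsCycleOf (banana G v w F) G := by
  have hadj : (banana G v w F).Adj v w := by
    obtain ⟨e, he⟩ : F.Nonempty := Finset.card_pos.1 (by omega)
    exact ⟨e, ⟨he, hlink e he⟩, hlink e he⟩
  refine ⟨⟨?_, fun e x y h => h.2⟩, ?_, ?_, ⟨v, Or.inl rfl⟩, ?_, ?_⟩
  · rintro x (rfl | rfl)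
    · exact hv
    · exact hw
  · exact Set.toFinite ({v, w} : Set α)
  · exact F.finite_toSet.subset fun e he => he.1
  · intro x hx
    refine Set.Subset.antisymm (fun y hy => hy.1) fun y hy => ⟨hy, ?_⟩
    rcases hx with rfl | rfl <;> rcases hy with rfl | rfl
    · exact .refl
    · exact .single hadj
    · exact .single hadj.symm
    · exact .refl
  · intro x hx
    have h1 : (banana G v w F).loopSet x = ∅ := by
      rw [Set.eq_empty_iff_forall_notMem]
      rintro e ⟨he, h⟩
      rcases hx with rfl | rfl
      · exact hne (h.right_unique he.2)
      · exact hne (h.right_unique he.2.symm).symm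
    have h2 : (banana G v w F).incidenceSet x = (F : Set β) := by
      ext e
      constructor
      · rintro ⟨y, ⟨he, -⟩, -⟩
        exact he
      · intro he
        rcases hx with rfl | rfl
        · exact ⟨w, ⟨he, hlink e he⟩, hlink e he⟩
        · exact ⟨v, ⟨he, hlink e he⟩, (hlink e he).symm⟩
    rw [degree, h1, h2, Set.ncard_empty, Set.ncard_coe_finset, hF]

open Classical in
theorem countBoth_banana {G : Graph α β} {v w : α} {Δ : Finset β} (hΔ : ∀ e, e ∈ Δ ↔ G.IsLink e v w) {e f : β} (hef : e ≠ f) :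
    countBoth ((Δ.powersetCard 2).toList.map (banana G v w)) e f =
      if e ∈ Δ ∧ f ∈ Δ then 1 else 0 := by
  rw [countBoth]
  have h := countP_toList_map (Δ.powersetCard 2) (banana G v w)
    (fun C => e ∈ E(C) ∧ f ∈ E(C))
  refine Eq.trans (by convert h) ?_
  have hmem : ∀ (F : Finset β) (e : β), e ∈ E(banana G v w F) ↔ e ∈ F ∧ e ∈ Δ := fun F e => by
    rw [hΔ]; rfl
  simp only [hmem]
  split_ifs with hin
  · rw [Finset.card_eq_one]
    refine ⟨{e, f}, ?_⟩
    ext F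
    rw [Finset.mem_filter, Finset.mem_powersetCard, Finset.mem_singleton]
    constructor
    · rintro ⟨⟨hF, hc⟩, ⟨he, -⟩, hf, -⟩
      refine (Finset.eq_of_subset_of_card_le ?_ ?_).symm
      · intro x hx
        rcases Finset.mem_insert.1 hx with rfl | hx
        · exact he
        · rw [Finset.mem_singleton.1 hx]; exact hf
      · rw [hc, Finset.card_pair hef]
    · rintro rfl
      refine ⟨⟨?_, Finset.card_pair hef⟩, ⟨by simp, hin.1⟩, by simp, hin.2⟩
      intro x hx
      rcases Finset.mem_insert.1 hx with rfl | hx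
      · exact hin.1
      · rw [Finset.mem_singleton.1 hx]; exact hin.2
  · rw [Finset.card_eq_zero, Finset.filter_eq_empty_iff]
    rintro F - ⟨⟨-, h1⟩, -, h2⟩
    exact hin ⟨h1, h2⟩

end Banana

section SmallComponents

variable {α β : Type*} {G : Graph α β} {μ : α → α} {σ : α → β → β}

/-- Near a cycle the component is `{v, μ v}`, because a third vertex would bring its partner along.
All edges at these vertices are parallel, and the list of all pairs of them is balanced under any
bijections. -/
theorem IsMatched.exists_list_of_small (h : IsMatched G μ σ) (hV : V(G).Finite) (hE : E(G).Finite)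
    (hC : ∃ C, IsCycleOf C G) (hsmall : ¬ ∃ v ∈ V(G), 4 ≤ (component G v).ncard) :
    ∃ L : List (Graph α β), L ≠ [] ∧ (∀ C ∈ L, IsCycleOf C G) ∧
      ∀ v ∈ V(G), ∀ e ∈ delta G v, ∀ f ∈ delta G v, e ≠ f →
        countBoth L e f = countBoth L (σ v e) (σ v f) := by
  classical
  obtain ⟨C, hCG, hC⟩ := hC
  obtain ⟨v, hvC⟩ := hC.nonempty
  have hv : v ∈ V(G) := hCG.vertexSet_mono hvC
  have hvc : v ∈ component G v := ⟨hv, .refl⟩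
  have hloop : C.loopSet v = ∅ := by
    rw [Set.eq_empty_iff_forall_notMem]
    intro e he
    exact h.not_isLoopAt hE e v (hCG.2 he)
  have hinc : (C.incidenceSet v).ncard = 2 := by
    have := hC.two_regular v hvC
    rwa [degree, hloop, Set.ncard_empty, add_zero] at this
  obtain ⟨e₁, e₂, h12, hi⟩ := Set.ncard_eq_two.1 hinc
  have hi1 : e₁ ∈ C.incidenceSet v := by rw [hi]; exact Or.inl rfl
  have hi2 : e₂ ∈ C.incidenceSet v := by rw [hi]; exact Or.inr rfl
  obtain ⟨y₁, hy1⟩ := hi1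
  obtain ⟨y₂, hy2⟩ := hi2
  replace hy1 := hCG.2 hy1
  replace hy2 := hCG.2 hy2
  have hne : v ≠ μ v := (h.inv v hv).2.1.symm
  have hμ : μ v ∈ V(G) := (h.inv v hv).1
  have hμc : μ v ∈ component G v := h.map_mem_component hE hvc ⟨y₁, hy1⟩
  have hcomp : ∀ w ∈ component G v, w = v ∨ w = μ v := by
    intro w hw
    by_contra hcon
    rw [not_or] at hcon
    obtain ⟨e, he⟩ := IsMatched.exists_inc_of_component hw hvc hcon.1
    have hμw := h.map_mem_component hE hw he
    have h0 := h.inv w hw.1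
    apply hsmall
    refine ⟨v, hv, ?_⟩
    have h1 : ({v, μ v, w, μ w} : Finset α).card = 4 := by
      have ha : v ≠ μ w := fun hvw => hcon.2 (by rw [hvw, h0.2.2])
      have hb : μ v ≠ μ w := fun hvw => hcon.1 (by rw [← h0.2.2, ← hvw, (h.inv v hv).2.2])
      rw [Finset.card_insert_of_notMem, Finset.card_insert_of_notMem, Finset.card_pair]
      · exact h0.2.1.symm
      · simp [hb, Ne.symm hcon.2]
      · simp [hne, ha, Ne.symm hcon.1]
    rw [← h1, ← Set.ncard_coe_finset]
    refine Set.ncard_le_ncard ?_ (hV.subset fun x hx => hx.1)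
    intro x hx
    simp only [Finset.coe_insert, Finset.coe_singleton, Set.mem_insert_iff,
      Set.mem_singleton_iff] at hx
    rcases hx with rfl | rfl | rfl | rfl
    · exact hvc
    · exact hμc
    · exact hw
    · exact hμw
  have hlink : ∀ e, G.Inc e v → G.IsLink e v (μ v) := by
    rintro e ⟨y, hy⟩
    rcases hcomp y (component_closed hvc hy) with rfl | rfl
    · exact absurd hy (h.not_isLoopAt hE e y)
    · exact hy
  have hlink' : ∀ e, G.Inc e (μ v) → G.IsLink e v (μ v) := by
    rintro e ⟨y, hy⟩
    rcases hcomp y (component_closed hμc hy) with rfl | rfl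
    · exact hy.symm
    · exact absurd hy (h.not_isLoopAt hE e _)
  have hfin : {e | G.IsLink e v (μ v)}.Finite := hE.subset fun e he => Graph.IsLink.edge_mem he
  have hΔ : ∀ e, e ∈ hfin.toFinset ↔ G.IsLink e v (μ v) := fun e => hfin.mem_toFinset
  have hin : ∀ w ∈ V(G), ∀ e ∈ delta G w, (e ∈ hfin.toFinset ↔ w = v ∨ w = μ v) := by
    intro w hw e he
    rw [h.mem_delta_iff hE] at he
    rw [hΔ]
    constructor
    · intro hl
      exact he.eq_or_eq_of_isLink hl
    · rintro (rfl | rfl)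
      · exact hlink e he
      · exact hlink' e he
  refine ⟨(hfin.toFinset.powersetCard 2).toList.map (banana G v (μ v)), ?_, ?_, ?_⟩
  · have hmem : ({e₁, e₂} : Finset β) ∈ hfin.toFinset.powersetCard 2 := by
      rw [Finset.mem_powersetCard]
      refine ⟨?_, Finset.card_pair h12⟩
      intro x hx
      rw [hΔ]
      rcases Finset.mem_insert.1 hx with rfl | hx
      · exact hlink _ ⟨y₁, hy1⟩
      · rw [Finset.mem_singleton.1 hx]; exact hlink _ ⟨y₂, hy2⟩
    exact List.ne_nil_of_mem (List.mem_map_of_mem (Finset.mem_toList.2 hmem))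
  · intro C hC
    obtain ⟨F, hF, rfl⟩ := List.mem_map.1 hC
    rw [Finset.mem_toList, Finset.mem_powersetCard] at hF
    exact isCycleOf_banana hv hμ hne hF.2 fun e he => (hΔ e).1 (hF.1 he)
  · intro w hw e he f hf hef
    have hσe := (h.bij w hw).mapsTo he
    have hσf := (h.bij w hw).mapsTo hf
    have hσ : σ w e ≠ σ w f := fun heq => hef ((h.bij w hw).injOn he hf heq)
    rw [countBoth_banana hΔ hef, countBoth_banana hΔ hσ]
    simp only [hin w hw e he, hin w hw f hf, hin _ (h.inv w hw).1 _ hσe,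
      hin _ (h.inv w hw).1 _ hσf]
    have hiff : (w = v ∨ w = μ v) ↔ (μ w = v ∨ μ w = μ v) := by
      constructor
      · rintro (rfl | rfl)
        · exact Or.inr rfl
        · exact Or.inl (h.inv v hv).2.2
      · rintro (h1 | h1)
        · exact Or.inr (by rw [← h1, (h.inv w hw).2.2])
        · exact Or.inl (by rw [← (h.inv w hw).2.2, h1, (h.inv v hv).2.2])
    simp only [hiff]

end SmallComponents

/-! ### Boundary words as runs along lines -/

section Runs

namespace LineSystem

variable {n : ℕ} {E : Type*} (D : LineSystem n E)

theorem read_add (k l : ℕ) (e : E) :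
    D.read (k + l) e = D.read k e ++ D.read l ((D.nxt ^ k) e) := by
  induction l with
  | zero => simp [read]
  | succ l ih =>
    rw [← add_assoc, read_succ, ih, read_succ, List.append_assoc, ← Equiv.Perm.mul_apply, ← pow_add,
      add_comm l k]

theorem mk_read_pow {N : ℕ} {e : E} (hN : (D.nxt ^ N) e = e) (k : ℕ) :
    FreeGroup.mk (D.read N e) ^ k = FreeGroup.mk (D.read (N * k) e) := by
  induction k with
  | zero => simp [read, FreeGroup.one_eq_mk]
  | succ k ih =>
    have h : (D.nxt ^ (N * k)) e = e := by
      rw [pow_mul]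
      exact Function.IsFixedPt.perm_pow hN k
    rw [pow_succ, ih, FreeGroup.mul_mk, Nat.mul_succ, read_add, h]

/-- A reversal of the lines of a line system. -/
structure IsReversal (rev : E → E) : Prop where
  hd_rev : ∀ e, D.hd (rev e) = D.tl e
  nxt_rev : ∀ e, D.nxt (rev (D.nxt e)) = rev e

variable {D} {rev : E → E}

theorem IsReversal.inv_mk_read (h : D.IsReversal rev) (k : ℕ) (e : E) :
    (FreeGroup.mk (D.read k e))⁻¹ = FreeGroup.mk (D.read k (rev ((D.nxt ^ k) e))) := by
  induction k with
  | zero => simp [read]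
  | succ k ih =>
    have h1 : D.read (k + 1) e = D.read k e ++ [D.hd ((D.nxt ^ k) e)] := D.read_succ k e
    have h2 : D.read (k + 1) (rev ((D.nxt ^ (k + 1)) e)) =
        [letterInv (D.hd ((D.nxt ^ k) e))] ++ D.read k (rev ((D.nxt ^ k) e)) := by
      rw [add_comm k 1, read_add, pow_add, pow_one, Equiv.Perm.mul_apply, h.nxt_rev]
      congr 1
      simp [read, h.hd_rev, tl_nxt]
    rw [h1, h2, ← FreeGroup.mul_mk, ← FreeGroup.mul_mk, mul_inv_rev, ih]
    exact congrArg₂ (· * ·) (letterElt_letterInv _).symm rfl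

/-- A negative power is read along the reversed line, so the sign of the exponent plays no role. -/
theorem IsReversal.exists_toWord_zpow (h : D.IsReversal rev) {N : ℕ} (hN : D.nxt ^ N = 1) (e : E)
    (k : ℤ) : ∃ (M : ℕ) (e' : E), D.nxt ^ M = 1 ∧
      (FreeGroup.mk (D.read N e) ^ k).toWord = D.read M e' := by
  have hfix : ∀ e, (D.nxt ^ N) e = e := fun e => by rw [hN]; rfl
  have hpow : ∀ k, D.nxt ^ (N * k) = 1 := fun k => by rw [pow_mul, hN, one_pow]
  obtain ⟨k, rfl | rfl⟩ := k.eq_nat_or_neg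
  · refine ⟨N * k, e, hpow k, ?_⟩
    rw [zpow_natCast, D.mk_read_pow (hfix e), D.toWord_read]
  · refine ⟨N * k, rev e, hpow k, ?_⟩
    rw [zpow_neg, zpow_natCast, ← inv_pow, h.inv_mk_read, hfix, D.mk_read_pow (hfix _),
      D.toWord_read]

theorem val_finRotate {m : ℕ} (j : Fin m) : (finRotate m j : ℕ) = (j + 1) % m := by
  rcases m with _ | m
  · exact j.elim0
  · rw [finRotate_apply, Fin.val_add, Fin.val_one', Nat.add_mod_mod]

/-- The boundary of each disk of a tiling runs along lines. -/
theorem IsReversal.exists_run (h : D.IsReversal rev) {N : ℕ} (hN : D.nxt ^ N = 1)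
    {S : SidePairing} {ℓ : S.Side → Fin n × Bool}
    (hS : ∀ i, ∃ e, ∃ k : ℤ,
      List.IsRotated (boundaryWord S ℓ i) (FreeGroup.mk (D.read N e) ^ k).toWord) :
    ∃ c : S.Side → E, (∀ s, D.hd (c s) = ℓ s) ∧ ∀ s, c (S.next s) = D.nxt (c s) := by
  have key : ∀ i, ∃ e : E, D.nxt ^ S.sides i = 1 ∧ ∀ j : Fin (S.sides i),
      D.hd ((D.nxt ^ (j : ℕ)) e) = ℓ ⟨i, j⟩ := by
    intro i
    obtain ⟨e, k, hk⟩ := hS i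
    obtain ⟨M, e', hM, hw⟩ := h.exists_toWord_zpow hN e k
    rw [hw] at hk
    obtain ⟨r, hr⟩ := hk.symm
    have hlen : M = S.sides i := by
      have := congrArg List.length hr
      simpa [length_read, boundaryWord] using this
    subst hlen
    refine ⟨(D.nxt ^ r) e', hM, fun j => ?_⟩
    have hj : (j : ℕ) < ((D.read (S.sides i) e').rotate r).length := by
      simp [length_read]
    have h1 : ((D.read (S.sides i) e').rotate r)[(j : ℕ)] = ℓ ⟨i, j⟩ := by
      have : (boundaryWord S ℓ i)[(j : ℕ)]'(by simp [boundaryWord]) = ℓ ⟨i, j⟩ := by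
        simp [boundaryWord]
      rw [← this]
      congr 1
    rw [← h1, List.getElem_rotate]
    simp only [read, List.getElem_map, List.getElem_range, List.length_map, List.length_range]
    rw [← Equiv.Perm.mul_apply, ← pow_add, ← Nat.mod_add_div ((j : ℕ) + r) (S.sides i), pow_add,
      pow_mul, hM, one_pow, mul_one, Nat.mod_add_div]
  choose e he hd using key
  refine ⟨fun s => (D.nxt ^ (s.2 : ℕ)) (e s.1), fun s => hd s.1 s.2, ?_⟩
  rintro ⟨i, j⟩
  change (D.nxt ^ ((finRotate _ j : Fin _) : ℕ)) (e i) = D.nxt ((D.nxt ^ (j : ℕ)) (e i))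
  rw [val_finRotate, ← Equiv.Perm.mul_apply, ← pow_succ', ← Nat.mod_add_div ((j : ℕ) + 1)
    (S.sides i), pow_add, pow_mul, he, one_pow, mul_one, Nat.mod_add_div]

end LineSystem

end Runs

/-! ### The words spelled by a component of a matched graph -/

section Darts

open scoped Graph

variable {α β : Type*} {G : Graph α β} {μ : α → α} {σ : α → β → β} {n : ℕ}

/-- A component of a matched graph whose vertices are labelled by the letters of a free group. -/
structure IsLettering (G : Graph α β) (μ : α → α) (b : Fin n × Bool → α) : Prop where
  inj : Function.Injective b
  map : ∀ x, μ (b x) = b (letterInv x)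
  mem : ∀ x, b x ∈ V(G)
  closed : ∀ x e y, G.IsLink e (b x) y → ∃ z, b z = y
  conn : ∀ x y, Relation.ReflTransGen G.Adj (b x) (b y)

/-- The oriented edges between lettered vertices. -/
def Dart (G : Graph α β) (b : Fin n × Bool → α) : Type _ :=
  {d : β × (Fin n × Bool) × (Fin n × Bool) // G.IsLink d.1 (b d.2.1) (b d.2.2)}

namespace Dart

variable {b : Fin n × Bool → α}

def edge (d : Dart G b) : β := d.1.1
def src (d : Dart G b) : Fin n × Bool := d.1.2.1
def tgt (d : Dart G b) : Fin n × Bool := d.1.2.2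

theorem isLink (d : Dart G b) : G.IsLink d.edge (b d.src) (b d.tgt) := d.2

def rev (d : Dart G b) : Dart G b := ⟨(d.edge, d.tgt, d.src), d.isLink.symm⟩

@[simp] theorem edge_rev (d : Dart G b) : d.rev.edge = d.edge := rfl
@[simp] theorem src_rev (d : Dart G b) : d.rev.src = d.tgt := rfl
@[simp] theorem tgt_rev (d : Dart G b) : d.rev.tgt = d.src := rfl
@[simp] theorem rev_rev (d : Dart G b) : d.rev.rev = d := rfl

theorem finite (hE : E(G).Finite) : Finite (Dart G b) := by
  have : Finite E(G) := hE
  refine Finite.of_injective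
    (fun d : Dart G b => ((⟨d.edge, d.isLink.edge_mem⟩ : E(G)), d.src, d.tgt)) ?_
  intro d d' h
  simp only [Prod.mk.injEq, Subtype.mk.injEq] at h
  exact Subtype.ext (Prod.ext h.1 (Prod.ext h.2.1 h.2.2))

theorem ext_src (hb : IsLettering G μ b) {d d' : Dart G b} (he : d.edge = d'.edge)
    (hs : d.src = d'.src) : d = d' := by
  have h := d.isLink
  rw [he, hs] at h
  exact Subtype.ext (Prod.ext he (Prod.ext hs (hb.inj (h.right_unique d'.isLink))))

theorem ext_tgt (hb : IsLettering G μ b) {d d' : Dart G b} (he : d.edge = d'.edge)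
    (hs : d.tgt = d'.tgt) : d = d' := by
  have := ext_src hb (d := d.rev) (d' := d'.rev) he hs
  rw [← rev_rev d, this, rev_rev]

theorem exists_src (hb : IsLettering G μ b) {e : β} {x : Fin n × Bool} (h : G.Inc e (b x)) :
    ∃ d : Dart G b, d.edge = e ∧ d.src = x := by
  obtain ⟨y, hy⟩ := h
  obtain ⟨z, rfl⟩ := hb.closed x e y hy
  exact ⟨⟨(e, x, z), hy⟩, rfl, rfl⟩

theorem exists_nxt (hG : IsMatched G μ σ) (hE : E(G).Finite) (hb : IsLettering G μ b)
    (d : Dart G b) :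
    ∃ d' : Dart G b, d'.edge = σ (b d.tgt) d.edge ∧ d'.src = letterInv d.tgt := by
  refine exists_src hb ((hG.mem_delta_iff hE).1 ?_)
  rw [← hb.map]
  exact (hG.bij _ (hb.mem _)).mapsTo ((hG.mem_delta_iff hE).2 d.isLink.inc_right)

/-- The oriented edge following `d` on its line. -/
noncomputable def nxt (hG : IsMatched G μ σ) (hE : E(G).Finite) (hb : IsLettering G μ b)
    (d : Dart G b) : Dart G b := (exists_nxt hG hE hb d).choose

section

variable (hG : IsMatched G μ σ) (hE : E(G).Finite) (hb : IsLettering G μ b)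

theorem edge_nxt (d : Dart G b) : (nxt hG hE hb d).edge = σ (b d.tgt) d.edge :=
  (exists_nxt hG hE hb d).choose_spec.1

theorem src_nxt (d : Dart G b) : (nxt hG hE hb d).src = letterInv d.tgt :=
  (exists_nxt hG hE hb d).choose_spec.2

/-- Here the symmetry of `σ` enters: following a line backwards retraces it. It makes `nxt`
invertible and `rev` a reversal. -/
theorem nxt_rev_nxt (d : Dart G b) : nxt hG hE hb (nxt hG hE hb d).rev = d.rev := by
  refine ext_src hb ?_ ?_
  · rw [edge_nxt, tgt_rev, edge_rev, edge_nxt, src_nxt, ← hb.map, edge_rev]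
    exact hG.symm _ (hb.mem _) _ ((hG.mem_delta_iff hE).2 d.isLink.inc_right)
  · rw [src_nxt, tgt_rev, src_nxt, letterInv_letterInv, src_rev]

end

/-- The line system of a lettered component. -/
noncomputable def lineSystem (hG : IsMatched G μ σ) (hE : E(G).Finite) (hb : IsLettering G μ b) :
    LineSystem n (Dart G b) where
  nxt :=
    { toFun := nxt hG hE hb
      invFun := fun d => (nxt hG hE hb d.rev).rev
      left_inv := fun d => by
        change (nxt hG hE hb (nxt hG hE hb d).rev).rev = d
        rw [nxt_rev_nxt, rev_rev]
      right_inv := fun d => nxt_rev_nxt hG hE hb d.rev }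
  hd := tgt
  hd_nxt_ne := fun d h => by
    have h2 := (nxt hG hE hb d).isLink
    change (nxt hG hE hb d).tgt = _ at h
    rw [src_nxt, h] at h2
    exact hG.not_isLoopAt hE _ _ h2

variable (hG : IsMatched G μ σ) (hE : E(G).Finite) (hb : IsLettering G μ b)

@[simp] theorem lineSystem_hd (d : Dart G b) : (lineSystem hG hE hb).hd d = d.tgt := rfl

theorem lineSystem_nxt (d : Dart G b) : (lineSystem hG hE hb).nxt d = nxt hG hE hb d := rfl

@[simp] theorem lineSystem_tl (d : Dart G b) : (lineSystem hG hE hb).tl d = d.src := by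
  obtain ⟨d, rfl⟩ := (lineSystem hG hE hb).nxt.surjective d
  rw [LineSystem.tl_nxt, lineSystem_nxt, src_nxt, lineSystem_hd]

theorem isReversal_rev : (lineSystem hG hE hb).IsReversal rev where
  hd_rev d := by simp
  nxt_rev d := nxt_rev_nxt hG hE hb d

theorem ncard_le (hG : IsMatched G μ σ) (hE : E(G).Finite) (hb : IsLettering G μ b) (x : Fin n × Bool) :
    {d : Dart G b | d.src = x ∨ d.tgt = x}.ncard ≤ 2 * (delta G (b x)).ncard := by
  have hfin := finite (b := b) hE
  have hδ : (delta G (b x)).Finite := hE.subset fun e he => ((hG.mem_delta_iff hE).1 he).edge_mem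
  have h1 : {d : Dart G b | d.src = x}.ncard ≤ (delta G (b x)).ncard := by
    refine Set.ncard_le_ncard_of_injOn edge ?_ ?_ hδ
    · rintro d rfl
      exact (hG.mem_delta_iff hE).2 d.isLink.inc_left
    · intro d hd d' hd' h
      exact ext_src hb h (Eq.trans hd (Eq.symm hd'))
  have h2 : {d : Dart G b | d.tgt = x}.ncard ≤ (delta G (b x)).ncard := by
    refine Set.ncard_le_ncard_of_injOn edge ?_ ?_ hδ
    · rintro d rfl
      exact (hG.mem_delta_iff hE).2 d.isLink.inc_right
    · intro d hd d' hd' h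
      exact ext_tgt hb h (Eq.trans hd (Eq.symm hd'))
  have h3 : {d : Dart G b | d.src = x ∨ d.tgt = x} = {d | d.src = x} ∪ {d | d.tgt = x} := rfl
  have h4 := Set.ncard_union_le {d : Dart G b | d.src = x} {d | d.tgt = x}
  rw [h3]
  omega

theorem le_ncard (hE : E(G).Finite) (hb : IsLettering G μ b) (X : Set (Fin n × Bool)) :
    2 * (cutEdges G (b '' Xᶜ)).ncard ≤ {d : Dart G b | ¬ (d.src ∈ X ↔ d.tgt ∈ X)}.ncard := by
  have hfin := finite (b := b) hE
  have hsub : cutEdges G (b '' Xᶜ) ⊆ edge '' {d : Dart G b | d.src ∉ X ∧ d.tgt ∈ X} := by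
    rintro e ⟨_, y, hl, ⟨x, hx, rfl⟩, hy⟩
    obtain ⟨z, rfl⟩ := hb.closed x e y hl
    refine ⟨⟨(e, x, z), hl⟩, ⟨hx, ?_⟩, rfl⟩
    by_contra hz
    exact hy ⟨z, hz, rfl⟩
  have h1 := (Set.ncard_le_ncard hsub).trans (Set.ncard_image_le)
  have h2 : {d : Dart G b | d.src ∉ X ∧ d.tgt ∈ X}.ncard =
      {d : Dart G b | d.src ∈ X ∧ d.tgt ∉ X}.ncard := by
    refine Set.ncard_congr (fun d _ => d.rev) (fun d hd => ⟨hd.2, hd.1⟩) ?_ ?_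
    · intro d d' _ _ h
      rw [← rev_rev d, h, rev_rev]
    · intro d hd
      exact ⟨d.rev, ⟨hd.2, hd.1⟩, rfl⟩
  have h3 : {d : Dart G b | ¬ (d.src ∈ X ↔ d.tgt ∈ X)} =
      {d | d.src ∉ X ∧ d.tgt ∈ X} ∪ {d | d.src ∈ X ∧ d.tgt ∉ X} := by
    ext d
    simp only [Set.mem_ofPred_eq, Set.mem_union]
    tauto
  rw [h3, Set.ncard_union_eq]
  · omega
  · rw [Set.disjoint_left]
    exact fun d h h' => h.1 h'.1

/-- Darts double every edge on both sides of the inequality. The complement of `X` contains `x` but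
not its inverse, so the connectivity between matched vertices bounds the degree by its cut. -/
theorem cutCondition : (lineSystem hG hE hb).CutCondition := by
  intro x X hx hx'
  have h1 := ncard_le hG hE hb x
  have h2 := le_ncard hE hb X
  have h3 : (delta G (b x)).ncard ≤ (cutEdges G (b '' Xᶜ)).ncard := by
    refine hG.ncard_delta_le hE (hb.mem x) ⟨x, hx, rfl⟩ ?_
    rw [hb.map]
    rintro ⟨y, hy, h⟩
    rw [hb.inj h] at hy
    exact hy hx'
  simp only [lineSystem_tl, lineSystem_hd]
  omega

theorem eq_empty_or_univ {X : Set (Fin n × Bool)}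
    (hX : ∀ d, (lineSystem hG hE hb).tl d ∈ X ↔ (lineSystem hG hE hb).hd d ∈ X) :
    X = ∅ ∨ X = Set.univ := by
  rcases X.eq_empty_or_nonempty with h | ⟨x, hx⟩
  · exact Or.inl h
  right
  rw [Set.eq_univ_iff_forall]
  intro y
  have key : ∀ w, Relation.ReflTransGen G.Adj (b x) w → ∃ z ∈ X, b z = w := by
    intro w hw
    induction hw with
    | refl => exact ⟨x, hx, rfl⟩
    | tail _ hadj ih =>
      obtain ⟨z, hz, rfl⟩ := ih
      obtain ⟨e, he⟩ := hadj
      obtain ⟨z', rfl⟩ := hb.closed z e _ he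
      refine ⟨z', ?_, rfl⟩
      let d : Dart G b := ⟨(e, z, z'), he⟩
      have h1 := hX d
      rw [lineSystem_tl] at h1
      exact h1.1 hz
  obtain ⟨z, hz, h⟩ := key _ (hb.conn x y)
  rwa [hb.inj h] at hz

/-- A tiling for the lines of a lettered component yields cycles. -/
theorem exists_list_of_tiling (hG : IsMatched G μ σ) (hE : E(G).Finite) (hb : IsLettering G μ b)
    (h : TilingConjecture n) :
    ∃ L : List (Graph α β), (∀ C ∈ L, IsCycleOf C G) ∧
      (∀ v ∈ V(G), ∀ e ∈ delta G v, ∀ f ∈ delta G v, e ≠ f →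
        countBoth L e f = countBoth L (σ v e) (σ v f)) ∧ ∃ C ∈ L, 2 < E(C).ncard := by
  classical
  have hfin := finite (b := b) hE
  have := Fintype.ofFinite (Dart G b)
  set D := lineSystem hG hE hb
  -- All lines close up after `N` steps, so every dart starts a cyclically reduced word of length
  -- `N`.
  set N := orderOf D.nxt
  have hN : D.nxt ^ N = 1 := pow_orderOf_eq_one _
  have : NeZero N := ⟨(orderOf_pos D.nxt).ne'⟩
  have hfix : ∀ e, (D.nxt ^ N) e = e := fun e => by rw [hN]; rfl
  obtain ⟨S, ℓ, hmap, hinj, hbd, hχ⟩ := h _ (fun u hu => by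
      obtain ⟨e, -, rfl⟩ := List.mem_map.1 hu
      rw [D.toWord_read]
      exact D.isCyclicallyReduced_read (hfix e))
    (D.isMinimal_of_cutCondition (cutCondition hG hE hb) hN)
    (D.isDiskbusting_of_cutCondition (cutCondition hG hE hb) hN
      fun X hX => eq_empty_or_univ hG hE hb hX)
  obtain ⟨c, hc, hnext⟩ := (isReversal_rev hG hE hb).exists_run hN (S := S) (ℓ := ℓ) (fun i => by
    obtain ⟨u, hu, k, -, hk⟩ := hbd i
    obtain ⟨e, -, rfl⟩ := List.mem_map.1 hu
    exact ⟨e, k, hk⟩)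
  replace hc : ∀ s, (c s).tgt = ℓ s := hc
  have hout : ∀ h : S.SideEnd, outLetter S ℓ (S.opp h) = outLetter S ℓ h := by
    rintro ⟨s, e⟩
    simp only [outLetter, SidePairing.opp, hmap s]
    cases e <;> cases S.flip s <;> simp
  have hnot : ∀ h : S.SideEnd, outLetter S ℓ (h.1, !h.2) = letterInv (outLetter S ℓ h) := by
    rintro ⟨s, e⟩
    cases e <;> simp [outLetter]
  -- A corner carries the edge of the dart at which the side starting there is read; a side-end
  -- carries the letter read when leaving along it.
  let Λ : LinkLabelling S G :=
    { edge := fun s => (c s).edge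
      vtx := fun h => b (outLetter S ℓ h)
      isLink := fun s => by
        have h1 : outLetter S ℓ (s, false) = (c s).tgt := (hc s).symm
        have h2 : outLetter S ℓ (S.prev s, true) = (c s).src := by
          have := hnext (S.prev s)
          rw [S.next_prev] at this
          rw [this, lineSystem_nxt, src_nxt, hc]
          rfl
        rw [h1, h2]
        exact (c s).isLink.symm
      vtx_opp := fun h => congrArg b (hout h)
      inj := fun h h' hv hh => hinj h h' hv (hb.inj hh) }
  have hμ : ∀ h : S.SideEnd, Λ.vtx (h.1, !h.2) = μ (Λ.vtx h) := fun h => by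
    change b _ = μ (b _)
    rw [hnot, hb.map]
  have hσ : ∀ h : S.SideEnd,
      Λ.edge (S.corner (h.1, !h.2)) = σ (Λ.vtx h) (Λ.edge (S.corner h)) := by
    rintro ⟨s, _ | _⟩
    · change (c (S.next s)).edge = σ (b (ℓ s)) (c s).edge
      rw [hnext, lineSystem_nxt, edge_nxt, hc]
    · change (c s).edge = σ (b (letterInv (ℓ s))) (c (S.next s)).edge
      rw [hnext, lineSystem_nxt, edge_nxt, hc, ← hb.map]
      refine (hG.symm _ (hb.mem _) _ ((hG.mem_delta_iff hE).2 ?_)).symm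
      rw [← hc]
      exact (c s).isLink.inc_right
  have := Fintype.ofFinite S.Vertex
  refine ⟨Λ.goodLinks, ?_, ?_, Λ.exists_large_link hχ⟩
  · intro C hC
    obtain ⟨p, hp, rfl⟩ := Λ.mem_goodLinks.1 hC
    exact Λ.link_isCycleOf (hG.not_isLoopAt hE) hp
  · intro v hv e he f hf hef
    have hσe := (hG.bij v hv).mapsTo he
    have hσf := (hG.bij v hv).mapsTo hf
    have hσef : σ v e ≠ σ v f := fun heq => hef ((hG.bij v hv).injOn he hf heq)
    rw [Λ.countBoth_goodLinks hef ((hG.mem_delta_iff hE).1 he) ((hG.mem_delta_iff hE).1 hf),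
      Λ.countBoth_goodLinks hσef ((hG.mem_delta_iff hE).1 hσe) ((hG.mem_delta_iff hE).1 hσf)]
    refine le_antisymm (Λ.card_ends_le hμ hσ v e f) ?_
    have h2 := Λ.card_ends_le hμ hσ (μ v) (σ v e) (σ v f)
    rwa [(hG.inv v hv).2.2, hG.symm v hv e he, hG.symm v hv f hf] at h2

end Dart

end Darts

open scoped Graph

/-! ### Lettering a component, and cycles from tilings -/

section

variable {α β : Type*} {μ : α → α}

/-- A fixed point free involution looks like the inversion of letters. -/
theorem exists_letters [DecidableEq α] (W : Finset α)
    (hW : ∀ v ∈ W, μ v ∈ W ∧ μ v ≠ v ∧ μ (μ v) = v) :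
    ∃ (n : ℕ) (b : Fin n × Bool → α), Function.Injective b ∧ (∀ x, μ (b x) = b (letterInv x)) ∧
      ∀ v, v ∈ W ↔ ∃ x, b x = v := by
  induction W using Finset.strongInduction with
  | H W ih =>
    rcases W.eq_empty_or_nonempty with rfl | ⟨v, hv⟩
    · exact ⟨0, fun x => x.1.elim0, fun x => x.1.elim0, fun x => x.1.elim0, fun v =>
        ⟨fun h => absurd h (Finset.notMem_empty v), fun ⟨x, _⟩ => x.1.elim0⟩⟩
    have h0 := hW v hv
    have hmem : ∀ w, w ∈ (W.erase v).erase (μ v) ↔ w ≠ μ v ∧ w ≠ v ∧ w ∈ W := fun w => by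
      rw [Finset.mem_erase, Finset.mem_erase]
    obtain ⟨n, b, hb, hbμ, hbW⟩ := ih ((W.erase v).erase (μ v))
      ((Finset.erase_subset _ _).trans_ssubset (Finset.erase_ssubset hv)) (fun w hw => by
        rw [hmem] at hw
        have h1 := hW w hw.2.2
        refine ⟨(hmem _).2 ⟨fun h => hw.2.1 ?_, fun h => hw.1 ?_, h1.1⟩, h1.2⟩
        · rw [← h1.2.2, h, h0.2.2]
        · rw [← h1.2.2, h])
    have hbv : ∀ x, b x ≠ v := fun x h => ((hmem _).1 ((hbW _).2 ⟨x, h⟩)).2.1 rfl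
    have hbμv : ∀ x, b x ≠ μ v := fun x h => ((hmem _).1 ((hbW _).2 ⟨x, h⟩)).1 rfl
    let c : Fin (n + 1) × Bool → α := fun x =>
      Fin.cases (motive := fun _ => α) (if x.2 then v else μ v) (fun j => b (j, x.2)) x.1
    have hc0 : c (0, true) = v := rfl
    have hc1 : c (0, false) = μ v := rfl
    have hcs : ∀ j t, c (Fin.succ j, t) = b (j, t) := fun j t => rfl
    refine ⟨n + 1, c, ?_, ?_, ?_⟩
    · rintro ⟨i, t⟩ ⟨j, s⟩ h
      induction i using Fin.cases with
      | zero =>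
        induction j using Fin.cases with
        | zero =>
          cases t <;> cases s
          · rfl
          · exact absurd h h0.2.1
          · exact absurd h.symm h0.2.1
          · rfl
        | succ j =>
          cases t
          · exact absurd h.symm (hbμv _)
          · exact absurd h.symm (hbv _)
      | succ i =>
        induction j using Fin.cases with
        | zero =>
          cases s
          · exact absurd h (hbμv _)
          · exact absurd h (hbv _)
        | succ j =>
          have := hb (a₁ := (i, t)) (a₂ := (j, s)) h
          simp only [Prod.mk.injEq] at this
          rw [this.1, this.2]
    · rintro ⟨i, t⟩
      induction i using Fin.cases with
      | zero =>
        cases t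
        · exact h0.2.2
        · rfl
      | succ i => exact hbμ (i, t)
    · intro w
      constructor
      · intro hw
        by_cases h1 : w = v
        · exact ⟨(0, true), h1.symm⟩
        by_cases h2 : w = μ v
        · exact ⟨(0, false), h2.symm⟩
        obtain ⟨⟨j, t⟩, h⟩ := (hbW w).1 ((hmem w).2 ⟨h2, h1, hw⟩)
        exact ⟨(j.succ, t), h⟩
      · rintro ⟨⟨i, t⟩, rfl⟩
        induction i using Fin.cases with
        | zero =>
          cases t
          · exact h0.1
          · exact hv
        | succ i => exact ((hmem _).1 ((hbW _).2 ⟨(i, t), rfl⟩)).2.2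

/-- Every vertex of a component with more than one vertex has an edge, so the component is closed
under `μ` and splits into pairs `{w, μ w}`, which play the role of inverse letters. -/
theorem IsMatched.exists_lettering {G : Graph α β} {σ : α → β → β} (h : IsMatched G μ σ)
    (hV : V(G).Finite) (hE : E(G).Finite) {v : α}
    (h4 : 4 ≤ (component G v).ncard) :
    ∃ (n : ℕ) (b : Fin n × Bool → α), IsLettering G μ b ∧ 2 ≤ n ∧ 2 * n ≤ V(G).ncard := by
  classical
  have hfin : (component G v).Finite := hV.subset fun w hw => hw.1
  obtain ⟨n, b, hb, hbμ, hbW⟩ := exists_letters (μ := μ) hfin.toFinset (fun w hw => by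
    rw [hfin.mem_toFinset] at hw ⊢
    have : ∃ w' ∈ component G v, w' ≠ w := by
      by_contra! hcon
      have h1 : component G v ⊆ {w} := fun w' hw' => hcon w' hw'
      have := Set.ncard_le_ncard h1
      rw [Set.ncard_singleton] at this
      omega
    obtain ⟨w', hw', hne⟩ := this
    obtain ⟨e, he⟩ := IsMatched.exists_inc_of_component hw hw' hne.symm
    exact ⟨h.map_mem_component hE hw he, (h.inv w hw.1).2⟩)
  have hbW' : ∀ w, w ∈ component G v ↔ ∃ x, b x = w := fun w => by
    rw [← hbW, hfin.mem_toFinset]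
  have hmem : ∀ x, b x ∈ component G v := fun x => (hbW' _).2 ⟨x, rfl⟩
  have hcard : (component G v).ncard = 2 * n := by
    have : component G v = Set.range b := Set.ext hbW'
    rw [this, ← Set.image_univ, hb.injOn.ncard_image, Set.ncard_univ, Nat.card_eq_fintype_card,
      Fintype.card_prod, Fintype.card_fin, Fintype.card_bool, mul_comm]
  refine ⟨n, b, ⟨hb, hbμ, fun x => (hmem x).1, ?_, ?_⟩, by omega, ?_⟩
  · intro x e y hl
    exact (hbW' y).1 (component_closed (hmem x) hl)
  · intro x y
    exact (reflTransGen_adj_symm (hmem x).2).trans (hmem y).2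
  · rw [← hcard]
    exact Set.ncard_le_ncard (fun w hw => hw.1) hV

end

theorem graphConjecture_of_tilingConjecture {n' : ℕ}
    (h : ∀ n : ℕ, 2 ≤ n → n ≤ n' → TilingConjecture n) : GraphConjecture (2 * n') := by
  intro α β G hV hE hN hC μ σ hμ hσ hconn hσσ
  have hG : IsMatched G μ σ := ⟨hμ, hσ, hconn, hσσ⟩
  by_cases hlarge : ∃ v ∈ V(G), 4 ≤ (component G v).ncard
  · obtain ⟨v, -, h4⟩ := hlarge
    obtain ⟨n, b, hb, h2, hn⟩ := hG.exists_lettering hV hE h4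
    obtain ⟨L, hL, hcount, C, hCL, hC2⟩ :=
      Dart.exists_list_of_tiling hG hE hb (h n h2 (by omega))
    exact ⟨L, List.ne_nil_of_mem hCL, hL, hcount, fun _ => ⟨C, hCL, hC2⟩⟩
  · obtain ⟨L, hne, hL, hcount⟩ := hG.exists_list_of_small hV hE hC hlarge
    exact ⟨L, hne, hL, hcount, fun hl => absurd hl hlarge⟩

open scoped Graph

/-! ### Edge-disjoint paths -/

section Menger

variable {V E : Type*}

/-- The graph whose edge `e` has the ends `tl e` and `hd e`. -/
def ofEnds (tl hd : E → V) : Graph V E where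
  vertexSet := Set.univ
  edgeSet := Set.univ
  IsLink e x y := (tl e = x ∧ hd e = y) ∨ (hd e = x ∧ tl e = y)
  isLink_symm _ _ := ⟨fun _ _ h => h.elim (fun h => Or.inr ⟨h.2, h.1⟩) fun h => Or.inl ⟨h.2, h.1⟩⟩
  eq_or_eq_of_isLink_of_isLink := by
    rintro e x y v w (⟨rfl, rfl⟩ | ⟨rfl, rfl⟩) (⟨h1, h2⟩ | ⟨h1, h2⟩)
    · exact Or.inl h1
    · exact Or.inr h2
    · exact Or.inr h2
    · exact Or.inl h1
  edge_mem_iff_exists_isLink e := ⟨fun _ => ⟨tl e, hd e, Or.inl ⟨rfl, rfl⟩⟩, fun _ => trivial⟩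
  left_mem_of_isLink _ _ _ _ := trivial

variable {tl hd : E → V}

theorem ofEnds_inc {e : E} {x : V} : (ofEnds tl hd).Inc e x ↔ tl e = x ∨ hd e = x := by
  constructor
  · rintro ⟨y, ⟨h, -⟩ | ⟨h, -⟩⟩
    · exact Or.inl h
    · exact Or.inr h
  · rintro (rfl | rfl)
    · exact ⟨hd e, Or.inl ⟨rfl, rfl⟩⟩
    · exact ⟨tl e, Or.inr ⟨rfl, rfl⟩⟩

theorem mem_cutEdges_ofEnds {e : E} {X : Set V} :
    e ∈ cutEdges (ofEnds tl hd) X ↔ ¬ (tl e ∈ X ↔ hd e ∈ X) := by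
  constructor
  · rintro ⟨a, b, ⟨rfl, rfl⟩ | ⟨rfl, rfl⟩, ha, hb⟩ h
    · exact hb (h.1 ha)
    · exact hb (h.2 ha)
  · intro h
    by_cases h1 : tl e ∈ X
    · exact ⟨_, _, Or.inl ⟨rfl, rfl⟩, h1, fun h2 => h ⟨fun _ => h2, fun _ => h1⟩⟩
    · by_cases h2 : hd e ∈ X
      · exact ⟨_, _, Or.inr ⟨rfl, rfl⟩, h2, h1⟩
      · exact absurd ⟨fun h => absurd h h1, fun h => absurd h h2⟩ h

/-- `w` can be reached from `u` along an edge in an allowed direction; `true` stands for the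
direction from `tl` to `hd`. -/
def Reach (tl hd : E → V) (D : E → Bool → Prop) (u w : V) : Prop :=
  ∃ e, (D e true ∧ tl e = u ∧ hd e = w) ∨ (D e false ∧ hd e = u ∧ tl e = w)

variable [DecidableEq V] [Fintype E]

/-- The excess of the flow `f` at `v`. -/
def excess (tl hd : E → V) (f : E → ℤ) (v : V) : ℤ :=
  ∑ e, f e * ((if hd e = v then 1 else 0) - if tl e = v then 1 else 0)

theorem excess_add (f g : E → ℤ) (v : V) :
    excess tl hd (fun e => f e + g e) v = excess tl hd f v + excess tl hd g v := by
  simp only [excess, add_mul, Finset.sum_add_distrib]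

theorem excess_sub (f g : E → ℤ) (v : V) :
    excess tl hd (fun e => f e - g e) v = excess tl hd f v - excess tl hd g v := by
  simp only [excess, sub_mul, Finset.sum_sub_distrib]

theorem excess_single [DecidableEq E] (e : E) (c : ℤ) (v : V) :
    excess tl hd (fun e' => if e' = e then c else 0) v =
      c * ((if hd e = v then 1 else 0) - if tl e = v then 1 else 0) := by
  simp [excess, ite_mul]

theorem sum_excess (f : E → ℤ) (X : Finset V) :
    ∑ v ∈ X, excess tl hd f v =
      ∑ e, f e * ((if hd e ∈ X then 1 else 0) - if tl e ∈ X then 1 else 0) := by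
  simp only [excess]
  rw [Finset.sum_comm]
  refine Finset.sum_congr rfl fun e _ => ?_
  rw [← Finset.mul_sum, Finset.sum_sub_distrib, Finset.sum_ite_eq, Finset.sum_ite_eq]

/-- Cut the walk at its last visit to `u`; the rest avoids `u`. -/
theorem exists_first_step {r : V → V → Prop} {A : Finset V} {u w : V}
    (h : Relation.ReflTransGen (fun a b => b ∈ A ∧ r a b) u w) (hne : u ≠ w) :
    ∃ z ∈ A.erase u, r u z ∧ Relation.ReflTransGen (fun a b => b ∈ A.erase u ∧ r a b) z w := by
  have key : w = u ∨ ∃ z ∈ A.erase u, r u z ∧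
      Relation.ReflTransGen (fun a b => b ∈ A.erase u ∧ r a b) z w := by
    clear hne
    induction h with
    | refl => exact Or.inl rfl
    | @tail b c _ hbc ih =>
      by_cases hc : c = u
      · exact Or.inl hc
      have hcA : c ∈ A.erase u := Finset.mem_erase.2 ⟨hc, hbc.1⟩
      rcases ih with rfl | ⟨z, hz, huz, hzb⟩
      · exact Or.inr ⟨c, hcA, hbc.2, .refl⟩
      · exact Or.inr ⟨z, hz, huz, hzb.tail ⟨hcA, hbc.2⟩⟩
  exact key.resolve_left (Ne.symm hne)

/-- Along allowed directions a vertex is reached by a path, which carries a unit flow. -/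
theorem exists_path_flow {D : E → Bool → Prop} (A : Finset V) {u w : V} (hu : u ∈ A)
    (h : Relation.ReflTransGen (fun a b => b ∈ A ∧ Reach tl hd D a b) u w) :
    ∃ (g : E → ℤ) (P : List (E × V)), IsPath (ofEnds tl hd) u P w ∧
      (∀ v ∈ P.map Prod.snd, v ∈ A) ∧ (∀ e, g e ≠ 0 → tl e ∈ A ∧ hd e ∈ A) ∧
      (∀ e, e ∈ P.map Prod.fst ↔ g e ≠ 0) ∧
      (∀ e, g e = 0 ∨ (g e = 1 ∧ D e true) ∨ (g e = -1 ∧ D e false)) ∧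
      ∀ v, excess tl hd g v = (if v = w then 1 else 0) - if v = u then 1 else 0 := by
  classical
  induction A using Finset.strongInduction generalizing u with
  | H A ih =>
    by_cases hne : u = w
    · subst hne
      refine ⟨fun _ => 0, [], ⟨.nil trivial, by simp⟩, by simp, by simp, by simp, by simp, ?_⟩
      intro v
      simp [excess]
    obtain ⟨z, hz, ⟨e, he⟩, hzw⟩ := exists_first_step h hne
    obtain ⟨g, P, hP, hPA, hgA, hgP, hgD, hex⟩ := ih _ (Finset.erase_ssubset hu) hz hzw
    have hzu : z ≠ u := (Finset.mem_erase.1 hz).1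
    have hlink : (ofEnds tl hd).IsLink e u z := by
      rcases he with ⟨-, h1, h2⟩ | ⟨-, h1, h2⟩
      · exact Or.inl ⟨h1, h2⟩
      · exact Or.inr ⟨h1, h2⟩
    have hge : g e = 0 := by
      by_contra hge
      obtain ⟨h1, h2⟩ := hgA e hge
      rcases hlink with ⟨h3, -⟩ | ⟨h3, -⟩
      · rw [h3] at h1; exact (Finset.mem_erase.1 h1).1 rfl
      · rw [h3] at h2; exact (Finset.mem_erase.1 h2).1 rfl
    obtain ⟨c, hc, hcD, hcx⟩ : ∃ c : ℤ, c ≠ 0 ∧ ((c = 1 ∧ D e true) ∨ (c = -1 ∧ D e false)) ∧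
        ∀ v, c * ((if hd e = v then 1 else 0) - if tl e = v then 1 else 0) =
          (if v = z then 1 else 0) - if v = u then 1 else 0 := by
      rcases he with ⟨h0, rfl, rfl⟩ | ⟨h0, rfl, rfl⟩
      · refine ⟨1, by norm_num, Or.inl ⟨rfl, h0⟩, fun v => ?_⟩
        simp only [one_mul, eq_comm]
      · refine ⟨-1, by norm_num, Or.inr ⟨rfl, h0⟩, fun v => ?_⟩
        simp only [neg_mul, one_mul, neg_sub, eq_comm]
    refine ⟨fun e' => g e' + if e' = e then c else 0, (e, z) :: P, ⟨.cons hlink hP.1, ?_⟩,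
      ?_, ?_, ?_, ?_, ?_⟩
    · rw [List.map_cons, List.nodup_cons]
      refine ⟨?_, hP.2⟩
      rw [List.mem_cons, not_or]
      exact ⟨hzu.symm, fun hmem => (Finset.mem_erase.1 (hPA _ hmem)).1 rfl⟩
    · intro v hv
      rw [List.map_cons, List.mem_cons] at hv
      rcases hv with rfl | hv
      · exact Finset.mem_of_mem_erase hz
      · exact Finset.mem_of_mem_erase (hPA v hv)
    · intro e' he'
      by_cases hee : e' = e
      · subst hee
        rcases hlink with ⟨rfl, rfl⟩ | ⟨rfl, rfl⟩
        · exact ⟨hu, Finset.mem_of_mem_erase hz⟩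
        · exact ⟨Finset.mem_of_mem_erase hz, hu⟩
      · simp only [if_neg hee, add_zero] at he'
        exact ⟨Finset.mem_of_mem_erase (hgA e' he').1, Finset.mem_of_mem_erase (hgA e' he').2⟩
    · intro e'
      rw [List.map_cons, List.mem_cons, hgP]
      by_cases hee : e' = e
      · subst hee
        simp [hge, hc]
      · simp [hee]
    · intro e'
      by_cases hee : e' = e
      · subst hee
        simp only [hge, if_true, zero_add]
        exact Or.inr hcD
      · simp only [if_neg hee, add_zero]
        exact hgD e'
    · intro v
      rw [excess_add, hex, excess_single, hcx]
      ring

/-- Either there is a path in allowed directions, or a set which no allowed direction leaves. -/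
theorem exists_path_flow_or_cut [Fintype V] (D : E → Bool → Prop) (x y : V) :
    (∃ (g : E → ℤ) (P : List (E × V)), IsPath (ofEnds tl hd) x P y ∧
      (∀ e, e ∈ P.map Prod.fst ↔ g e ≠ 0) ∧
      (∀ e, g e = 0 ∨ (g e = 1 ∧ D e true) ∨ (g e = -1 ∧ D e false)) ∧
      ∀ v, excess tl hd g v = (if v = y then 1 else 0) - if v = x then 1 else 0) ∨
    ∃ X : Finset V, x ∈ X ∧ y ∉ X ∧ (∀ e, tl e ∈ X → hd e ∉ X → ¬ D e true) ∧
      ∀ e, hd e ∈ X → tl e ∉ X → ¬ D e false := by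
  classical
  by_cases h : Relation.ReflTransGen (Reach tl hd D) x y
  · left
    have h' : Relation.ReflTransGen (fun a b => b ∈ (Finset.univ : Finset V) ∧ Reach tl hd D a b)
        x y := by
      refine Relation.ReflTransGen.mono ?_ _ _ h
      exact fun a b hab => ⟨Finset.mem_univ b, hab⟩
    obtain ⟨g, P, hP, -, -, hgP, hgD, hex⟩ := exists_path_flow Finset.univ (Finset.mem_univ x) h'
    exact ⟨g, P, hP, hgP, hgD, hex⟩
  · right
    refine ⟨Finset.univ.filter fun v => Relation.ReflTransGen (Reach tl hd D) x v, ?_, ?_, ?_, ?_⟩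
    · simpa using Relation.ReflTransGen.refl
    · simpa using h
    · intro e h1 h2 hD
      simp only [Finset.mem_filter, Finset.mem_univ, true_and] at h1 h2
      exact h2 (h1.tail ⟨e, Or.inl ⟨hD, rfl, rfl⟩⟩)
    · intro e h1 h2 hD
      simp only [Finset.mem_filter, Finset.mem_univ, true_and] at h1 h2
      exact h2 (h1.tail ⟨e, Or.inr ⟨hD, rfl, rfl⟩⟩)

/-- Summing the excess over `X` cancels the edges inside `X` and leaves the net flow out of `X`,
which must be the value of the flow. -/
theorem sum_excess_of_flow {f : E → ℤ} {x y : V} {k : ℤ}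
    (hex : ∀ v, excess tl hd f v = k * ((if v = y then 1 else 0) - if v = x then 1 else 0))
    {X : Finset V} (hx : x ∈ X) (hy : y ∉ X) :
    ∑ e, f e * ((if tl e ∈ X then 1 else 0) - if hd e ∈ X then 1 else 0) = k := by
  have h1 := sum_excess (tl := tl) (hd := hd) f X
  have h2 : ∑ v ∈ X, excess tl hd f v = -k := by
    simp only [hex]
    rw [← Finset.mul_sum, Finset.sum_sub_distrib, Finset.sum_ite_eq', Finset.sum_ite_eq',
      if_pos hx, if_neg hy]
    ring
  rw [h2] at h1
  rw [← neg_inj, h1, ← Finset.sum_neg_distrib]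
  refine Finset.sum_congr rfl fun e _ => ?_
  ring

/-- If all cuts are large then there is a large flow. -/
theorem exists_flow [Fintype V] {x y : V} {k : ℕ}
    (hcut : ∀ X : Set V, x ∈ X → y ∉ X → k ≤ {e | ¬ (tl e ∈ X ↔ hd e ∈ X)}.ncard) (j : ℕ)
    (hj : j ≤ k) :
    ∃ f : E → ℤ, (∀ e, -1 ≤ f e ∧ f e ≤ 1) ∧
      ∀ v, excess tl hd f v = j * ((if v = y then 1 else 0) - if v = x then 1 else 0) := by
  classical
  induction j with
  | zero => exact ⟨fun _ => 0, fun e => by norm_num, fun v => by simp [excess]⟩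
  | succ j ih =>
    obtain ⟨f, hf, hex⟩ := ih (by omega)
    -- An edge may be used in a direction in which it is not yet saturated.
    rcases exists_path_flow_or_cut (tl := tl) (hd := hd)
      (fun e b => if b then f e < 1 else -1 < f e) x y with
      ⟨g, -, -, -, hgD, hgex⟩ | ⟨X, hx, hy, h1, h2⟩
    · refine ⟨fun e => f e + g e, fun e => ?_, fun v => ?_⟩
      · have := hf e
        change -1 ≤ f e + g e ∧ f e + g e ≤ 1
        rcases hgD e with h | ⟨h, h'⟩ | ⟨h, h'⟩
        · omega
        · simp only [if_true] at h'; omega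
        · simp only [Bool.false_eq_true, if_false] at h'; omega
      · rw [excess_add, hex, hgex]
        push_cast
        ring
    -- Without an augmenting path all edges of the cut are saturated outwards, so the value `j` is
    -- the size of the cut, which is at least `k > j`.
    · exfalso
      have h3 := sum_excess_of_flow hex hx hy
      have h4 := hcut (X : Set V) hx hy
      have h5 : ∑ e, f e * ((if tl e ∈ X then 1 else 0) - if hd e ∈ X then 1 else 0) =
          ∑ e, if ¬ (tl e ∈ (X : Set V) ↔ hd e ∈ (X : Set V)) then (1 : ℤ) else 0 := by
        refine Finset.sum_congr rfl fun e _ => ?_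
        have := hf e
        have h6 := h1 e
        have h7 := h2 e
        simp only [if_true, Bool.false_eq_true, if_false, not_lt] at h6 h7
        by_cases ht : tl e ∈ X <;> by_cases hh : hd e ∈ X <;>
          simp only [ht, hh, Finset.mem_coe, if_true, if_false, not_true, not_false_iff, iff_true,
            iff_self, iff_false] <;>
          simp only [ht, hh, not_true, not_false_iff, true_implies, false_implies] at h6 h7 <;>
          omega
      rw [h5, Finset.sum_boole] at h3
      rw [Set.ncard_eq_toFinset_card', Set.toFinset_ofPred] at h4
      have h6 : (Finset.univ.filter fun e => ¬ (tl e ∈ (X : Set V) ↔ hd e ∈ (X : Set V))).card = j :=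
        by exact_mod_cast h3
      omega

/-- A flow of value `k` contains `k` edge-disjoint paths. -/
theorem exists_paths_of_flow [Fintype V] {x y : V} (k : ℕ) (f : E → ℤ)
    (hf : ∀ e, -1 ≤ f e ∧ f e ≤ 1)
    (hex : ∀ v, excess tl hd f v = k * ((if v = y then 1 else 0) - if v = x then 1 else 0)) :
    ∃ P : Fin k → List (E × V), (∀ i, IsPath (ofEnds tl hd) x (P i) y) ∧
      (Pairwise fun i j => List.Disjoint ((P i).map Prod.fst) ((P j).map Prod.fst)) ∧
      ∀ i, ∀ e ∈ (P i).map Prod.fst, f e ≠ 0 := by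
  classical
  induction k generalizing f with
  | zero => exact ⟨fun i => i.elim0, fun i => i.elim0, fun i => i.elim0, fun i => i.elim0⟩
  | succ k ih =>
    -- Now edges may be used only in the direction of the flow they carry, so that the path can be
    -- subtracted from the flow.
    rcases exists_path_flow_or_cut (tl := tl) (hd := hd)
      (fun e b => if b then f e = 1 else f e = -1) x y with
      ⟨g, Q, hQ, hgQ, hgD, hgex⟩ | ⟨X, hx, hy, h1, h2⟩
    · have hg : ∀ e, g e = 0 ∨ g e = f e := fun e => by
        rcases hgD e with h | ⟨h, h'⟩ | ⟨h, h'⟩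
        · exact Or.inl h
        · simp only [if_true] at h'; exact Or.inr (h.trans h'.symm)
        · simp only [Bool.false_eq_true, if_false] at h'; exact Or.inr (h.trans h'.symm)
      obtain ⟨P, hP, hdisj, hPf⟩ := ih (fun e => f e - g e) (fun e => by
          have := hf e
          rcases hg e with h | h <;> rw [h] <;> omega) (fun v => by
          rw [excess_sub, hex, hgex]
          push_cast
          ring)
      have hQP : ∀ i, List.Disjoint (Q.map Prod.fst) ((P i).map Prod.fst) := by
        intro i e he he'
        have h3 := (hgQ e).1 he
        rcases hg e with h | h
        · exact h3 h
        · exact hPf i e he' (by rw [h, sub_self])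
      refine ⟨Fin.cons Q P, ?_, ?_, ?_⟩
      · intro i
        induction i using Fin.cases with
        | zero => exact hQ
        | succ i => exact hP i
      · intro i j hij
        induction i using Fin.cases with
        | zero =>
          induction j using Fin.cases with
          | zero => exact absurd rfl hij
          | succ j => exact hQP j
        | succ i =>
          induction j using Fin.cases with
          | zero => exact (hQP i).symm
          | succ j => exact hdisj fun h => hij (congrArg _ h)
      · intro i e he
        induction i using Fin.cases with
        | zero =>
          rcases hg e with h | h
          · exact absurd h ((hgQ e).1 he)
          · rw [← h]; exact (hgQ e).1 he
        | succ i =>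
          have h3 := hPf i e he
          rcases hg e with h | h
          · rwa [h, sub_zero] at h3
          · rw [h, sub_self] at h3; exact absurd rfl h3
    -- No flow leaves `X`, so the value would be at most 0.
    · exfalso
      have h3 := sum_excess_of_flow hex hx hy
      have h5 : ∑ e, f e * ((if tl e ∈ X then 1 else 0) - if hd e ∈ X then 1 else 0) ≤ 0 := by
        refine Finset.sum_nonpos fun e _ => ?_
        have := hf e
        have h6 := h1 e
        have h7 := h2 e
        simp only [if_true, Bool.false_eq_true, if_false] at h6 h7
        by_cases ht : tl e ∈ X <;> by_cases hh : hd e ∈ X <;>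
          simp only [ht, hh, if_true, if_false] <;>
          simp only [ht, hh, not_true, not_false_iff, true_implies, false_implies] at h6 h7 <;>
          omega
      push_cast at h3
      omega

/-- **Menger's theorem** for edge-disjoint paths, at a vertex that is a minimum cut. -/
theorem localEdgeConn_eq_of_cut [Fintype V] {x y : V} (hxy : x ≠ y) {k : ℕ}
    (hk : {e | ¬ (tl e = x ↔ hd e = x)}.ncard = k)
    (hcut : ∀ X : Set V, x ∈ X → y ∉ X → k ≤ {e | ¬ (tl e ∈ X ↔ hd e ∈ X)}.ncard) :
    localEdgeConn (ofEnds tl hd) x y = k := by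
  have hle : localEdgeConn (ofEnds tl hd) x y ≤ k := by
    have h1 := localEdgeConn_le_ncard_cutEdges (G := ofEnds tl hd) (Set.toFinite (Set.univ : Set E))
      (x := x) (y := y) (X := {x}) rfl hxy.symm
    have h2 : cutEdges (ofEnds tl hd) {x} = {e | ¬ (tl e = x ↔ hd e = x)} := by
      ext e
      exact mem_cutEdges_ofEnds
    rwa [h2, hk] at h1
  refine le_antisymm hle ?_
  obtain ⟨f, hf, hex⟩ := exists_flow hcut k le_rfl
  obtain ⟨P, hP, hdisj, -⟩ := exists_paths_of_flow k f hf hex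
  -- The numbers of disjoint paths are bounded, because `x ≠ y` makes every path use an edge.
  refine le_csSup ⟨Fintype.card E, ?_⟩ ⟨P, hP, hdisj⟩
  rintro j ⟨Q, hQ, hQd⟩
  have hne : ∀ i, ∃ e, e ∈ (Q i).map Prod.fst := fun i => by
    obtain ⟨e, he, -⟩ := (hQ i).1.exists_mem_cutEdges (X := {x}) rfl hxy.symm
    exact ⟨e, he⟩
  choose c hc using hne
  have hinj : Function.Injective c := by
    intro i j hij
    by_contra hne
    exact hQd hne (hc i) (hij ▸ hc j)
  simpa using Fintype.card_le_of_injective c hinj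

end Menger

/-! ### Whitehead automorphisms -/

section CyclicLength

variable {n : ℕ}

theorem norm_pow_le (g : FreeGroup (Fin n)) (N : ℕ) : (g ^ N).norm ≤ N * g.norm := by
  induction N with
  | zero => simp
  | succ N ih =>
    rw [pow_succ, Nat.succ_mul]
    exact (FreeGroup.norm_mul_le _ _).trans (Nat.add_le_add_right ih _)

theorem norm_pow_of_isCyclicallyReduced {L : List (Fin n × Bool)}
    (hL : FreeGroup.IsCyclicallyReduced L) (N : ℕ) :
    (FreeGroup.mk L ^ N).norm = N * L.length := by
  have h1 : FreeGroup.mk L ^ N = FreeGroup.mk (List.replicate N L).flatten := by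
    induction N with
    | zero => simp [FreeGroup.one_eq_mk]
    | succ N ih => rw [pow_succ', ih, FreeGroup.mul_mk, List.replicate_succ, List.flatten_cons]
  rw [h1, FreeGroup.norm, FreeGroup.toWord_mk, (hL.flatten_replicate N).isReduced.reduce_eq]
  simp

/-- The cyclic reduction is shortest in the conjugacy class. -/
theorem cyclicLength_le_norm_conj (g h : FreeGroup (Fin n)) :
    cyclicLength g ≤ (h * g * h⁻¹).norm := by
  set L := FreeGroup.reduceCyclically g.toWord with hL
  set w := FreeGroup.mk (FreeGroup.reduceCyclically.conjugator g.toWord) with hw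
  have hg : g = w * FreeGroup.mk L * w⁻¹ := by
    rw [hw, hL, FreeGroup.mul_mk, FreeGroup.inv_mk, FreeGroup.mul_mk,
      FreeGroup.reduceCyclically.conj_conjugator_reduceCyclically, FreeGroup.mk_toWord]
  have hc : FreeGroup.IsCyclicallyReduced L :=
    FreeGroup.reduceCyclically.isCyclicallyReduced FreeGroup.isReduced_toWord
  -- Conjugation changes the norm of an `N`-th power by at most `2 * (h * w).norm`, whereas a
  -- conjugate shorter than `L` would save at least `N`.
  set N := 2 * (h * w).norm + 1 with hN
  have h1 : FreeGroup.mk L ^ N = (h * w)⁻¹ * (h * g * h⁻¹) ^ N * (h * w) := by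
    rw [conj_pow, hg, conj_pow]
    group
  have h2 : N * L.length ≤ (h * w).norm + N * (h * g * h⁻¹).norm + (h * w).norm := by
    rw [← norm_pow_of_isCyclicallyReduced hc, h1]
    refine (FreeGroup.norm_mul_le _ _).trans (Nat.add_le_add_right ?_ _)
    refine (FreeGroup.norm_mul_le _ _).trans ?_
    rw [FreeGroup.norm_inv_eq]
    exact Nat.add_le_add_left (norm_pow_le _ _) _
  by_contra hlt
  rw [not_le] at hlt
  change _ < L.length at hlt
  have h3 := Nat.mul_le_mul_left N (Nat.succ_le_of_lt hlt)
  rw [Nat.mul_succ] at h3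
  omega

end CyclicLength

section Whitehead

variable {n : ℕ}

open Classical in
/-- The factor put in front of a letter by a Whitehead automorphism with multiplier `c`. -/
noncomputable def whiteheadFactor (X : Set (Fin n × Bool)) (c : FreeGroup (Fin n))
    (x : Fin n × Bool) : FreeGroup (Fin n) := if x ∈ X then c else 1

/-- The endomorphism multiplying the letters in `X` by `c` in front, except for `i₀`. -/
noncomputable def whiteheadHom (X : Set (Fin n × Bool)) (i₀ : Fin n) (c : FreeGroup (Fin n)) :
    FreeGroup (Fin n) →* FreeGroup (Fin n) :=
  FreeGroup.lift fun i => if i = i₀ then FreeGroup.of i else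
    whiteheadFactor X c (i, true) * FreeGroup.of i * (whiteheadFactor X c (i, false))⁻¹

theorem letterElt_true (i : Fin n) : letterElt (i, true) = FreeGroup.of i := rfl

theorem letterElt_false (i : Fin n) : letterElt (i, false) = (FreeGroup.of i)⁻¹ := rfl

theorem whiteheadHom_self (X : Set (Fin n × Bool)) (a : Fin n × Bool) (c : FreeGroup (Fin n)) :
    whiteheadHom X a.1 c (letterElt a) = letterElt a := by
  obtain ⟨i, _ | _⟩ := a
  · rw [letterElt_false, map_inv, whiteheadHom, FreeGroup.lift_apply_of, if_pos rfl]
  · rw [letterElt_true, whiteheadHom, FreeGroup.lift_apply_of, if_pos rfl]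

/-- The second homomorphism fixes the multiplier `c` of the first, so the factors `c` and `d` meet
and cancel at both ends of a letter. -/
theorem whiteheadHom_comp (X : Set (Fin n × Bool)) (a : Fin n × Bool) {c d : FreeGroup (Fin n)}
    (hcd : d * c = 1) (hc : whiteheadHom X a.1 d c = c) :
    (whiteheadHom X a.1 d).comp (whiteheadHom X a.1 c) = MonoidHom.id _ := by
  refine FreeGroup.ext_hom _ _ fun i => ?_
  have hF : ∀ x, whiteheadHom X a.1 d (whiteheadFactor X c x) = whiteheadFactor X c x := by
    intro x
    simp only [whiteheadFactor]
    split_ifs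
    · exact hc
    · exact map_one _
  have hFF : ∀ x, whiteheadFactor X c x * whiteheadFactor X d x = 1 := by
    intro x
    simp only [whiteheadFactor]
    split_ifs
    · exact mul_eq_one_comm.1 hcd
    · exact one_mul 1
  have h1 : ∀ e : FreeGroup (Fin n), whiteheadHom X a.1 e (FreeGroup.of i) =
      if i = a.1 then FreeGroup.of i else
        whiteheadFactor X e (i, true) * FreeGroup.of i * (whiteheadFactor X e (i, false))⁻¹ :=
    fun e => by rw [whiteheadHom, FreeGroup.lift_apply_of]
  rw [MonoidHom.comp_apply, MonoidHom.id_apply, h1]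
  split_ifs with hi
  · rw [h1, if_pos hi]
  · rw [map_mul, map_mul, map_inv, hF, hF, h1, if_neg hi]
    have h2 := hFF (i, true)
    have h3 := hFF (i, false)
    have h4 : (whiteheadFactor X d (i, false))⁻¹ * (whiteheadFactor X c (i, false))⁻¹ = 1 := by
      rw [← mul_inv_rev, h3, inv_one]
    calc _ = (whiteheadFactor X c (i, true) * whiteheadFactor X d (i, true)) * FreeGroup.of i *
          ((whiteheadFactor X d (i, false))⁻¹ * (whiteheadFactor X c (i, false))⁻¹) := by group
      _ = _ := by rw [h2, h4, one_mul, mul_one]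

/-- The Whitehead automorphism with multiplier `a`. -/
noncomputable def whiteheadAut (X : Set (Fin n × Bool)) (a : Fin n × Bool) :
    FreeGroup (Fin n) ≃* FreeGroup (Fin n) :=
  MonoidHom.toMulEquiv (whiteheadHom X a.1 (letterElt a)) (whiteheadHom X a.1 (letterElt a)⁻¹)
    (whiteheadHom_comp X a (inv_mul_cancel _) (whiteheadHom_self X a _))
    (whiteheadHom_comp X a (mul_inv_cancel _) (by
      rw [map_inv, whiteheadHom_self]))

/-- What remains of a letter besides the factors at its ends. -/
noncomputable def whiteheadMiddle (a x : Fin n × Bool) : FreeGroup (Fin n) :=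
  if x.1 = a.1 then 1 else letterElt x

/-- The image of `a` is `a`, which is already its front factor, so its middle part is trivial. The
conditions on `X` give `a` a factor in front and none behind, and one formula covers all letters. -/
theorem whiteheadAut_letterElt {X : Set (Fin n × Bool)} {a : Fin n × Bool} (ha : a ∈ X)
    (ha' : letterInv a ∉ X) (x : Fin n × Bool) :
    whiteheadAut X a (letterElt x) = whiteheadFactor X (letterElt a) x * whiteheadMiddle a x *
      (whiteheadFactor X (letterElt a) (letterInv x))⁻¹ := by
  change whiteheadHom X a.1 (letterElt a) (letterElt x) = _
  by_cases hx : x.1 = a.1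
  · have : x = a ∨ x = letterInv a := by
      obtain ⟨i, b⟩ := x
      obtain ⟨j, c⟩ := a
      simp only at hx
      subst hx
      cases b <;> cases c <;> simp [letterInv]
    rw [whiteheadMiddle, if_pos hx]
    rcases this with rfl | rfl
    · rw [whiteheadHom_self]
      simp [whiteheadFactor, ha, ha']
    · rw [letterElt_letterInv, map_inv, whiteheadHom_self, letterInv_letterInv]
      simp [whiteheadFactor, ha, ha']
  · rw [whiteheadMiddle, if_neg hx]
    obtain ⟨i, b⟩ := x
    have h1 : whiteheadHom X a.1 (letterElt a) (FreeGroup.of i) =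
        whiteheadFactor X (letterElt a) (i, true) * FreeGroup.of i *
          (whiteheadFactor X (letterElt a) (i, false))⁻¹ := by
      rw [whiteheadHom, FreeGroup.lift_apply_of, if_neg hx]
    cases b
    · rw [letterElt_false, map_inv, h1]
      simp only [letterInv, mul_inv_rev, inv_inv, Bool.not_false, mul_assoc]
    · exact h1

namespace LineSystem

variable {E : Type*} (D : LineSystem n E)

-- The end factor of a letter meets the front factor of the next one. They cancel unless exactly one
-- end of the Whitehead edge between the letters lies in `X`, in which case one letter remains.
-- Occurrences of `a` and its inverse have no middle part.
open Classical in
theorem norm_whiteheadAut_read_le {X : Set (Fin n × Bool)} {a : Fin n × Bool} (ha : a ∈ X)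
    (ha' : letterInv a ∉ X) (k : ℕ) (e : E) :
    ((whiteheadFactor X (letterElt a) (D.hd e))⁻¹ * whiteheadAut X a (FreeGroup.mk (D.read k e)) *
      whiteheadFactor X (letterElt a) (D.hd ((D.nxt ^ k) e))).norm ≤
    ∑ t ∈ Finset.range k, ((if (D.hd ((D.nxt ^ t) e)).1 = a.1 then 0 else 1) +
      if D.tl (D.nxt ((D.nxt ^ t) e)) ∈ X ↔ D.hd (D.nxt ((D.nxt ^ t) e)) ∈ X then 0 else 1) := by
  induction k with
  | zero => simp [read, ← FreeGroup.one_eq_mk]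
  | succ k ih =>
    rw [Finset.sum_range_succ]
    have h1 : FreeGroup.mk (D.read (k + 1) e) =
        FreeGroup.mk (D.read k e) * letterElt (D.hd ((D.nxt ^ k) e)) := by
      rw [read_succ, ← FreeGroup.mul_mk]
      rfl
    have h2 : D.hd ((D.nxt ^ (k + 1)) e) = D.hd (D.nxt ((D.nxt ^ k) e)) := by
      rw [pow_succ', Equiv.Perm.mul_apply]
    rw [h1, map_mul, whiteheadAut_letterElt ha ha', h2]
    generalize (D.nxt ^ k) e = f at *
    rw [← D.tl_nxt f]
    generalize D.nxt f = f' at *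
    have h3 : (whiteheadMiddle a (D.hd f)).norm ≤ if (D.hd f).1 = a.1 then 0 else 1 := by
      rw [whiteheadMiddle]
      split_ifs
      · simp
      · rw [norm_letterElt]
    have h4 : ((whiteheadFactor X (letterElt a) (D.tl f'))⁻¹ *
        whiteheadFactor X (letterElt a) (D.hd f')).norm ≤
        if D.tl f' ∈ X ↔ D.hd f' ∈ X then 0 else 1 := by
      simp only [whiteheadFactor]
      by_cases h5 : D.tl f' ∈ X <;> by_cases h6 : D.hd f' ∈ X <;>
        simp [h5, h6, FreeGroup.norm_inv_eq, norm_letterElt]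
    refine le_trans (le_of_eq (congrArg FreeGroup.norm ?_)) ((FreeGroup.norm_mul_le _ _).trans
      (Nat.add_le_add ih ((FreeGroup.norm_mul_le _ _).trans (Nat.add_le_add h3 h4))))
    group

end LineSystem

end Whitehead

/-! ### The Whitehead graph of a minimal list -/

section Positions

variable {n : ℕ}

/-- The positions in the words of a list. -/
abbrev Position (U : List (FreeGroup (Fin n))) : Type :=
  Σ k : Fin U.length, Fin (U.get k).toWord.length

theorem get_finRotate_ne {w : List (Fin n × Bool)} (hc : FreeGroup.IsCyclicallyReduced w)
    (j : Fin w.length) : w.get (finRotate _ j) ≠ letterInv (w.get j) := by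
  intro h
  have key : (w.get j).1 = (w.get (finRotate _ j)).1 → (w.get j).2 = (w.get (finRotate _ j)).2 := by
    have hv := LineSystem.val_finRotate j
    by_cases hj : (j : ℕ) + 1 < w.length
    · rw [Nat.mod_eq_of_lt hj] at hv
      have h1 := List.isChain_iff_getElem.1 hc.1 j hj
      simpa only [List.get_eq_getElem, hv] using h1
    · have hj' : (j : ℕ) + 1 = w.length := by omega
      rw [hj', Nat.mod_self] at hv
      have h1 : w.getLast? = some (w.get j) := by
        have h0 : w.length - 1 = j := by omega
        rw [List.getLast?_eq_getElem?, h0, List.get_eq_getElem, List.getElem?_eq_getElem]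
      have h2 : w.head? = some (w.get (finRotate _ j)) := by
        rw [List.head?_eq_getElem?, List.get_eq_getElem, List.getElem?_eq_getElem (by omega)]
        simp only [hv]
      exact hc.2 _ h1 _ h2
  rw [h] at key
  simp only [letterInv] at key
  have := key trivial
  revert this
  cases (w.get j).2 <;> simp

/-- The lines of a list of cyclically reduced words. -/
def positionSystem (U : List (FreeGroup (Fin n)))
    (hU : ∀ u ∈ U, FreeGroup.IsCyclicallyReduced u.toWord) : LineSystem n (Position U) where
  nxt := Equiv.sigmaCongrRight fun _ => finRotate _
  hd e := (U.get e.1).toWord.get e.2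
  hd_nxt_ne e := get_finRotate_ne (hU _ (U.get_mem e.1)) e.2

variable {U : List (FreeGroup (Fin n))} {hU : ∀ u ∈ U, FreeGroup.IsCyclicallyReduced u.toWord}

theorem positionSystem_nxt_pow (t : ℕ) (k : Fin U.length) (j : Fin (U.get k).toWord.length) :
    ((positionSystem U hU).nxt ^ t) ⟨k, j⟩ =
      ⟨k, ⟨(j + t) % (U.get k).toWord.length, Nat.mod_lt _ j.pos⟩⟩ := by
  induction t with
  | zero =>
    simp only [pow_zero, Equiv.Perm.one_apply, add_zero, Nat.mod_eq_of_lt j.2]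
  | succ t ih =>
    rw [pow_succ', Equiv.Perm.mul_apply, ih]
    refine congrArg (Sigma.mk k) (Fin.ext ?_)
    rw [LineSystem.val_finRotate]
    simp only [Nat.mod_add_mod, add_assoc]

theorem positionSystem_read (k : Fin U.length) (j : Fin (U.get k).toWord.length)
    (hj : (j : ℕ) = 0) :
    (positionSystem U hU).read (U.get k).toWord.length ⟨k, j⟩ = (U.get k).toWord := by
  refine List.ext_getElem (LineSystem.length_read _ _ _) fun t h1 h2 => ?_
  simp only [LineSystem.read, List.getElem_map, List.getElem_range, positionSystem_nxt_pow]
  simp only [positionSystem, hj, zero_add, Nat.mod_eq_of_lt h2]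
  rfl

-- After a full period the two outer factors of `norm_whiteheadAut_read_le` coincide and form a
-- conjugation, which the cyclic length ignores.
open Classical in
theorem cyclicLength_whiteheadAut_le {X : Set (Fin n × Bool)} {a : Fin n × Bool} (ha : a ∈ X)
    (ha' : letterInv a ∉ X) (k : Fin U.length) :
    cyclicLength (whiteheadAut X a (U.get k)) ≤ ∑ j, ((if
      ((positionSystem U hU).hd ⟨k, j⟩).1 = a.1 then 0 else 1) +
      if (positionSystem U hU).tl ((positionSystem U hU).nxt ⟨k, j⟩) ∈ X ↔
        (positionSystem U hU).hd ((positionSystem U hU).nxt ⟨k, j⟩) ∈ X then 0 else 1) := by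
  by_cases h0 : (U.get k).toWord.length = 0
  · have : U.get k = 1 := by
      rw [← FreeGroup.toWord_eq_nil_iff]
      exact List.length_eq_zero_iff.1 h0
    have h1 : cyclicLength (whiteheadAut X a (U.get k)) = 0 := by
      rw [this, map_one]
      simp [cyclicLength]
    rw [h1]
    exact Nat.zero_le _
  · set D := positionSystem U hU
    set z : Fin (U.get k).toWord.length := ⟨0, by omega⟩
    have hr := positionSystem_read (hU := hU) k z rfl
    have hu : U.get k = FreeGroup.mk (D.read (U.get k).toWord.length ⟨k, z⟩) := by
      rw [hr, FreeGroup.mk_toWord]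
    have hfix : (D.nxt ^ (U.get k).toWord.length) ⟨k, z⟩ = ⟨k, z⟩ := by
      rw [positionSystem_nxt_pow]
      exact congrArg (Sigma.mk k) (Fin.ext (by simp [z]))
    have h1 := D.norm_whiteheadAut_read_le ha ha' (U.get k).toWord.length ⟨k, z⟩
    rw [hfix, ← hu] at h1
    have h2 := cyclicLength_le_norm_conj (whiteheadAut X a (U.get k))
      (whiteheadFactor X (letterElt a) (D.hd ⟨k, z⟩))⁻¹
    rw [inv_inv] at h2
    refine h2.trans (h1.trans (le_of_eq ?_))
    rw [Finset.sum_range]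
    refine Finset.sum_congr rfl fun j _ => ?_
    have h3 : (D.nxt ^ (j : ℕ)) ⟨k, z⟩ = ⟨k, j⟩ := by
      rw [positionSystem_nxt_pow]
      exact congrArg (Sigma.mk k) (Fin.ext (by
        simp only [z, zero_add]
        exact Nat.mod_eq_of_lt j.2))
    rw [h3]

theorem sum_map_eq_sum_fin {γ : Type*} (U : List γ) (f : γ → ℕ) :
    (U.map f).sum = ∑ k : Fin U.length, f (U.get k) := by
  conv_lhs => rw [← List.ofFn_get U]
  rw [List.map_ofFn, List.sum_ofFn]
  rfl

/-- The Whitehead graph of a minimal list satisfies the cut condition. -/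
theorem cutCondition_of_isMinimal (hmin : IsMinimal U) : (positionSystem U hU).CutCondition := by
  classical
  intro x X hx hx'
  set D := positionSystem U hU
  have ha : letterInv (letterInv x) ∉ X := by rwa [letterInv_letterInv]
  -- The new total length is at most the old one minus the degree of `x` plus the number of edges
  -- crossing `X`.
  have h1 := hmin (whiteheadAut X (letterInv x))
  rw [sum_map_eq_sum_fin, sum_map_eq_sum_fin] at h1
  have h2 : ∑ k : Fin U.length, cyclicLength (U.get k) = Fintype.card (Position U) := by
    rw [Fintype.card_sigma]
    refine Finset.sum_congr rfl fun k _ => ?_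
    rw [Fintype.card_fin, LineSystem.cyclicLength_of_isCyclicallyReduced (hU _ (U.get_mem k))]
    rfl
  have h3 := Finset.sum_le_sum fun k (_ : k ∈ (Finset.univ : Finset (Fin U.length))) =>
    cyclicLength_whiteheadAut_le (hU := hU) hx' ha k
  have h4 := h1.trans h3
  rw [h2, ← Fintype.sum_sigma', Finset.sum_add_distrib] at h4
  change _ ≤ (∑ e : Position U, if (D.hd e).1 = (letterInv x).1 then 0 else 1) +
    ∑ e : Position U, if D.tl (D.nxt e) ∈ X ↔ D.hd (D.nxt e) ∈ X then 0 else 1 at h4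
  have h5 : (∑ e : Position U, if D.tl (D.nxt e) ∈ X ↔ D.hd (D.nxt e) ∈ X then 0 else 1) =
      {e | ¬ (D.tl e ∈ X ↔ D.hd e ∈ X)}.ncard := by
    rw [Equiv.sum_comp D.nxt fun e => if D.tl e ∈ X ↔ D.hd e ∈ X then 0 else 1]
    rw [Set.ncard_eq_toFinset_card', Set.toFinset_ofPred, Finset.card_filter]
    exact Finset.sum_congr rfl fun e _ => by split_ifs <;> rfl
  -- The degree of `x` counts the positions reading `x` or its inverse, which are those where the
  -- middle part vanishes.
  have h6 : (∑ e : Position U, if (D.hd e).1 = (letterInv x).1 then 0 else 1) +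
      {e | D.tl e = x ∨ D.hd e = x}.ncard = Fintype.card (Position U) := by
    have h7 : {e | D.tl e = x ∨ D.hd e = x} = {e | D.tl e = x} ∪ {e | D.hd e = x} := rfl
    have h8 : {e | D.tl e = x} = D.nxt '' {e | D.hd e = letterInv x} := by
      rw [Equiv.image_eq_preimage_symm]
      ext e
      simp only [Set.mem_preimage, Set.mem_ofPred_eq]
      rw [D.hd_nxt_symm, letterInv_injective.eq_iff]
    have h9 : {e | (D.hd e).1 = x.1} = {e | D.hd e = letterInv x} ∪ {e | D.hd e = x} := by
      ext e
      simp only [Set.mem_ofPred_eq, Set.mem_union, letterInv, Prod.ext_iff]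
      cases (D.hd e).2 <;> cases x.2 <;> simp
    have h10 : {e | D.tl e = x ∨ D.hd e = x}.ncard = {e | (D.hd e).1 = x.1}.ncard := by
      rw [h7, h9, Set.ncard_union_eq, Set.ncard_union_eq, h8,
        Set.ncard_image_of_injective _ D.nxt.injective]
      · rw [Set.disjoint_left]
        intro e he he'
        exact letterInv_ne x (Eq.trans (Eq.symm he) he')
      · rw [Set.disjoint_left]
        intro e he he'
        exact D.hd_ne_tl e (Eq.trans he' (Eq.symm he))
    rw [h10, Set.ncard_eq_toFinset_card', Set.toFinset_ofPred, Finset.card_filter,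
      ← Finset.sum_add_distrib, ← Finset.card_univ, Finset.card_eq_sum_ones]
    refine Finset.sum_congr rfl fun e _ => ?_
    change (if (D.hd e).1 = x.1 then 0 else 1) + _ = 1
    split_ifs <;> rfl
  rw [h5] at h4
  omega

end Positions

/-! ### Diskbusting implies connectedness -/

section Splittings

variable {n : ℕ}

/-- The subgroup generated by some of the basis elements. -/
def basisSubgroup (T : Set (Fin n)) : Subgroup (FreeGroup (Fin n)) :=
  Subgroup.closure (FreeGroup.of '' T)

theorem of_mem_basisSubgroup {T : Set (Fin n)} {i : Fin n} (h : i ∈ T) :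
    FreeGroup.of i ∈ basisSubgroup T := Subgroup.subset_closure ⟨i, h, rfl⟩

theorem mk_mem_basisSubgroup {T : Set (Fin n)} (L : List (Fin n × Bool)) (h : ∀ x ∈ L, x.1 ∈ T) :
    FreeGroup.mk L ∈ basisSubgroup T := by
  induction L with
  | nil => rw [← FreeGroup.one_eq_mk]; exact one_mem _
  | cons x L ih =>
    have h1 : FreeGroup.mk (x :: L) = letterElt x * FreeGroup.mk L := by
      rw [letterElt, FreeGroup.mul_mk, List.singleton_append]
    rw [h1]
    refine mul_mem ?_ (ih fun y hy => h y (List.mem_cons_of_mem _ hy))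
    have h2 := of_mem_basisSubgroup (h x List.mem_cons_self)
    obtain ⟨i, _ | _⟩ := x
    · exact inv_mem h2
    · exact h2

/-- The inverse sends each basis element to its factor, by the universal property of the free group.
-/
theorem isInternalFreeProduct_basisSubgroup (T : Set (Fin n)) :
    IsInternalFreeProduct (basisSubgroup T) (basisSubgroup Tᶜ) := by
  classical
  let ψ : FreeGroup (Fin n) →* Monoid.Coprod (basisSubgroup T) (basisSubgroup Tᶜ) :=
    FreeGroup.lift fun i => if h : i ∈ T then Monoid.Coprod.inl ⟨_, of_mem_basisSubgroup h⟩
      else Monoid.Coprod.inr ⟨_, of_mem_basisSubgroup (T := Tᶜ) h⟩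
  have hl : ∀ x (hx : x ∈ basisSubgroup T), ψ x = Monoid.Coprod.inl ⟨x, hx⟩ := by
    intro x hx
    refine Subgroup.closure_induction (p := fun x hx => ψ x = Monoid.Coprod.inl ⟨x, hx⟩)
      ?_ ?_ ?_ ?_ hx
    · rintro _ ⟨i, hi, rfl⟩
      simp only [ψ, FreeGroup.lift_apply_of]
      rw [dif_pos hi]
    · rw [map_one]
      exact (map_one Monoid.Coprod.inl).symm
    · intro x y hx hy h1 h2
      rw [map_mul, h1, h2, ← map_mul]
      rfl
    · intro x hx h1
      rw [map_inv, h1, ← map_inv]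
      rfl
  have hr : ∀ x (hx : x ∈ basisSubgroup Tᶜ), ψ x = Monoid.Coprod.inr ⟨x, hx⟩ := by
    intro x hx
    refine Subgroup.closure_induction (p := fun x hx => ψ x = Monoid.Coprod.inr ⟨x, hx⟩)
      ?_ ?_ ?_ ?_ hx
    · rintro _ ⟨i, hi, rfl⟩
      simp only [ψ, FreeGroup.lift_apply_of]
      rw [dif_neg hi]
    · rw [map_one]
      exact (map_one Monoid.Coprod.inr).symm
    · intro x y hx hy h1 h2
      rw [map_mul, h1, h2, ← map_mul]
      rfl
    · intro x hx h1
      rw [map_inv, h1, ← map_inv]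
      rfl
  have h1 : ψ.comp (Monoid.Coprod.lift (basisSubgroup T).subtype (basisSubgroup Tᶜ).subtype) =
      MonoidHom.id _ := by
    refine Monoid.Coprod.hom_ext ?_ ?_
    · ext ⟨x, hx⟩
      simpa using hl x hx
    · ext ⟨x, hx⟩
      simpa using hr x hx
  have h2 : (Monoid.Coprod.lift (basisSubgroup T).subtype (basisSubgroup Tᶜ).subtype).comp ψ =
      MonoidHom.id _ := by
    refine FreeGroup.ext_hom _ _ fun i => ?_
    by_cases hi : i ∈ T
    · simp [ψ, hi]
    · simp [ψ, hi]
  exact Function.bijective_iff_has_inverse.2 ⟨ψ, fun x => DFunLike.congr_fun h1 x,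
    fun x => DFunLike.congr_fun h2 x⟩

theorem basisSubgroup_ne_bot {T : Set (Fin n)} {i : Fin n} (h : i ∈ T) : basisSubgroup T ≠ ⊥ := by
  intro hbot
  have h1 := of_mem_basisSubgroup h
  rw [hbot, Subgroup.mem_bot] at h1
  exact FreeGroup.of_ne_one i h1

/-- A diskbusting list cannot be separated by a partition of the basis. -/
theorem IsDiskbusting.eq_empty_or_univ {U : List (FreeGroup (Fin n))} (hdb : IsDiskbusting U)
    {T : Set (Fin n)}
    (hT : ∀ u ∈ U, (∀ x ∈ u.toWord, x.1 ∈ T) ∨ ∀ x ∈ u.toWord, x.1 ∉ T) :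
    T = ∅ ∨ T = Set.univ := by
  by_contra! hcon
  obtain ⟨h1, h2⟩ := hcon
  obtain ⟨i, hi⟩ := h1
  obtain ⟨j, hj⟩ := (Set.ne_univ_iff_exists_notMem T).1 h2
  refine hdb ⟨basisSubgroup T, basisSubgroup Tᶜ, isInternalFreeProduct_basisSubgroup T,
    basisSubgroup_ne_bot hi, basisSubgroup_ne_bot (T := Tᶜ) hj, fun u hu => ?_⟩
  rcases hT u hu with h | h
  · left
    refine ⟨1, ?_⟩
    rw [one_mul, inv_one, mul_one, ← FreeGroup.mk_toWord (x := u)]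
    exact mk_mem_basisSubgroup _ h
  · right
    refine ⟨1, ?_⟩
    rw [one_mul, inv_one, mul_one, ← FreeGroup.mk_toWord (x := u)]
    exact mk_mem_basisSubgroup _ h

variable {U : List (FreeGroup (Fin n))} {hU : ∀ u ∈ U, FreeGroup.IsCyclicallyReduced u.toWord}

theorem exists_position {k : Fin U.length} {x : Fin n × Bool} (hx : x ∈ (U.get k).toWord) :
    ∃ e : Position U, e.1 = k ∧ (positionSystem U hU).hd e = x := by
  obtain ⟨j, rfl⟩ := List.get_of_mem hx
  exact ⟨⟨k, j⟩, rfl, rfl⟩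

theorem exists_nxt_pow_eq {e f : Position U} (h : e.1 = f.1) :
    ∃ t : ℕ, ((positionSystem U hU).nxt ^ t) e = f := by
  obtain ⟨k, j⟩ := e
  obtain ⟨l, i⟩ := f
  obtain rfl : k = l := h
  refine ⟨(U.get k).toWord.length - j + i, ?_⟩
  rw [positionSystem_nxt_pow]
  refine congrArg (Sigma.mk k) (Fin.ext ?_)
  have h1 : (j : ℕ) + ((U.get k).toWord.length - j + i) = (U.get k).toWord.length + i := by
    have := j.2
    omega
  simp only [h1, Nat.add_mod_left]
  exact Nat.mod_eq_of_lt i.2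

/-- The Whitehead graph of a minimal diskbusting list is connected. -/
theorem eq_empty_or_univ_of_isDiskbusting (hn : 2 ≤ n)
    (hcut : (positionSystem U hU).CutCondition) (hdb : IsDiskbusting U) {X : Set (Fin n × Bool)}
    (hX : ∀ e, (positionSystem U hU).tl e ∈ X ↔ (positionSystem U hU).hd e ∈ X) :
    X = ∅ ∨ X = Set.univ := by
  set D := positionSystem U hU with hD
  -- If `X` separated a letter from its inverse, the empty cut would force that letter to have
  -- degree 0. Its basis element would then occur in no word and split off, which needs `n ≥ 2` for
  -- the other factor to be nontrivial.
  have hne : ∀ x, ¬ (x ∉ X ∧ letterInv x ∈ X) := by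
    rintro x ⟨hx, hx'⟩
    have h1 := hcut x X hx hx'
    have h2 : {e | ¬ (D.tl e ∈ X ↔ D.hd e ∈ X)} = ∅ := by
      rw [Set.eq_empty_iff_forall_notMem]
      exact fun e he => he (hX e)
    rw [h2, Set.ncard_empty, Nat.le_zero, Set.ncard_eq_zero] at h1
    have h3 : ∀ e, (D.hd e).1 ≠ x.1 := by
      intro e he
      have h4 : D.hd e = x ∨ D.hd e = letterInv x := by
        generalize D.hd e = y at he
        obtain ⟨i, b⟩ := x
        obtain ⟨j, c⟩ := y
        simp only at he
        subst he
        cases b <;> cases c <;> simp [letterInv]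
      rcases h4 with h4 | h4
      · exact (Set.eq_empty_iff_forall_notMem.1 h1) e (Or.inr h4)
      · refine (Set.eq_empty_iff_forall_notMem.1 h1) (D.nxt e) (Or.inl ?_)
        rw [D.tl_nxt, h4, letterInv_letterInv]
    rcases hdb.eq_empty_or_univ (T := {x.1}) (fun u hu => Or.inr fun y hy => by
      obtain ⟨k, rfl⟩ := List.get_of_mem hu
      obtain ⟨e, -, rfl⟩ := exists_position (hU := hU) hy
      exact h3 e) with h4 | h4
    · exact Set.singleton_ne_empty _ h4
    · have h5 := congrArg Set.ncard h4
      rw [Set.ncard_singleton, Set.ncard_univ, Nat.card_fin] at h5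
      omega
  have hinv : ∀ i b, (i, b) ∈ X ↔ (i, true) ∈ X := by
    intro i b
    have h1 := hne (i, true)
    have h2 := hne (i, false)
    simp only [letterInv, Bool.not_true, Bool.not_false] at h1 h2
    cases b
    · constructor <;> intro h <;> by_contra hcon
      · exact h1 ⟨hcon, h⟩
      · exact h2 ⟨hcon, h⟩
    · exact Iff.rfl
  have hinv' : ∀ x : Fin n × Bool, x ∈ X ↔ (x.1, true) ∈ X := fun x => hinv x.1 x.2
  -- Now `X` is a union of pairs of inverse letters, so membership is constant along each word and
  -- `X` partitions the basis.
  have hnxt : ∀ e, D.hd (D.nxt e) ∈ X ↔ D.hd e ∈ X := by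
    intro e
    rw [← hX, D.tl_nxt, hinv', hinv' (D.hd e)]
    rfl
  have hpow : ∀ (t : ℕ) e, D.hd ((D.nxt ^ t) e) ∈ X ↔ D.hd e ∈ X := by
    intro t e
    induction t with
    | zero => rfl
    | succ t ih => rw [pow_succ', Equiv.Perm.mul_apply, hnxt, ih]
  rcases hdb.eq_empty_or_univ (T := {i | (i, true) ∈ X}) (fun u hu => by
    by_cases hall : ∀ x ∈ u.toWord, x.1 ∈ {i | (i, true) ∈ X}
    · exact Or.inl hall
    · right
      intro x hx hxX
      apply hall
      intro y hy
      obtain ⟨k, rfl⟩ := List.get_of_mem hu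
      obtain ⟨e, he, rfl⟩ := exists_position (hU := hU) hx
      obtain ⟨f, hf, rfl⟩ := exists_position (hU := hU) hy
      obtain ⟨t, rfl⟩ := exists_nxt_pow_eq (hU := hU) (he.trans hf.symm)
      have h1 : D.hd e ∈ X := (hinv' _).2 hxX
      exact (hinv' _).1 ((hpow t e).2 h1)) with h | h
  · left
    rw [Set.eq_empty_iff_forall_notMem] at h ⊢
    exact fun x hx => h x.1 ((hinv' x).1 hx)
  · right
    rw [Set.eq_univ_iff_forall] at h ⊢
    exact fun x => (hinv' x).2 (h x.1)

end Splittings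

open scoped Graph

/-! ### Cycles in matched graphs -/

section PathCycle

variable {α β : Type*} {G : Graph α β}

theorem IsWalk.mem_of_isLink {x y : α} {w : List (β × α)} (h : IsWalk G x w y) {f : β}
    (hf : f ∈ w.map Prod.fst) {a b : α} (hl : G.IsLink f a b) : a ∈ x :: w.map Prod.snd := by
  induction h with
  | nil => simp at hf
  | @cons x z y e w he hw ih =>
    rw [List.map_cons, List.mem_cons] at hf
    rcases hf with rfl | hf
    · rcases hl.left_eq_or_eq he with rfl | rfl <;> simp
    · exact List.mem_cons_of_mem _ (ih hf)

theorem IsWalk.end_mem {x y : α} {w : List (β × α)} (h : IsWalk G x w y) :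
    y ∈ x :: w.map Prod.snd := by
  induction h with
  | nil => simp
  | cons _ _ ih => exact List.mem_cons_of_mem _ ih

theorem IsWalk.mem_vertexSet {x y : α} {w : List (β × α)} (h : IsWalk G x w y) {v : α}
    (hv : v ∈ x :: w.map Prod.snd) : v ∈ V(G) := by
  induction h with
  | nil hx =>
    simp only [List.map_nil, List.mem_singleton] at hv
    exact hv ▸ hx
  | cons he _ ih =>
    rw [List.mem_cons] at hv
    rcases hv with rfl | hv
    · exact he.left_mem
    · exact ih hv

open Classical in
/-- Each vertex of a path is on two of its edges, except for the ends of the path. -/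
theorem IsPath.ncard_inc (hG : ∀ e x, ¬ G.IsLoopAt e x) {x y : α} {w : List (β × α)}
    (h : IsPath G x w y) (v : α) :
    {f | f ∈ w.map Prod.fst ∧ G.Inc f v}.ncard + (if v = x then 1 else 0) +
      (if v = y then 1 else 0) = if v ∈ x :: w.map Prod.snd then 2 else 0 := by
  obtain ⟨hw, hnd⟩ := h
  induction hw with
  | @nil x _ =>
    simp only [List.map_nil, List.not_mem_nil, false_and, List.mem_singleton]
    rw [show {f : β | False} = ∅ from rfl, Set.ncard_empty]
    split_ifs <;> rfl
  | @cons x z y e w he hw ih =>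
    rw [List.map_cons, List.nodup_cons] at hnd
    have hxz : x ≠ z := by
      rintro rfl
      exact hG e x he
    have hew : e ∉ w.map Prod.fst := fun h' => hnd.1 (hw.mem_of_isLink h' he)
    have hxw : ∀ f ∈ w.map Prod.fst, ¬ G.Inc f x := by
      rintro f hf ⟨b, hb⟩
      exact hnd.1 (hw.mem_of_isLink hf hb)
    have hinc : G.Inc e v ↔ v = x ∨ v = z := by
      constructor
      · exact fun h' => h'.eq_or_eq_of_isLink he
      · rintro (rfl | rfl)
        · exact he.inc_left
        · exact he.inc_right
    have hfin : {f | f ∈ w.map Prod.fst ∧ G.Inc f v}.Finite :=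
      (w.map Prod.fst).toFinset.finite_toSet.subset fun f hf => by simpa using hf.1
    have hcard : {f | f ∈ ((e, z) :: w).map Prod.fst ∧ G.Inc f v}.ncard =
        {f | f ∈ w.map Prod.fst ∧ G.Inc f v}.ncard + if v = x ∨ v = z then 1 else 0 := by
      by_cases hv : v = x ∨ v = z
      · rw [if_pos hv, ← Set.ncard_insert_of_notMem (fun h' => hew h'.1) hfin]
        congr 1
        ext f
        simp only [List.map_cons, List.mem_cons, Set.mem_ofPred_eq, Set.mem_insert_iff]
        constructor
        · rintro ⟨rfl | h1, h2⟩
          · exact Or.inl rfl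
          · exact Or.inr ⟨h1, h2⟩
        · rintro (rfl | ⟨h1, h2⟩)
          · exact ⟨Or.inl rfl, hinc.2 hv⟩
          · exact ⟨Or.inr h1, h2⟩
      · rw [if_neg hv, add_zero]
        congr 1
        ext f
        simp only [List.map_cons, List.mem_cons, Set.mem_ofPred_eq]
        constructor
        · rintro ⟨rfl | h1, h2⟩
          · exact absurd (hinc.1 h2) hv
          · exact ⟨h1, h2⟩
        · exact fun h' => ⟨Or.inr h'.1, h'.2⟩
    have hih := ih hnd.2
    rw [hcard]
    have hmem : v ∈ x :: ((e, z) :: w).map Prod.snd ↔ v = x ∨ v ∈ z :: w.map Prod.snd := by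
      simp
    have hxm : x ∉ z :: w.map Prod.snd := hnd.1
    by_cases hvx : v = x
    · subst hvx
      rw [if_neg hxm] at hih
      rw [if_pos (hmem.2 (Or.inl rfl)), if_pos (Or.inl rfl), if_pos rfl]
      omega
    · have h1 : (v = x ∨ v = z) ↔ v = z := or_iff_right hvx
      have h2 : v ∈ x :: ((e, z) :: w).map Prod.snd ↔ v ∈ z :: w.map Prod.snd :=
        hmem.trans (or_iff_right hvx)
      simp only [h1, h2, if_neg hvx]
      omega

/-- The graph consisting of a path from `x` to `y` and an edge `e` between `y` and `x`. -/
def pathCycle {x y : α} {w : List (β × α)} (h : IsWalk G x w y) {e : β} (he : G.IsLink e x y) :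
    Graph α β where
  vertexSet := {v | v ∈ x :: w.map Prod.snd}
  edgeSet := {f | f = e ∨ f ∈ w.map Prod.fst}
  IsLink f a b := (f = e ∨ f ∈ w.map Prod.fst) ∧ G.IsLink f a b
  isLink_symm _ _ := ⟨fun _ _ h => ⟨h.1, h.2.symm⟩⟩
  eq_or_eq_of_isLink_of_isLink _ _ _ _ _ h h' := h.2.left_eq_or_eq h'.2
  edge_mem_iff_exists_isLink f := by
    constructor
    · intro hf
      have hfG : f ∈ E(G) := by
        rcases hf with rfl | hf
        · exact he.edge_mem
        · clear he
          induction h with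
          | nil => simp at hf
          | cons he _ ih =>
            rw [List.map_cons, List.mem_cons] at hf
            rcases hf with rfl | hf
            · exact he.edge_mem
            · exact ih hf
      obtain ⟨a, b, hab⟩ := Graph.exists_isLink_of_mem_edgeSet hfG
      exact ⟨a, b, hf, hab⟩
    · rintro ⟨a, b, hf, -⟩
      exact hf
  left_mem_of_isLink := by
    rintro f a b ⟨rfl | hf, hl⟩
    · rcases hl.left_eq_or_eq he with rfl | rfl
      · exact List.mem_cons_self
      · exact h.end_mem
    · exact h.mem_of_isLink hf hl

theorem isCycleOf_pathCycle (hG : ∀ e x, ¬ G.IsLoopAt e x) {x y : α} {w : List (β × α)}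
    (h : IsPath G x w y) {e : β} (he : G.IsLink e x y) (hew : e ∉ w.map Prod.fst) :
    IsCycleOf (pathCycle h.1 he) G := by
  classical
  have hxy : x ≠ y := by
    rintro rfl
    exact hG e x he
  have hfin : {f | f ∈ w.map Prod.fst}.Finite :=
    (w.map Prod.fst).toFinset.finite_toSet.subset fun f hf => by simpa using hf
  refine ⟨⟨fun v hv => h.1.mem_vertexSet hv, fun f a b hf => hf.2⟩, ?_, ?_,
    ⟨x, List.mem_cons_self⟩, ?_, ?_⟩
  · exact (x :: w.map Prod.snd).toFinset.finite_toSet.subset fun v hv =>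
      Finset.mem_coe.2 (List.mem_toFinset.2 hv)
  · exact (hfin.insert e).subset fun f hf => hf
  · have key : ∀ v ∈ x :: w.map Prod.snd,
        Relation.ReflTransGen (pathCycle h.1 he).Adj x v := by
      have hgen : ∀ (C : Graph α β) (x y : α) (w : List (β × α)), IsWalk G x w y →
          (∀ f a b, f ∈ w.map Prod.fst → G.IsLink f a b → C.IsLink f a b) →
          ∀ v ∈ x :: w.map Prod.snd, Relation.ReflTransGen C.Adj x v := by
        intro C x y w hw
        induction hw with
        | nil =>
          intro _ v hv
          simp only [List.map_nil, List.mem_singleton] at hv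
          rw [hv]
        | @cons x z y e w he _ ih =>
          intro hC v hv
          rw [List.mem_cons] at hv
          rcases hv with rfl | hv
          · exact .refl
          · refine Relation.ReflTransGen.head ⟨e, hC e x z List.mem_cons_self he⟩
              (ih (fun f a b hf => hC f a b (List.mem_cons_of_mem _ hf)) v hv)
      exact hgen _ x y w h.1 fun f a b hf hl => ⟨Or.inr hf, hl⟩
    intro v hv
    refine Set.Subset.antisymm (fun u hu => hu.1) fun u hu => ⟨hu, ?_⟩
    exact (reflTransGen_adj_symm (key v hv)).trans (key u hu)
  · intro v hv
    have h1 : (pathCycle h.1 he).loopSet v = ∅ := by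
      rw [Set.eq_empty_iff_forall_notMem]
      exact fun f hf => hG f v hf.2
    have h2 := h.ncard_inc hG v
    rw [if_pos (show v ∈ x :: w.map Prod.snd from hv)] at h2
    rw [degree, h1, Set.ncard_empty, add_zero, ← h2]
    have hfin' : {f | f ∈ w.map Prod.fst ∧ G.Inc f v}.Finite := hfin.subset fun f hf => hf.1
    have hinc : ∀ f, (pathCycle h.1 he).Inc f v ↔ (f = e ∨ f ∈ w.map Prod.fst) ∧ G.Inc f v := by
      intro f
      constructor
      · rintro ⟨b, hb, hl⟩
        exact ⟨hb, b, hl⟩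
      · rintro ⟨hb, b, hl⟩
        exact ⟨b, hb, hl⟩
    by_cases hv' : v = x ∨ v = y
    · have hev : G.Inc e v := by
        rcases hv' with rfl | rfl
        · exact he.inc_left
        · exact he.inc_right
      have h3 : (pathCycle h.1 he).incidenceSet v =
          insert e {f | f ∈ w.map Prod.fst ∧ G.Inc f v} := by
        ext f
        rw [Graph.mem_incidenceSet, hinc]
        constructor
        · rintro ⟨rfl | h4, h5⟩
          · exact Or.inl rfl
          · exact Or.inr ⟨h4, h5⟩
        · rintro (rfl | ⟨h4, h5⟩)
          · exact ⟨Or.inl rfl, hev⟩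
          · exact ⟨Or.inr h4, h5⟩
      rw [h3, Set.ncard_insert_of_notMem (fun h' => hew h'.1) hfin']
      rcases hv' with rfl | rfl
      · rw [if_pos rfl, if_neg hxy]
      · rw [if_pos rfl, if_neg hxy.symm]
    · rw [not_or] at hv'
      rw [if_neg hv'.1, if_neg hv'.2, add_zero, add_zero]
      congr 1
      ext f
      rw [Graph.mem_incidenceSet, hinc]
      constructor
      · rintro ⟨rfl | h4, h5⟩
        · rcases h5.eq_or_eq_of_isLink he with h6 | h6
          · exact absurd h6 hv'.1
          · exact absurd h6 hv'.2
        · exact ⟨h4, h5⟩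
      · exact fun h4 => ⟨Or.inr h4.1, h4.2⟩

end PathCycle

section MatchedCycle

variable {V E : Type*} [Fintype V] [Fintype E] [DecidableEq V] {tl hd : E → V} {μ : V → V}
  {σ : V → E → E}

/-- An edge at a vertex of degree at least two in a matched graph is on a cycle. -/
theorem IsMatched.exists_isCycleOf (h : IsMatched (ofEnds tl hd) μ σ) {v : V}
    (hv : 2 ≤ (delta (ofEnds tl hd) v).ncard) : ∃ C, IsCycleOf C (ofEnds tl hd) := by
  have hE : E(ofEnds tl hd).Finite := Set.toFinite (Set.univ : Set E)
  have hvG : v ∈ V(ofEnds tl hd) := trivial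
  have hloop := h.not_isLoopAt hE
  obtain ⟨e, he⟩ : (delta (ofEnds tl hd) v).Nonempty := by
    rw [Set.nonempty_iff_ne_empty]
    intro h0
    rw [h0, Set.ncard_empty] at hv
    omega
  obtain ⟨x, hxv, hl⟩ := he
  -- A path between the ends of `e` that avoids `e` closes up to a cycle; otherwise `e` is a bridge
  -- with `v` on the side `X`.
  rcases exists_path_flow_or_cut (tl := tl) (hd := hd) (fun f _ => f ≠ e) v x with
    ⟨g, P, hP, hgP, hgD, -⟩ | ⟨X, hx, hy, h1, h2⟩
  · refine ⟨_, isCycleOf_pathCycle hloop hP hl fun heP => ?_⟩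
    rcases hgD e with h3 | h3 | h3
    · exact (hgP e).1 heP h3
    · exact h3.2 rfl
    · exact h3.2 rfl
  · exfalso
    have hcut : ∀ f a b, (ofEnds tl hd).IsLink f a b → a ∈ X → b ∉ X → f = e := by
      rintro f a b (⟨rfl, rfl⟩ | ⟨rfl, rfl⟩) ha hb
      · exact not_not.1 (h1 f ha hb)
      · exact not_not.1 (h2 f ha hb)
    -- If `μ v` is on the side of `v`, removing `v` from `X` leaves a cut between `μ v` and `v`
    -- inside `δ(v)` without `e`, smaller than the degree. If not, `e` alone separates them,
    -- although the degree is at least 2.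
    by_cases hμ : μ v ∈ X
    · have hinv := h.inv v hvG
      have h3 := h.ncard_delta_le hE (v := μ v) trivial (X := (X : Set V) \ {v})
        ⟨hμ, hinv.2.1⟩ (fun h' => h'.2 hinv.2.2)
      have h4 : (delta (ofEnds tl hd) (μ v)).ncard = (delta (ofEnds tl hd) v).ncard := by
        have hb := h.bij v hvG
        rw [← hb.image_eq, hb.injOn.ncard_image]
      have h5 : cutEdges (ofEnds tl hd) ((X : Set V) \ {v}) ⊆ delta (ofEnds tl hd) v \ {e} := by
        rintro f ⟨a, b, hab, ⟨haX, hav⟩, hb⟩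
        have hav' : a ≠ v := hav
        have hfe : f ≠ e := by
          rintro rfl
          rcases hab.left_eq_or_eq hl with rfl | rfl
          · exact hav' rfl
          · exact hy haX
        have hbX : b ∈ X := by
          by_contra hbX
          exact hfe (hcut f a b hab haX hbX)
        have hbv : b = v := by
          by_contra hbv
          exact hb ⟨hbX, hbv⟩
        subst hbv
        exact ⟨⟨a, hav', hab.symm⟩, hfe⟩
      have h6 := Set.ncard_le_ncard h5
      have h7 : e ∈ delta (ofEnds tl hd) v := ⟨x, hxv, hl⟩
      rw [Set.ncard_sdiff_singleton_of_mem h7] at h6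
      omega
    · have h3 := h.ncard_delta_le hE hvG (X := (X : Set V)) hx hμ
      have h4 : cutEdges (ofEnds tl hd) (X : Set V) ⊆ {e} := by
        rintro f ⟨a, b, hab, ha, hb⟩
        exact hcut f a b hab ha hb
      have h5 := Set.ncard_le_ncard h4
      rw [Set.ncard_singleton] at h5
      omega

end MatchedCycle

/-! ### The padded Whitehead graph as a matched graph -/

section WhiteheadGraph

namespace LineSystem

variable {n n' : ℕ} {E : Type*} (D : LineSystem n E)

open Classical in
/-- The identification of the edges at a vertex `v` of the Whitehead graph with those at its
inverse. -/
noncomputable def glue (v : Fin n × Bool) (e : E) : E :=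
  if D.hd e = v then D.nxt e else D.nxt.symm e

theorem glue_hd (e : E) : D.glue (D.hd e) e = D.nxt e := if_pos rfl

theorem glue_tl (e : E) : D.glue (D.tl e) e = D.nxt.symm e := if_neg (D.hd_ne_tl e)

theorem glue_mem {v : Fin n × Bool} {e : E} (h : D.tl e = v ∨ D.hd e = v) :
    D.tl (D.glue v e) = letterInv v ∨ D.hd (D.glue v e) = letterInv v := by
  rcases h with rfl | rfl
  · rw [glue_tl, D.hd_nxt_symm]
    exact Or.inr rfl
  · rw [glue_hd, D.tl_nxt]
    exact Or.inl rfl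

theorem glue_glue {v : Fin n × Bool} {e : E} (h : D.tl e = v ∨ D.hd e = v) :
    D.glue (letterInv v) (D.glue v e) = e := by
  rcases h with rfl | rfl
  · rw [glue_tl, ← D.hd_nxt_symm, glue_hd, Equiv.apply_symm_apply]
  · rw [glue_hd, ← D.tl_nxt, glue_tl, Equiv.symm_apply_apply]

theorem eq_of_glue_eq {v : Fin n × Bool} {e f : E} (he : D.tl e = v ∨ D.hd e = v)
    (hf : D.tl f = v ∨ D.hd f = v) (h : D.glue v e = D.glue v f) : e = f := by
  rw [← D.glue_glue he, h, D.glue_glue hf]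

/-- The Whitehead graph, with additional isolated vertices. -/
def whiteheadGraph (h : n ≤ n') : Graph (Fin n' × Bool) E :=
  ofEnds (fun e => Prod.map (Fin.castLE h) id (D.tl e)) fun e =>
    Prod.map (Fin.castLE h) id (D.hd e)

variable {D} (h : n ≤ n')

theorem letter_injective : Function.Injective
    (Prod.map (Fin.castLE h) id : Fin n × Bool → Fin n' × Bool) :=
  (Fin.castLE_injective h).prodMap Function.injective_id

theorem inc_whiteheadGraph {e : E} {x : Fin n × Bool} :
    (D.whiteheadGraph h).Inc e (Prod.map (Fin.castLE h) id x) ↔ D.tl e = x ∨ D.hd e = x := by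
  rw [whiteheadGraph, ofEnds_inc, (letter_injective h).eq_iff, (letter_injective h).eq_iff]

theorem exists_of_inc_whiteheadGraph {e : E} {v : Fin n' × Bool}
    (hv : (D.whiteheadGraph h).Inc e v) : ∃ x, Prod.map (Fin.castLE h) id x = v := by
  rcases ofEnds_inc.1 hv with hv | hv
  · exact ⟨_, hv⟩
  · exact ⟨_, hv⟩

theorem not_isLoopAt_whiteheadGraph (e : E) (v : Fin n' × Bool) :
    ¬ (D.whiteheadGraph h).IsLoopAt e v := by
  rintro (⟨h1, h2⟩ | ⟨h1, h2⟩)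
  · exact D.hd_ne_tl e (letter_injective h (h2.trans h1.symm))
  · exact D.hd_ne_tl e (letter_injective h (h1.trans h2.symm))

theorem mem_delta_whiteheadGraph {e : E} {v : Fin n' × Bool} :
    e ∈ delta (D.whiteheadGraph h) v ↔ (D.whiteheadGraph h).Inc e v := by
  constructor
  · rintro ⟨y, -, hy⟩
    exact ⟨y, hy⟩
  · rintro ⟨y, hy⟩
    refine ⟨y, ?_, hy⟩
    rintro rfl
    exact not_isLoopAt_whiteheadGraph h e y hy

open Classical in
variable (D) in
/-- The identification `glue`, for the Whitehead graph with additional vertices. -/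
noncomputable def glueMap (v : Fin n' × Bool) (e : E) : E :=
  if Prod.map (Fin.castLE h) id (D.hd e) = v then D.nxt e else D.nxt.symm e

theorem glueMap_apply (x : Fin n × Bool) (e : E) :
    D.glueMap h (Prod.map (Fin.castLE h) id x) e = D.glue x e := by
  simp only [glueMap, glue, (letter_injective h).eq_iff]

theorem letterInv_map (x : Fin n × Bool) : letterInv (Prod.map (Fin.castLE h) id x) =
    Prod.map (Fin.castLE h) id (letterInv x) := rfl

/-- The cut condition for complements of vertex sets supplies the large cuts that Menger's theorem
needs. The added vertices have degree 0. -/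
theorem isMatched_whiteheadGraph [Fintype E] (hcut : D.CutCondition) :
    IsMatched (D.whiteheadGraph h) letterInv (D.glueMap h) := by
  classical
  have hmaps : ∀ v, Set.MapsTo (D.glueMap h v) (delta (D.whiteheadGraph h) v)
      (delta (D.whiteheadGraph h) (letterInv v)) := by
    intro v e he
    rw [mem_delta_whiteheadGraph] at he ⊢
    obtain ⟨x, rfl⟩ := exists_of_inc_whiteheadGraph h he
    rw [inc_whiteheadGraph] at he
    rw [glueMap_apply, letterInv_map, inc_whiteheadGraph]
    exact D.glue_mem he
  have hinv : ∀ v, ∀ e ∈ delta (D.whiteheadGraph h) v,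
      D.glueMap h (letterInv v) (D.glueMap h v e) = e := by
    intro v e he
    rw [mem_delta_whiteheadGraph] at he
    obtain ⟨x, rfl⟩ := exists_of_inc_whiteheadGraph h he
    rw [inc_whiteheadGraph] at he
    rw [glueMap_apply, letterInv_map, glueMap_apply]
    exact D.glue_glue he
  refine ⟨fun v _ => ⟨trivial, letterInv_ne v, letterInv_letterInv v⟩, fun v _ => ?_, fun v _ => ?_,
    fun v _ => hinv v⟩
  · refine Set.InvOn.bijOn (f' := D.glueMap h (letterInv v)) ⟨hinv v, ?_⟩ (hmaps v) ?_
    · have := hinv (letterInv v)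
      rwa [letterInv_letterInv] at this
    · have := hmaps (letterInv v)
      rwa [letterInv_letterInv] at this
  · have h1 : (D.whiteheadGraph h).loopSet v = ∅ := by
      rw [Set.eq_empty_iff_forall_notMem]
      exact fun e => not_isLoopAt_whiteheadGraph h e v
    have hE : E(D.whiteheadGraph h).Finite := Set.toFinite (Set.univ : Set E)
    rw [degree_eq hE, h1, Set.ncard_empty, mul_zero, add_zero, ← cutEdges_singleton]
    have h2 : cutEdges (D.whiteheadGraph h) {v} =
        {e | ¬ (Prod.map (Fin.castLE h) id (D.tl e) = v ↔
          Prod.map (Fin.castLE h) id (D.hd e) = v)} := by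
      ext e
      exact mem_cutEdges_ofEnds
    rw [h2]
    refine localEdgeConn_eq_of_cut (letterInv_ne v).symm rfl fun X hx hy => ?_
    by_cases hr : ∃ x, Prod.map (Fin.castLE h) id x = v
    · obtain ⟨x, rfl⟩ := hr
      have h3 := hcut x {z | Prod.map (Fin.castLE h) id z ∉ X} (fun h' => h' hx) hy
      have h4 : {e | ¬ (Prod.map (Fin.castLE h) id (D.tl e) = Prod.map (Fin.castLE h) id x ↔
          Prod.map (Fin.castLE h) id (D.hd e) = Prod.map (Fin.castLE h) id x)} =
          {e | D.tl e = x ∨ D.hd e = x} := by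
        ext e
        simp only [Set.mem_ofPred_eq, (letter_injective h).eq_iff]
        have := D.hd_ne_tl e
        constructor
        · tauto
        · rintro (rfl | rfl) h5
          · exact this (h5.1 rfl)
          · exact this (h5.2 rfl).symm
      rw [h4]
      refine h3.trans (le_of_eq ?_)
      congr 1
      ext e
      simp only [Set.mem_ofPred_eq]
      tauto
    · have h3 : {e | ¬ (Prod.map (Fin.castLE h) id (D.tl e) = v ↔
          Prod.map (Fin.castLE h) id (D.hd e) = v)} = ∅ := by
        rw [Set.eq_empty_iff_forall_notMem]
        intro e he
        exact he ⟨fun h' => absurd ⟨_, h'⟩ hr, fun h' => absurd ⟨_, h'⟩ hr⟩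
      rw [h3, Set.ncard_empty]
      exact Nat.zero_le _

theorem two_mul_le_ncard_component (hn : 0 < n)
    (hconn : ∀ X : Set (Fin n × Bool), (∀ e, D.tl e ∈ X ↔ D.hd e ∈ X) → X = ∅ ∨ X = Set.univ) :
    ∃ v, 2 * n ≤ (component (D.whiteheadGraph h) v).ncard := by
  let x₀ : Fin n × Bool := (⟨0, hn⟩, true)
  set v := Prod.map (Fin.castLE h) id x₀
  have h1 := hconn {x | Prod.map (Fin.castLE h) id x ∈ component (D.whiteheadGraph h) v} fun e =>
    ⟨fun he => component_closed he (e := e) (Or.inl ⟨rfl, rfl⟩),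
      fun he => component_closed he (e := e) (Or.inr ⟨rfl, rfl⟩)⟩
  have h2 : x₀ ∈ {x | Prod.map (Fin.castLE h) id x ∈ component (D.whiteheadGraph h) v} :=
    ⟨trivial, .refl⟩
  have h3 := h1.resolve_left fun h4 => by rw [h4] at h2; exact h2
  refine ⟨v, ?_⟩
  have h4 : Set.range (Prod.map (Fin.castLE h) id : Fin n × Bool → Fin n' × Bool) ⊆
      component (D.whiteheadGraph h) v := by
    rintro _ ⟨x, rfl⟩
    exact Set.eq_univ_iff_forall.1 h3 x
  have h5 := Set.ncard_le_ncard h4 (Set.toFinite _)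
  rwa [← Set.image_univ, (letter_injective h).injOn.ncard_image, Set.ncard_univ,
    Nat.card_eq_fintype_card, Fintype.card_prod, Fintype.card_fin, Fintype.card_bool,
    mul_comm] at h5

/-- Otherwise every degree is at most 1, and a connected graph of that kind has at most two
vertices, while there are at least four letters. -/
theorem exists_isCycleOf_whiteheadGraph [Fintype E] (hcut : D.CutCondition) (hn : 2 ≤ n)
    (hconn : ∀ X : Set (Fin n × Bool), (∀ e, D.tl e ∈ X ↔ D.hd e ∈ X) → X = ∅ ∨ X = Set.univ) :
    ∃ C, IsCycleOf C (D.whiteheadGraph h) := by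
  classical
  by_contra hno
  have hlt : ∀ v, (delta (D.whiteheadGraph h) v).ncard < 2 := fun v => by
    by_contra hlt
    exact hno ((isMatched_whiteheadGraph h hcut).exists_isCycleOf (not_lt.1 hlt))
  have huniq : ∀ x e f, (D.tl e = x ∨ D.hd e = x) → (D.tl f = x ∨ D.hd f = x) → e = f := by
    intro x e f he hf
    have h1 := hlt (Prod.map (Fin.castLE h) id x)
    refine (Set.ncard_le_one (Set.toFinite _)).1 (Nat.le_of_lt_succ h1) e ?_ f ?_
    · rwa [mem_delta_whiteheadGraph, inc_whiteheadGraph]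
    · rwa [mem_delta_whiteheadGraph, inc_whiteheadGraph]
  let x₀ : Fin n × Bool := (⟨0, by omega⟩, true)
  have hcard : 2 < Fintype.card (Fin n × Bool) := by
    rw [Fintype.card_prod, Fintype.card_fin, Fintype.card_bool]
    omega
  have hsmall : ∀ a b : Fin n × Bool, ({a, b} : Set (Fin n × Bool)) ≠ Set.univ := by
    intro a b hab
    have h1 := Set.ncard_insert_le a {b}
    rw [hab, Set.ncard_univ, Set.ncard_singleton, Nat.card_eq_fintype_card] at h1
    omega
  by_cases hx : ∃ e, D.tl e = x₀ ∨ D.hd e = x₀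
  · obtain ⟨e, -⟩ := hx
    rcases hconn {D.tl e, D.hd e} (fun f => by
      constructor
      · rintro (h1 | h1)
        · rw [huniq _ f e (Or.inl h1) (Or.inl rfl)]
          exact Or.inr rfl
        · rw [huniq _ f e (Or.inl h1) (Or.inr rfl)]
          exact Or.inr rfl
      · rintro (h1 | h1)
        · rw [huniq _ f e (Or.inr h1) (Or.inl rfl)]
          exact Or.inl rfl
        · rw [huniq _ f e (Or.inr h1) (Or.inr rfl)]
          exact Or.inl rfl) with h1 | h1
    · exact (Set.insert_nonempty _ _).ne_empty h1
    · exact hsmall _ _ h1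
  · rcases hconn {x₀} (fun f => by
      constructor
      · exact fun h1 => absurd ⟨f, Or.inl h1⟩ hx
      · exact fun h1 => absurd ⟨f, Or.inr h1⟩ hx) with h1 | h1
    · exact (Set.singleton_nonempty _).ne_empty h1
    · refine hsmall x₀ x₀ ?_
      rwa [Set.pair_eq_singleton]

end LineSystem

end WhiteheadGraph

/-! ### Surfaces from permutations -/

section Enumeration

/-- There is one index per orbit, with the minimal period as the number of sides; the iterates of a
representative list the orbit cyclically. -/
theorem exists_orbit_enumeration {K : Type*} [Finite K] (τ : Equiv.Perm K) :
    ∃ (m : ℕ) (s : Fin m → ℕ) (φ : (Σ i, Fin (s i)) ≃ K), (∀ i, 0 < s i) ∧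
      ∀ i j, φ ⟨i, finRotate _ j⟩ = τ (φ ⟨i, j⟩) := by
  let st := Equiv.Perm.SameCycle.setoid τ
  obtain ⟨m, ⟨ε⟩⟩ := Finite.exists_equiv_fin (Quotient st)
  let r : Fin m → K := fun i => (ε.symm i).out
  have hr : ∀ i, ε (Quotient.mk st (r i)) = i := fun i => by
    rw [Quotient.out_eq, Equiv.apply_symm_apply]
  have hpos : ∀ x, 0 < Function.minimalPeriod τ x := fun x =>
    Function.minimalPeriod_pos_of_mem_periodicPts
      (Function.mem_periodicPts.2 ⟨orderOf τ, orderOf_pos τ, by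
        rw [Function.IsPeriodicPt, Function.IsFixedPt, Equiv.Perm.iterate_eq_pow, pow_orderOf_eq_one]
        rfl⟩)
  let s : Fin m → ℕ := fun i => Function.minimalPeriod τ (r i)
  let φ : (Σ i, Fin (s i)) → K := fun x => τ^[(x.2 : ℕ)] (r x.1)
  have hclass : ∀ x, ε (Quotient.mk st (φ x)) = x.1 := fun x => by
    rw [← hr x.1]
    congr 1
    refine Quotient.sound (s := st) (Equiv.Perm.SameCycle.symm ⟨(x.2 : ℕ), ?_⟩)
    rw [zpow_natCast, ← Equiv.Perm.iterate_eq_pow]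
  have hbij : Function.Bijective φ := by
    constructor
    · rintro ⟨i, j⟩ ⟨i', j'⟩ h
      obtain rfl : i = i' :=
        (hclass ⟨i, j⟩).symm.trans ((congrArg (fun k => ε (Quotient.mk st k)) h).trans
          (hclass ⟨i', j'⟩))
      refine congrArg (Sigma.mk i) (Fin.ext ?_)
      exact (Function.iterate_eq_iterate_iff_of_lt_minimalPeriod j.2 j'.2).1 h
    · intro k
      have h1 : st (r (ε (Quotient.mk st k))) k := by
        refine Quotient.exact (s := st) ?_
        rw [Quotient.out_eq, Equiv.symm_apply_apply]
      obtain ⟨t, ht⟩ := Equiv.Perm.SameCycle.exists_nat_pow_eq h1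
      refine ⟨⟨ε (Quotient.mk st k), ⟨t % s _, Nat.mod_lt _ (hpos _)⟩⟩, ?_⟩
      change τ^[t % Function.minimalPeriod τ _] _ = k
      rw [Function.iterate_mod_minimalPeriod_eq, Equiv.Perm.iterate_eq_pow]
      exact ht
  refine ⟨m, s, Equiv.ofBijective φ hbij, fun i => hpos _, fun i j => ?_⟩
  change τ^[((finRotate _ j : Fin _) : ℕ)] (r i) = τ (τ^[(j : ℕ)] (r i))
  rw [LineSystem.val_finRotate, Function.iterate_mod_minimalPeriod_eq, Function.iterate_succ_apply']

/-- A surface is given by the permutation of its sides which leads along the boundaries of the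
disks, together with the pairing. -/
theorem exists_sidePairing {K : Type*} [Finite K] (τ : Equiv.Perm K) (pair : K → K)
    (flip : K → Bool) (hne : ∀ k, pair k ≠ k) (hpair : ∀ k, pair (pair k) = k)
    (hflip : ∀ k, flip (pair k) = flip k) :
    ∃ (S : SidePairing) (φ : S.Side ≃ K), (∀ s, φ (S.next s) = τ (φ s)) ∧
      (∀ s, φ (S.pair s) = pair (φ s)) ∧ ∀ s, S.flip s = flip (φ s) := by
  obtain ⟨m, s, φ, hs, hφ⟩ := exists_orbit_enumeration τ
  refine ⟨⟨m, s, hs, fun k => φ.symm (pair (φ k)), fun k h => hne (φ k) ?_, fun k => ?_,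
    fun k => flip (φ k), fun k => ?_⟩, φ, fun k => hφ k.1 k.2, fun k => ?_, fun k => rfl⟩
  · rw [← φ.apply_symm_apply (pair (φ k)), h]
  · rw [φ.apply_symm_apply, hpair, φ.symm_apply_apply]
  · rw [φ.apply_symm_apply, hflip]
  · exact φ.apply_symm_apply _

/-- Fibres of equal size are matched by bijections. The fibre over `t₀` needs no hypothesis because
both totals are the size of `I`. -/
theorem exists_perm_of_card_fiber {I T : Type*} [Fintype I] [DecidableEq T] (p q : I → T) (t₀ : T)
    (h : ∀ t, t ≠ t₀ → (Finset.univ.filter fun i => p i = t).card =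
      (Finset.univ.filter fun i => q i = t).card) :
    ∃ φ : Equiv.Perm I, ∀ i, q (φ i) = p i := by
  classical
  let A : Finset T := insert t₀ (Finset.univ.image p ∪ Finset.univ.image q)
  have hp : Fintype.card I = ∑ t ∈ A, (Finset.univ.filter fun i => p i = t).card :=
    Finset.card_eq_sum_card_fiberwise fun i _ => by simp [A]
  have hq : Fintype.card I = ∑ t ∈ A, (Finset.univ.filter fun i => q i = t).card :=
    Finset.card_eq_sum_card_fiberwise fun i _ => by simp [A]
  have hmem : t₀ ∈ A := Finset.mem_insert_self _ _
  rw [← Finset.add_sum_erase _ _ hmem] at hp hq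
  have h1 : ∑ t ∈ A.erase t₀, (Finset.univ.filter fun i => p i = t).card =
      ∑ t ∈ A.erase t₀, (Finset.univ.filter fun i => q i = t).card :=
    Finset.sum_congr rfl fun t ht => h t (Finset.mem_erase.1 ht).1
  have h2 : ∀ t, Fintype.card {i // p i = t} = Fintype.card {i // q i = t} := by
    intro t
    rw [Fintype.card_subtype, Fintype.card_subtype]
    by_cases ht : t = t₀
    · subst ht
      omega
    · exact h t ht
  exact ⟨Equiv.ofFiberEquiv fun t => Fintype.equivOfCardEq (h2 t), Equiv.ofFiberEquiv_map _⟩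

end Enumeration

/-! ### A surface from a balanced family of cycles -/

section Families

variable {n : ℕ} {E : Type*} [DecidableEq E]

/-- The edges of `F` at the letter `v`. -/
def LineSystem.edgesAt (D : LineSystem n E) (F : Finset E) (v : Fin n × Bool) : Finset E :=
  F.filter fun e => D.tl e = v ∨ D.hd e = v

/-- A balanced family of cycles of the Whitehead graph. -/
structure CycleFamily (D : LineSystem n E) (I : Type*) [Fintype I] where
  edges : I → Finset E
  card_edgesAt : ∀ i v, (D.edgesAt (edges i) v).card = 0 ∨ (D.edgesAt (edges i) v).card = 2
  connected : ∀ i (Q : E → Prop), (∀ v, ∀ e ∈ D.edgesAt (edges i) v,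
    ∀ f ∈ D.edgesAt (edges i) v, Q e → Q f) → ∀ e ∈ edges i, ∀ f ∈ edges i, Q e → Q f
  balanced : ∀ v e f, (D.tl e = v ∨ D.hd e = v) → (D.tl f = v ∨ D.hd f = v) → e ≠ f →
    (Finset.univ.filter fun i => e ∈ edges i ∧ f ∈ edges i).card =
      (Finset.univ.filter fun i => D.glue v e ∈ edges i ∧ D.glue v f ∈ edges i).card

namespace CycleFamily

variable {D : LineSystem n E} {I : Type*} [Fintype I] (F : CycleFamily D I)

/-- The edges of the `i`-th cycle at the letter `v`. -/
def at' (i : I) (v : Fin n × Bool) : Finset E := D.edgesAt (F.edges i) v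

variable {F} in
theorem mem_at {i : I} {v : Fin n × Bool} {e : E} :
    e ∈ F.at' i v ↔ e ∈ F.edges i ∧ (D.tl e = v ∨ D.hd e = v) := Finset.mem_filter

theorem eq_pair_of_mem {i : I} {v : Fin n × Bool} {e f : E} (he : e ∈ F.at' i v)
    (hf : f ∈ F.at' i v) (hef : e ≠ f) : F.at' i v = {e, f} := by
  refine (Finset.eq_of_subset_of_card_le ?_ ?_).symm
  · intro x hx
    rcases Finset.mem_insert.1 hx with rfl | hx
    · exact he
    · rwa [Finset.mem_singleton.1 hx]
  · rw [Finset.card_pair hef]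
    rcases F.card_edgesAt i v with h | h
    · exact (le_of_eq h).trans (Nat.zero_le 2)
    · exact le_of_eq h

theorem exists_pair_of_nonempty {i : I} {v : Fin n × Bool} (h : F.at' i v ≠ ∅) :
    ∃ e f, e ≠ f ∧ F.at' i v = {e, f} := by
  rcases F.card_edgesAt i v with h0 | h0
  · exact absurd (Finset.card_eq_zero.1 h0) h
  · exact Finset.card_eq_two.1 h0

/-- A cycle has a pair of edges at `v` or none. By balance, each pair at `v` occurs in as many
cycles as the glued pair at the inverse; the cycles avoiding the letter form the exceptional fibre
over `∅`. -/
theorem exists_match_aux (v : Fin n × Bool) : ∃ φ : Equiv.Perm I, ∀ i,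
    F.at' (φ i) (letterInv v) = (F.at' i v).image (D.glue v) := by
  refine exists_perm_of_card_fiber (fun i => (F.at' i v).image (D.glue v))
    (fun i => F.at' i (letterInv v)) ∅ fun t ht => ?_
  by_cases hp : ∃ e f, (D.tl e = v ∨ D.hd e = v) ∧ (D.tl f = v ∨ D.hd f = v) ∧ e ≠ f ∧
      t = {D.glue v e, D.glue v f}
  · obtain ⟨e, f, he, hf, hef, rfl⟩ := hp
    have hgef : D.glue v e ≠ D.glue v f := fun h => hef (D.eq_of_glue_eq he hf h)
    have h1 : ∀ i, (F.at' i v).image (D.glue v) = {D.glue v e, D.glue v f} ↔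
        e ∈ F.edges i ∧ f ∈ F.edges i := by
      intro i
      constructor
      · intro h
        have key : ∀ g, (D.tl g = v ∨ D.hd g = v) → D.glue v g ∈ (F.at' i v).image (D.glue v) →
            g ∈ F.edges i := by
          intro g hg hm
          obtain ⟨g', hg', hgg⟩ := Finset.mem_image.1 hm
          rw [mem_at] at hg'
          rw [D.eq_of_glue_eq hg hg'.2 hgg.symm]
          exact hg'.1
        exact ⟨key e he (by rw [h]; simp), key f hf (by rw [h]; simp)⟩
      · rintro ⟨h1, h2⟩
        rw [F.eq_pair_of_mem (mem_at.2 ⟨h1, he⟩) (mem_at.2 ⟨h2, hf⟩) hef]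
        simp [Finset.image_insert]
    have h2 : ∀ i, F.at' i (letterInv v) = {D.glue v e, D.glue v f} ↔
        D.glue v e ∈ F.edges i ∧ D.glue v f ∈ F.edges i := by
      intro i
      constructor
      · intro h
        have h3 : D.glue v e ∈ F.at' i (letterInv v) := by rw [h]; simp
        have h4 : D.glue v f ∈ F.at' i (letterInv v) := by rw [h]; simp
        exact ⟨(mem_at.1 h3).1, (mem_at.1 h4).1⟩
      · rintro ⟨h1, h2⟩
        exact F.eq_pair_of_mem (mem_at.2 ⟨h1, D.glue_mem he⟩) (mem_at.2 ⟨h2, D.glue_mem hf⟩) hgef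
    simp only [h1, h2]
    exact F.balanced v e f he hf hef
  · have h1 : ∀ i, (F.at' i v).image (D.glue v) ≠ t := by
      rintro i rfl
      obtain ⟨e, f, hef, h⟩ := F.exists_pair_of_nonempty (i := i) (v := v) (fun h => ht (by
        rw [h, Finset.image_empty]))
      have he : e ∈ F.at' i v := by rw [h]; simp
      have hf : f ∈ F.at' i v := by rw [h]; simp
      refine hp ⟨e, f, (mem_at.1 he).2, (mem_at.1 hf).2, hef, ?_⟩
      rw [h]
      simp [Finset.image_insert]
    have h2 : ∀ i, F.at' i (letterInv v) ≠ t := by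
      rintro i rfl
      obtain ⟨e, f, hef, h⟩ := F.exists_pair_of_nonempty ht
      have he : e ∈ F.at' i (letterInv v) := by rw [h]; simp
      have hf : f ∈ F.at' i (letterInv v) := by rw [h]; simp
      have he' := D.glue_mem (mem_at.1 he).2
      have hf' := D.glue_mem (mem_at.1 hf).2
      have hee := D.glue_glue (mem_at.1 he).2
      have hff := D.glue_glue (mem_at.1 hf).2
      rw [letterInv_letterInv] at he' hf' hee hff
      refine hp ⟨_, _, he', hf', fun h' => hef ?_, ?_⟩
      · rw [← hee, h', hff]
      · rw [hee, hff, h]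
    rw [Finset.filter_false_of_mem fun i _ => h1 i, Finset.filter_false_of_mem fun i _ => h2 i]

/-- A matching of the cycles through each letter with those through its inverse. -/
structure Matching where
  perm : Fin n × Bool → Equiv.Perm I
  perm_inv : ∀ v i, perm (letterInv v) (perm v i) = i
  at_perm : ∀ v i, F.at' (perm v i) (letterInv v) = (F.at' i v).image (D.glue v)

/-- Choosing permutations for the positive letters and their inverses for the negative ones makes
the choices compatible. -/
theorem exists_matching : Nonempty F.Matching := by
  choose φ hφ using F.exists_match_aux
  refine ⟨⟨fun v => if v.2 then φ (v.1, true) else (φ (v.1, true))⁻¹, ?_, ?_⟩⟩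
  · rintro ⟨j, _ | _⟩ i
    · exact (φ (j, true)).apply_symm_apply i
    · exact (φ (j, true)).symm_apply_apply i
  · rintro ⟨j, _ | _⟩ i
    · obtain ⟨i, rfl⟩ := (φ (j, true)).surjective i
      have h1 := hφ (j, true) i
      change F.at' ((φ (j, true))⁻¹ (φ (j, true) i)) (j, true) = _
      rw [show (φ (j, true))⁻¹ (φ (j, true) i) = i from (φ (j, true)).symm_apply_apply i]
      change F.at' _ (j, false) = _ at h1
      rw [h1, Finset.image_image]
      refine Eq.trans Finset.image_id.symm (Finset.image_congr fun e he => ?_)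
      exact (D.glue_glue (mem_at.1 (Finset.mem_coe.1 he)).2).symm
    · exact hφ (j, true) i

open Classical in
/-- The other edge of the `i`-th cycle at the letter `v`. -/
noncomputable def other (i : I) (v : Fin n × Bool) (e : E) : E :=
  if h : ∃ f ∈ F.at' i v, f ≠ e then h.choose else e

theorem other_spec {i : I} {v : Fin n × Bool} {e : E} (he : e ∈ F.at' i v) :
    F.other i v e ∈ F.at' i v ∧ F.other i v e ≠ e := by
  have h : ∃ f ∈ F.at' i v, f ≠ e := by
    obtain ⟨a, b, hab, h⟩ := F.exists_pair_of_nonempty (i := i) (v := v) (fun h0 => by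
      rw [h0] at he
      exact Finset.notMem_empty e he)
    have ha : a ∈ F.at' i v := by rw [h]; simp
    have hb : b ∈ F.at' i v := by rw [h]; simp
    by_cases hae : a = e
    · exact ⟨b, hb, fun hbe => hab (hae.trans hbe.symm)⟩
    · exact ⟨a, ha, hae⟩
  rw [other, dif_pos h]
  exact h.choose_spec

theorem eq_or_eq_other {i : I} {v : Fin n × Bool} {e f : E} (he : e ∈ F.at' i v)
    (hf : f ∈ F.at' i v) : f = e ∨ f = F.other i v e := by
  obtain ⟨h1, h2⟩ := F.other_spec he
  have h3 := F.eq_pair_of_mem he h1 h2.symm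
  rw [h3] at hf
  simpa using hf

theorem eq_other {i : I} {v : Fin n × Bool} {e f : E} (he : e ∈ F.at' i v)
    (hf : f ∈ F.at' i v) (hne : f ≠ e) : f = F.other i v e :=
  (F.eq_or_eq_other he hf).resolve_left hne

theorem other_other {i : I} {v : Fin n × Bool} {e : E} (he : e ∈ F.at' i v) :
    F.other i v (F.other i v e) = e := by
  obtain ⟨h1, h2⟩ := F.other_spec he
  exact (F.eq_other h1 he h2.symm).symm

/-- The corners of the surface: the edges of the cycles. -/
abbrev Corner : Type _ := {x : I × E // x.2 ∈ F.edges x.1}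

namespace Matching

variable {F} (Φ : F.Matching)

theorem glue_mem_at {i : I} {v : Fin n × Bool} {e : E} (he : e ∈ F.at' i v) :
    D.glue v e ∈ F.at' (Φ.perm v i) (letterInv v) := by
  rw [Φ.at_perm]
  exact Finset.mem_image_of_mem _ he

theorem hd_mem_at (k : F.Corner) : k.1.2 ∈ F.at' k.1.1 (D.hd k.1.2) := mem_at.2 ⟨k.2, Or.inr rfl⟩

theorem tl_mem_at (k : F.Corner) : k.1.2 ∈ F.at' k.1.1 (D.tl k.1.2) := mem_at.2 ⟨k.2, Or.inl rfl⟩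

theorem other_glue {i : I} {v : Fin n × Bool} {e : E} (he : e ∈ F.at' i v) :
    F.other (Φ.perm v i) (letterInv v) (D.glue v e) = D.glue v (F.other i v e) := by
  obtain ⟨h1, h2⟩ := F.other_spec he
  refine (F.eq_other (Φ.glue_mem_at he) (Φ.glue_mem_at h1) fun h => h2 ?_).symm
  exact D.eq_of_glue_eq (mem_at.1 h1).2 (mem_at.1 he).2 h

/-- The next corner on the boundary of a disk. -/
def turn : Equiv.Perm F.Corner where
  toFun k := ⟨(Φ.perm (D.hd k.1.2) k.1.1, D.nxt k.1.2), by
    have h := Φ.glue_mem_at (hd_mem_at k)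
    rw [D.glue_hd] at h
    exact (mem_at.1 h).1⟩
  invFun k := ⟨(Φ.perm (D.tl k.1.2) k.1.1, D.nxt.symm k.1.2), by
    have h := Φ.glue_mem_at (tl_mem_at k)
    rw [D.glue_tl] at h
    exact (mem_at.1 h).1⟩
  left_inv k := by
    refine Subtype.ext (Prod.ext ?_ ?_)
    · simp only [D.tl_nxt, Φ.perm_inv]
    · exact D.nxt.symm_apply_apply _
  right_inv k := by
    refine Subtype.ext (Prod.ext ?_ ?_)
    · simp only [D.hd_nxt_symm, Φ.perm_inv]
    · exact D.nxt.apply_symm_apply _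

theorem turn_apply (k : F.Corner) :
    (Φ.turn k).1 = (Φ.perm (D.hd k.1.2) k.1.1, D.nxt k.1.2) := rfl

/-- The side paired with the side starting at the corner `k`. -/
noncomputable def pair (k : F.Corner) : F.Corner :=
  if D.hd (F.other k.1.1 (D.hd k.1.2) k.1.2) = D.hd k.1.2 then
    ⟨(k.1.1, F.other k.1.1 (D.hd k.1.2) k.1.2), (mem_at.1 (F.other_spec (hd_mem_at k)).1).1⟩
  else ⟨(Φ.perm (D.hd k.1.2) k.1.1, D.glue (D.hd k.1.2) (F.other k.1.1 (D.hd k.1.2) k.1.2)),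
    (mem_at.1 (Φ.glue_mem_at (F.other_spec (hd_mem_at k)).1)).1⟩

/-- Whether the side starting at the corner `k` is glued with a flip. -/
noncomputable def flip (k : F.Corner) : Bool :=
  !decide (D.hd (F.other k.1.1 (D.hd k.1.2) k.1.2) = D.hd k.1.2)

/-- The corner at an end of a side. -/
def cornerAt (h : F.Corner × Bool) : F.Corner := if h.2 then Φ.turn h.1 else h.1

variable (F) in
/-- The letter read when leaving an end of a side. -/
def letterAt (h : F.Corner × Bool) : Fin n × Bool :=
  if h.2 then letterInv (D.hd h.1.1.2) else D.hd h.1.1.2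

/-- The end of a side that is glued to a given one. -/
noncomputable def oppAt (h : F.Corner × Bool) : F.Corner × Bool :=
  (Φ.pair h.1, xor h.2 (flip h.1))

theorem mem_at_letterAt (h : F.Corner × Bool) :
    (Φ.cornerAt h).1.2 ∈ F.at' (Φ.cornerAt h).1.1 (letterAt F h) := by
  refine mem_at.2 ⟨(Φ.cornerAt h).2, ?_⟩
  obtain ⟨k, _ | _⟩ := h
  · exact Or.inr rfl
  · exact Or.inl (D.tl_nxt _)

/-- The two side-ends at a corner leave along the two ends of its Whitehead edge, which are
different letters. -/
theorem eq_of_cornerAt_eq {h h' : F.Corner × Bool} (h1 : Φ.cornerAt h = Φ.cornerAt h')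
    (h2 : letterAt F h = letterAt F h') : h = h' := by
  obtain ⟨k, b⟩ := h
  obtain ⟨k', b'⟩ := h'
  cases b <;> cases b'
  · exact Prod.ext h1 rfl
  · exfalso
    change k = Φ.turn k' at h1
    change D.hd k.1.2 = letterInv (D.hd k'.1.2) at h2
    rw [h1, turn_apply] at h2
    exact D.hd_nxt_ne _ h2
  · exfalso
    change Φ.turn k = k' at h1
    change letterInv (D.hd k.1.2) = D.hd k'.1.2 at h2
    rw [← h1, turn_apply] at h2
    exact D.hd_nxt_ne _ h2.symm
  · exact Prod.ext (Φ.turn.injective h1) rfl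

theorem exists_end {k : F.Corner} {v : Fin n × Bool} (hk : k.1.2 ∈ F.at' k.1.1 v) :
    ∃ h, Φ.cornerAt h = k ∧ letterAt F h = v := by
  rcases (mem_at.1 hk).2 with rfl | rfl
  · refine ⟨(Φ.turn.symm k, true), Φ.turn.apply_symm_apply k, ?_⟩
    change letterInv (D.hd (D.nxt.symm k.1.2)) = _
    rw [D.hd_nxt_symm, letterInv_letterInv]
  · exact ⟨(k, false), rfl, rfl⟩

theorem tl_other_of_hd_ne {k : F.Corner}
    (h : ¬ D.hd (F.other k.1.1 (D.hd k.1.2) k.1.2) = D.hd k.1.2) :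
    D.tl (F.other k.1.1 (D.hd k.1.2) k.1.2) = D.hd k.1.2 :=
  ((mem_at.1 (F.other_spec (hd_mem_at k)).1).2).resolve_right h

theorem letterAt_oppAt (h : F.Corner × Bool) : letterAt F (Φ.oppAt h) = letterAt F h := by
  obtain ⟨k, b⟩ := h
  have hne := tl_other_of_hd_ne (k := k)
  simp only [letterAt, oppAt, pair, flip]
  by_cases hf : D.hd (F.other k.1.1 (D.hd k.1.2) k.1.2) = D.hd k.1.2
  · simp only [hf, if_true, decide_true, Bool.not_true, Bool.xor_false]
  · have h1 : D.glue (D.hd k.1.2) (F.other k.1.1 (D.hd k.1.2) k.1.2) =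
        D.nxt.symm (F.other k.1.1 (D.hd k.1.2) k.1.2) := if_neg hf
    simp only [hf, if_false, decide_false, Bool.not_false, Bool.xor_true, h1, D.hd_nxt_symm, hne hf,
      letterInv_letterInv]
    cases b <;> rfl

/-- Gluing leads to the other corner of the same cycle at the letter, so each cycle closes up around
a vertex of the surface. At the far end of a side this works because the matching commutes with
passing to the other edge (`other_glue`). -/
theorem cornerAt_oppAt (h : F.Corner × Bool) : (Φ.cornerAt (Φ.oppAt h)).1 =
    ((Φ.cornerAt h).1.1, F.other (Φ.cornerAt h).1.1 (letterAt F h) (Φ.cornerAt h).1.2) := by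
  obtain ⟨k, b⟩ := h
  have hne := tl_other_of_hd_ne (k := k)
  by_cases hf : D.hd (F.other k.1.1 (D.hd k.1.2) k.1.2) = D.hd k.1.2
  · have hpair : (Φ.pair k).1 = (k.1.1, F.other k.1.1 (D.hd k.1.2) k.1.2) := by
      rw [pair, if_pos hf]
    have hflip : flip k = false := by simp [flip, hf]
    cases b
    · simp only [oppAt, hflip, cornerAt, letterAt, Bool.xor_false, Bool.false_eq_true, if_false,
        hpair]
    · simp only [oppAt, hflip, cornerAt, letterAt, Bool.xor_false, if_true, turn_apply, hpair]
      have h1 := Φ.other_glue (hd_mem_at k)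
      rw [D.glue_hd] at h1
      rw [h1, hf]
      refine Prod.ext rfl ?_
      exact (if_pos hf).symm
  · have h1 : D.glue (D.hd k.1.2) (F.other k.1.1 (D.hd k.1.2) k.1.2) =
        D.nxt.symm (F.other k.1.1 (D.hd k.1.2) k.1.2) := if_neg hf
    have hpair : (Φ.pair k).1 = (Φ.perm (D.hd k.1.2) k.1.1,
        D.glue (D.hd k.1.2) (F.other k.1.1 (D.hd k.1.2) k.1.2)) := by
      rw [pair, if_neg hf]
    have hflip : flip k = true := by simp [flip, hf]
    cases b
    · simp only [oppAt, hflip, cornerAt, letterAt, Bool.xor_true, Bool.not_false, if_true,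
        Bool.false_eq_true, if_false, turn_apply, hpair, h1, D.hd_nxt_symm, hne hf, Φ.perm_inv,
        Equiv.apply_symm_apply]
    · simp only [oppAt, hflip, cornerAt, letterAt, Bool.xor_true, Bool.not_true,
        Bool.false_eq_true, if_false, if_true, turn_apply, hpair]
      have h2 := Φ.other_glue (hd_mem_at k)
      rw [D.glue_hd] at h2
      rw [h2]

/-- A side-end is determined by its corner and its letter, and passing twice to the other edge of a
pair returns to the first. -/
theorem oppAt_oppAt (h : F.Corner × Bool) : Φ.oppAt (Φ.oppAt h) = h := by
  refine Φ.eq_of_cornerAt_eq (Subtype.ext ?_) ?_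
  · rw [cornerAt_oppAt, letterAt_oppAt, cornerAt_oppAt]
    exact Prod.ext rfl (F.other_other (Φ.mem_at_letterAt h))
  · rw [letterAt_oppAt, letterAt_oppAt]

theorem pair_pair (k : F.Corner) : Φ.pair (Φ.pair k) = k :=
  congrArg Prod.fst (Φ.oppAt_oppAt (k, false))

theorem flip_pair (k : F.Corner) : flip (Φ.pair k) = flip k := by
  have h : xor (xor false (flip k)) (flip (Φ.pair k)) = false :=
    congrArg Prod.snd (Φ.oppAt_oppAt (k, false))
  revert h
  cases flip k <;> cases flip (Φ.pair k) <;> simp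

theorem pair_ne (k : F.Corner) : Φ.pair k ≠ k := by
  intro h
  have h1 : Φ.oppAt (k, false) = (k, flip k) := by
    simp only [oppAt, h, Bool.false_xor]
  cases hf : flip k with
  | false =>
    have h2 := Φ.cornerAt_oppAt (k, false)
    rw [h1, hf] at h2
    exact (F.other_spec (hd_mem_at k)).2 (congrArg Prod.snd h2).symm
  | true =>
    have h2 := Φ.letterAt_oppAt (k, false)
    rw [h1, hf] at h2
    exact letterInv_ne _ h2

end Matching

theorem card_lt_card_edges (hne : ∀ i, (F.edges i).Nonempty) (hbig : ∃ i, 2 < (F.edges i).card) :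
    2 * Fintype.card I < ∑ i, (F.edges i).card := by
  have h2 : ∀ i, 2 ≤ (F.edges i).card := by
    intro i
    obtain ⟨e, he⟩ := hne i
    have h1 : e ∈ F.at' i (D.hd e) := mem_at.2 ⟨he, Or.inr rfl⟩
    obtain ⟨h3, h4⟩ := F.other_spec h1
    exact Finset.one_lt_card.2 ⟨_, (mem_at.1 h3).1, e, he, h4⟩
  obtain ⟨i, hi⟩ := hbig
  have h3 := Finset.sum_lt_sum (fun i (_ : i ∈ Finset.univ) => h2 i) ⟨i, Finset.mem_univ i, hi⟩
  rwa [Finset.sum_const, smul_eq_mul, mul_comm] at h3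

/-- A balanced family of cycles, not all of length two, yields a surface. -/
theorem exists_surface [Finite E] (hne : ∀ i, (F.edges i).Nonempty)
    (hbig : ∃ i, 2 < (F.edges i).card) :
    ∃ (S : SidePairing) (ℓ : S.Side → Fin n × Bool) (c : S.Side → E), IsGraphMap S ℓ ∧
      IsLocallyInjective S ℓ ∧ (∀ s, D.hd (c s) = ℓ s) ∧ (∀ s, c (S.next s) = D.nxt (c s)) ∧
      S.eulerChar < S.m := by
  classical
  obtain ⟨Φ⟩ := F.exists_matching
  obtain ⟨S, φ, hnext, hpair, hflip⟩ := exists_sidePairing Φ.turn Φ.pair Matching.flip Φ.pair_ne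
    Φ.pair_pair Φ.flip_pair
  let ℓ : S.Side → Fin n × Bool := fun s => D.hd (φ s).1.2
  let ψ : S.SideEnd → F.Corner × Bool := fun h => (φ h.1, h.2)
  have hψ : ∀ h h', ψ h = ψ h' → h = h' := fun h h' hh =>
    Prod.ext (φ.injective (congrArg Prod.fst hh)) (congrArg (fun x => x.2) hh)
  have hψs : ∀ h, ∃ h', ψ h' = h := fun h =>
    ⟨(φ.symm h.1, h.2), Prod.ext (φ.apply_symm_apply _) rfl⟩
  have hcorner : ∀ h, φ (S.corner h) = Φ.cornerAt (ψ h) := by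
    rintro ⟨s, _ | _⟩
    · rfl
    · exact hnext s
  have hopp : ∀ h, ψ (S.opp h) = Φ.oppAt (ψ h) := fun h =>
    Prod.ext (hpair h.1) (congrArg (xor h.2) (hflip h.1))
  have hout : ∀ h, outLetter S ℓ h = Matching.letterAt F (ψ h) := by
    rintro ⟨s, _ | _⟩ <;> rfl
  -- As each cycle is connected, all its corners meet in one vertex of the surface.
  have hcard : Nat.card S.Vertex ≤ Fintype.card I := by
    have hval : ∀ s t : S.Side, (φ s).1.1 = (φ t).1.1 →
        (Quot.mk _ s : S.Vertex) = Quot.mk _ t := by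
      intro s t hst
      have key := F.connected (φ s).1.1 (fun e => ∀ t : S.Side, (φ t).1 = ((φ s).1.1, e) →
        (Quot.mk _ s : S.Vertex) = Quot.mk _ t) ?_ (φ s).1.2 (φ s).2 (φ t).1.2
        (by rw [hst]; exact (φ t).2) ?_
      · exact key t (Prod.ext hst.symm rfl)
      · intro v e he f hf hQ t ht
        have he' : e ∈ F.at' (φ s).1.1 v := he
        have hf' : f ∈ F.at' (φ s).1.1 v := hf
        rcases F.eq_or_eq_other he' hf' with rfl | hfe
        · exact hQ t ht
        obtain ⟨h0, h1, h2⟩ := Φ.exists_end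
          (k := ⟨((φ s).1.1, e), (mem_at.1 he').1⟩) he'
        obtain ⟨h, rfl⟩ := hψs h0
        rw [← hcorner] at h1
        have h3 := hQ (S.corner h) (by rw [h1])
        have h4 : t = S.corner (S.opp h) := by
          refine φ.injective (Subtype.ext ?_)
          rw [hcorner, hopp, Φ.cornerAt_oppAt, ← hcorner, h1, h2, ht, hfe]
        rw [h3, h4]
        exact Quot.sound ⟨h, rfl, rfl⟩
      · intro t ht
        rw [φ.injective (Subtype.ext ht : φ t = φ s)]
    have : ∀ p : S.Vertex, ∃ s : S.Side, (Quot.mk _ s : S.Vertex) = p := Quot.exists_rep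
    choose r hr using this
    rw [← Nat.card_eq_fintype_card]
    refine Nat.card_le_card_of_injective (fun p => (φ (r p)).1.1) fun p q hpq => ?_
    rw [← hr p, ← hr q]
    exact hval _ _ hpq
  refine ⟨S, ℓ, fun s => (φ s).1.2, ?_, ?_, fun s => rfl, fun s => ?_, ?_⟩
  · intro s
    have h1 := Φ.letterAt_oppAt (ψ (s, false))
    rw [← hopp, ← hout, ← hout] at h1
    have h2 : outLetter S ℓ (S.opp (s, false)) =
      if S.flip s then letterInv (ℓ (S.pair s)) else ℓ (S.pair s) := by
      simp only [outLetter, SidePairing.opp, Bool.false_xor]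
    rw [h2] at h1
    change _ = ℓ s at h1
    rw [← h1]
    cases S.flip s <;> simp
  -- Conversely all corners at a vertex belong to one cycle, which has only two edges at a given
  -- letter.
  · intro h h' hv hl
    have hidx : (φ (S.corner h')).1.1 = (φ (S.corner h)).1.1 := by
      refine S.of_vertex_eq (Q := fun s => (φ s).1.1 = (φ (S.corner h)).1.1) ?_ hv rfl
      intro k hk
      rw [hcorner, hopp, Φ.cornerAt_oppAt, ← hcorner]
      exact hk
    rw [hout, hout] at hl
    have h1 := Φ.mem_at_letterAt (ψ h)
    have h2 := Φ.mem_at_letterAt (ψ h')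
    rw [hcorner, hcorner] at hidx
    rw [← hl, hidx] at h2
    rcases F.eq_or_eq_other h1 h2 with h3 | h3
    · left
      exact (hψ _ _ (Φ.eq_of_cornerAt_eq (Subtype.ext (Prod.ext hidx.symm h3.symm)) hl)).symm
    · right
      refine hψ _ _ (Φ.eq_of_cornerAt_eq (Subtype.ext ?_) ?_)
      · rw [hopp, Φ.cornerAt_oppAt]
        exact Prod.ext hidx h3
      · rw [hopp, Φ.letterAt_oppAt, hl]
  · change (φ (S.next s)).1.2 = _
    rw [hnext]
    rfl
  -- The sides are as many as the edges of all cycles together, more than twice the number of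
  -- cycles, so there are more edges than vertices in the surface.
  · have := Fintype.ofFinite E
    have h1 : Nat.card S.Side = ∑ i, (F.edges i).card := by
      rw [Nat.card_congr φ, Nat.card_eq_fintype_card,
        Fintype.card_congr (Equiv.subtypeProdEquivSigmaSubtype fun (i : I) (e : E) =>
          e ∈ F.edges i), Fintype.card_sigma]
      exact Finset.sum_congr rfl fun i _ => Fintype.card_coe _
    have h2 := F.card_lt_card_edges hne hbig
    rw [← h1, S.card_side] at h2
    rw [SidePairing.eulerChar]
    omega

end CycleFamily

end Families

open scoped Graph

/-! ### Boundary words, and tilings from cycles -/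

section BoundaryWords

namespace LineSystem

variable {n : ℕ} {E : Type*} (D : LineSystem n E)

theorem rotate_read {m : ℕ} {e : E} (hm : (D.nxt ^ m) e = e) (r : ℕ) :
    (D.read m e).rotate r = D.read m ((D.nxt ^ r) e) := by
  refine List.ext_getElem (by simp [length_read]) fun t h1 h2 => ?_
  have hfix : ∀ q, (D.nxt ^ (m * q)) e = e := fun q => by
    rw [pow_mul]
    exact Function.IsFixedPt.perm_pow hm q
  rw [List.getElem_rotate]
  simp only [read, List.getElem_map, List.getElem_range, List.length_map, List.length_range]
  rw [← Equiv.Perm.mul_apply, ← pow_add]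
  conv_rhs => rw [← Nat.mod_add_div (t + r) m, pow_add, Equiv.Perm.mul_apply, hfix]

end LineSystem

variable {n : ℕ} {U : List (FreeGroup (Fin n))}
  {hU : ∀ u ∈ U, FreeGroup.IsCyclicallyReduced u.toWord}

/-- The run around a disk returns to its starting position, so the number of sides is a multiple of
the length of the word it follows. Starting elsewhere than at the first letter only rotates the
power. -/
theorem exists_boundaryWord_isRotated {S : SidePairing} {ℓ : S.Side → Fin n × Bool}
    {c : S.Side → Position U} (hc : ∀ s, (positionSystem U hU).hd (c s) = ℓ s)
    (hnext : ∀ s, c (S.next s) = (positionSystem U hU).nxt (c s)) (i : Fin S.m) :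
    ∃ u ∈ U, ∃ k : ℤ, k ≠ 0 ∧ List.IsRotated (boundaryWord S ℓ i) (u ^ k).toWord := by
  set D := positionSystem U hU
  have hpos := S.sides_pos i
  let z : Fin (S.sides i) := ⟨0, hpos⟩
  have hrun : ∀ (t : ℕ) (ht : t < S.sides i), c ⟨i, ⟨t, ht⟩⟩ = (D.nxt ^ t) (c ⟨i, z⟩) := by
    intro t
    induction t with
    | zero => intro _; rfl
    | succ t ih =>
      intro ht
      have h1 : (⟨i, ⟨t + 1, ht⟩⟩ : S.Side) = S.next ⟨i, ⟨t, by omega⟩⟩ := by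
        refine congrArg (Sigma.mk i) (Fin.ext ?_)
        rw [LineSystem.val_finRotate]
        exact (Nat.mod_eq_of_lt ht).symm
      rw [h1, hnext, ih, pow_succ', Equiv.Perm.mul_apply]
  have hclosed : (D.nxt ^ S.sides i) (c ⟨i, z⟩) = c ⟨i, z⟩ := by
    obtain ⟨m, hm⟩ : ∃ m, S.sides i = m + 1 := ⟨S.sides i - 1, by omega⟩
    have h1 : (⟨i, z⟩ : S.Side) = S.next ⟨i, ⟨m, by omega⟩⟩ := by
      refine congrArg (Sigma.mk i) (Fin.ext ?_)
      rw [LineSystem.val_finRotate]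
      simp [z, hm]
    conv_rhs => rw [h1, hnext, hrun]
    rw [hm, pow_succ', Equiv.Perm.mul_apply]
  have hword : boundaryWord S ℓ i = D.read (S.sides i) (c ⟨i, z⟩) := by
    refine List.ext_getElem (by simp [boundaryWord, LineSystem.length_read]) fun t h1 h2 => ?_
    rw [LineSystem.length_read] at h2
    simp only [boundaryWord, List.getElem_ofFn, LineSystem.read, List.getElem_map,
      List.getElem_range]
    rw [← hc, hrun t h2]
  rw [hword]
  generalize c ⟨i, z⟩ = e at hclosed
  clear_value z
  generalize S.sides i = m at hclosed hpos
  obtain ⟨k, j⟩ := e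
  let z' : Fin (U.get k).toWord.length := ⟨0, j.pos⟩
  have hj : (⟨k, j⟩ : Position U) = (D.nxt ^ (j : ℕ)) ⟨k, z'⟩ := by
    rw [positionSystem_nxt_pow]
    refine congrArg (Sigma.mk k) (Fin.ext ?_)
    simp only [z', zero_add]
    exact (Nat.mod_eq_of_lt j.2).symm
  have hfix : (D.nxt ^ (U.get k).toWord.length) ⟨k, z'⟩ = ⟨k, z'⟩ := by
    rw [positionSystem_nxt_pow]
    refine congrArg (Sigma.mk k) (Fin.ext ?_)
    simp only [z', zero_add, Nat.mod_self]
  have hdvd : (U.get k).toWord.length ∣ m := by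
    rw [positionSystem_nxt_pow] at hclosed
    have h1 : ((j : ℕ) + m) % (U.get k).toWord.length = j := by
      have := eq_of_heq (Sigma.mk.inj_iff.1 hclosed).2
      exact congrArg Fin.val this
    have h2 : (j : ℕ) + m ≡ j + 0 [MOD (U.get k).toWord.length] := by
      rw [Nat.ModEq, h1, add_zero, Nat.mod_eq_of_lt j.2]
    exact (Nat.modEq_zero_iff_dvd).1 (Nat.ModEq.add_left_cancel' _ h2)
  obtain ⟨t, rfl⟩ := hdvd
  have ht : t ≠ 0 := by
    rintro rfl
    simp at hpos
  refine ⟨U.get k, U.get_mem k, t, by exact_mod_cast ht, ?_⟩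
  have hu : (U.get k ^ (t : ℤ)).toWord = D.read ((U.get k).toWord.length * t) ⟨k, z'⟩ := by
    have h1 : U.get k = FreeGroup.mk (D.read (U.get k).toWord.length ⟨k, z'⟩) := by
      rw [positionSystem_read k z' rfl, FreeGroup.mk_toWord]
    rw [zpow_natCast]
    conv_lhs => rw [h1]
    rw [D.mk_read_pow hfix, D.toWord_read]
  rw [hu, hj]
  refine List.IsRotated.symm ⟨j, D.rotate_read ?_ _⟩
  rw [pow_mul]
  exact Function.IsFixedPt.perm_pow hfix t

end BoundaryWords

section CyclesOfWhiteheadGraph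

variable {n n' : ℕ} {E : Type*} {D : LineSystem n E} (h : n ≤ n')

theorem inc_iff_of_le {C : Graph (Fin n' × Bool) E} (hC : C ≤ D.whiteheadGraph h) {e : E}
    {x : Fin n × Bool} :
    C.Inc e (Prod.map (Fin.castLE h) id x) ↔ e ∈ E(C) ∧ (D.tl e = x ∨ D.hd e = x) := by
  constructor
  · rintro ⟨y, hy⟩
    exact ⟨hy.edge_mem, (LineSystem.inc_whiteheadGraph h).1 ⟨y, hC.2 hy⟩⟩
  · rintro ⟨he, hx⟩
    obtain ⟨a, b, hab⟩ := Graph.exists_isLink_of_mem_edgeSet he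
    rcases ((LineSystem.inc_whiteheadGraph h).2 hx).eq_or_eq_of_isLink (hC.2 hab) with h1 | h1
    · rw [h1]; exact hab.inc_left
    · rw [h1]; exact hab.inc_right

theorem connected_of_isCycleOf {C : Graph (Fin n' × Bool) E}
    (hC : IsCycleOf C (D.whiteheadGraph h)) {Q : E → Prop}
    (hQ : ∀ x e f, e ∈ E(C) → (D.tl e = x ∨ D.hd e = x) → f ∈ E(C) → (D.tl f = x ∨ D.hd f = x) →
      Q e → Q f) {e f : E} (he : e ∈ E(C)) (hf : f ∈ E(C)) (hQe : Q e) : Q f := by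
  have hend : ∀ g ∈ E(C), C.Inc g (Prod.map (Fin.castLE h) id (D.tl g)) := fun g hg =>
    (inc_iff_of_le h hC.1).2 ⟨hg, Or.inl rfl⟩
  have key : ∀ w, Relation.ReflTransGen C.Adj (Prod.map (Fin.castLE h) id (D.tl e)) w →
      ∀ g, C.Inc g w → Q g := by
    intro w hw
    induction hw with
    | refl =>
      intro g hg
      rw [inc_iff_of_le h hC.1] at hg
      exact hQ _ e g he (Or.inl rfl) hg.1 hg.2 hQe
    | @tail w w' _ hadj ih =>
      intro g hg
      obtain ⟨a, ha⟩ := hadj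
      have h1 := ih a ha.inc_left
      obtain ⟨x, rfl⟩ := LineSystem.exists_of_inc_whiteheadGraph h (hC.1.2 ha).inc_right
      have h2 := ha.inc_right
      rw [inc_iff_of_le h hC.1] at hg h2
      exact hQ x a g h2.1 h2.2 hg.1 hg.2 h1
  have h1 : Prod.map (Fin.castLE h) id (D.tl f) ∈
      component C (Prod.map (Fin.castLE h) id (D.tl e)) := by
    rw [hC.2.connected _ (hend e he).vertex_mem]
    exact (hend f hf).vertex_mem
  exact key _ h1.2 f (hend f hf)

variable [Fintype E] [DecidableEq E]

open Classical in
theorem card_edgesAt_of_isCycleOf {C : Graph (Fin n' × Bool) E}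
    (hC : IsCycleOf C (D.whiteheadGraph h)) {x : Fin n × Bool}
    (hx : Prod.map (Fin.castLE h) id x ∈ V(C)) :
    (D.edgesAt (Finset.univ.filter fun e => e ∈ E(C)) x).card = 2 := by
  have h1 := hC.2.two_regular _ hx
  have h2 : C.loopSet (Prod.map (Fin.castLE h) id x) = ∅ := by
    rw [Set.eq_empty_iff_forall_notMem]
    exact fun e he => LineSystem.not_isLoopAt_whiteheadGraph h e _ (hC.1.2 he)
  have h3 : C.incidenceSet (Prod.map (Fin.castLE h) id x) =
      (D.edgesAt (Finset.univ.filter fun e => e ∈ E(C)) x : Set E) := by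
    ext e
    rw [Graph.mem_incidenceSet, inc_iff_of_le h hC.1]
    simp [LineSystem.edgesAt, and_or_left]
  rwa [degree, h2, h3, Set.ncard_empty, add_zero, Set.ncard_coe_finset] at h1

open Classical in
theorem countBoth_eq_card {α β : Type*} (L : List (Graph α β)) (e f : β) :
    countBoth L e f =
      (Finset.univ.filter fun i : Fin L.length => e ∈ E(L.get i) ∧ f ∈ E(L.get i)).card := by
  rw [countBoth]
  conv_lhs => rw [← List.ofFn_get L, List.ofFn_eq_map, List.countP_map]
  rw [Finset.card_def, Finset.filter_val, ← Multiset.countP_eq_card_filter]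
  exact (Multiset.coe_countP _ _).symm

open Classical in
/-- A balanced list of cycles of the Whitehead graph. -/
noncomputable def cycleFamily {L : List (Graph (Fin n' × Bool) E)}
    (hL : ∀ C ∈ L, IsCycleOf C (D.whiteheadGraph h))
    (hbal : ∀ v ∈ V(D.whiteheadGraph h), ∀ e ∈ delta (D.whiteheadGraph h) v,
      ∀ f ∈ delta (D.whiteheadGraph h) v, e ≠ f →
        countBoth L e f = countBoth L (D.glueMap h v e) (D.glueMap h v f)) :
    CycleFamily D (Fin L.length) where
  edges i := Finset.univ.filter fun e => e ∈ E(L.get i)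
  card_edgesAt i x := by
    have hC := hL _ (L.get_mem i)
    by_cases hx : Prod.map (Fin.castLE h) id x ∈ V(L.get i)
    · exact Or.inr (card_edgesAt_of_isCycleOf h hC hx)
    · left
      rw [Finset.card_eq_zero, Finset.eq_empty_iff_forall_notMem]
      intro e he
      rw [LineSystem.edgesAt, Finset.mem_filter, Finset.mem_filter] at he
      exact hx ((inc_iff_of_le h hC.1).2 ⟨he.1.2, he.2⟩).vertex_mem
  connected i Q hQ e he f hf hQe := by
    simp only [Finset.mem_filter, Finset.mem_univ, true_and] at he hf
    refine connected_of_isCycleOf h (hL _ (L.get_mem i)) (Q := Q) ?_ he hf hQe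
    intro x e f he hex hf hfx
    refine hQ x e ?_ f ?_
    · simpa [LineSystem.edgesAt] using ⟨he, hex⟩
    · simpa [LineSystem.edgesAt] using ⟨hf, hfx⟩
  balanced x e f he hf hef := by
    have h1 := hbal (Prod.map (Fin.castLE h) id x) trivial e
      ((LineSystem.mem_delta_whiteheadGraph h).2 ((LineSystem.inc_whiteheadGraph h).2 he)) f
      ((LineSystem.mem_delta_whiteheadGraph h).2 ((LineSystem.inc_whiteheadGraph h).2 hf)) hef
    rw [LineSystem.glueMap_apply, LineSystem.glueMap_apply, countBoth_eq_card,
      countBoth_eq_card] at h1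
    simpa only [Finset.mem_filter, Finset.mem_univ, true_and] using h1

end CyclesOfWhiteheadGraph

theorem tilingConjecture_of_graphConjecture {n n' : ℕ} (h2 : 2 ≤ n) (hn : n ≤ n')
    (h : GraphConjecture (2 * n')) : TilingConjecture n := by
  classical
  intro U hU hmin hdb
  set D := positionSystem U hU with hD
  have hcut : D.CutCondition := cutCondition_of_isMinimal hmin
  have hconn : ∀ X : Set (Fin n × Bool), (∀ e, D.tl e ∈ X ↔ D.hd e ∈ X) → X = ∅ ∨ X = Set.univ :=
    fun X hX => eq_empty_or_univ_of_isDiskbusting h2 hcut hdb hX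
  have hG := LineSystem.isMatched_whiteheadGraph hn hcut
  obtain ⟨v, hv⟩ := LineSystem.two_mul_le_ncard_component hn (by omega) hconn
  obtain ⟨L, -, hL, hbal, hlong⟩ := h (Fin n' × Bool) (Position U) (D.whiteheadGraph hn)
    (Set.toFinite (Set.univ : Set (Fin n' × Bool))) (Set.toFinite (Set.univ : Set (Position U)))
    (by
      change (Set.univ : Set (Fin n' × Bool)).ncard = _
      rw [Set.ncard_univ, Nat.card_eq_fintype_card, Fintype.card_prod, Fintype.card_fin,
        Fintype.card_bool, mul_comm])
    (LineSystem.exists_isCycleOf_whiteheadGraph hn hcut h2 hconn) letterInv (D.glueMap hn)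
    hG.inv hG.bij hG.conn hG.symm
  -- The letters of `F_n` lie in one component, with at least `2 * n ≥ 4` vertices, so the list
  -- contains a cycle of length greater than two.
  obtain ⟨C, hCL, hC⟩ := hlong ⟨v, trivial, by omega⟩
  let F := cycleFamily hn hL hbal
  have hcard : ∀ i : Fin L.length, (F.edges i).card = E(L.get i).ncard := by
    intro i
    rw [← Set.ncard_coe_finset]
    congr 1
    ext e
    change e ∈ ((Finset.univ.filter fun e => e ∈ E(L.get i) : Finset _) : Set _) ↔ _
    simp
  obtain ⟨i, rfl⟩ := List.get_of_mem hCL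
  obtain ⟨S, ℓ, c, hmap, hinj, hc, hnext, hχ⟩ := F.exists_surface (fun i => by
      obtain ⟨w, hw⟩ := (hL _ (L.get_mem i)).2.nonempty
      have h1 := (hL _ (L.get_mem i)).2.two_regular w hw
      have h3 : (L.get i).loopSet w = ∅ := by
        rw [Set.eq_empty_iff_forall_notMem]
        exact fun e he => LineSystem.not_isLoopAt_whiteheadGraph hn e _
          ((hL _ (L.get_mem i)).1.2 he)
      rw [degree, h3, Set.ncard_empty, add_zero] at h1
      obtain ⟨e, he⟩ : ((L.get i).incidenceSet w).Nonempty := by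
        rw [Set.nonempty_iff_ne_empty]
        intro h0
        rw [h0, Set.ncard_empty] at h1
        omega
      exact ⟨e, Finset.mem_filter.2 ⟨Finset.mem_univ e, Graph.Inc.edge_mem he⟩⟩)
    ⟨i, by rw [hcard]; exact hC⟩
  exact ⟨S, ℓ, hmap, hinj, fun i => exists_boundaryWord_isRotated hc hnext i, hχ⟩

end TilingConj

theorem mainTheorem8 (n' : ℕ) (hn' : 1 < n') :
    (∀ n : ℕ, 2 ≤ n → n ≤ n' → TilingConj.TilingConjecture n) ↔
      TilingConj.GraphConjecture (2 * n') := by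
  refine ⟨TilingConj.graphConjecture_of_tilingConjecture, fun h n h2 hn => ?_⟩
  exact TilingConj.tilingConjecture_of_graphConjecture h2 hn h
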